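/- Let $X$ be a (Hausdorff, finite-dimensional) smooth manifold and $n\ge 0$. Let $\mathrm{Af}_n(\mathbb C)\subset \mathrm{GL}_{n+1}(\mathbb C)$ be the group of the matrices $\begin{pmatrix}A&t\\0&1\end{pmatrix}$ with $A\in \mathrm{GL}_n(\mathbb C)$ and $t\in\mathbb C^n$. A flat affine bundle over $X$ is a smooth principal $\mathrm{Af}_n(\mathbb C)$-bundle $A\to X$ with a flat connection $\omega$, that is, a smooth connection $1$-form $\omega$ on $A$ with values in the Lie algebra of $\mathrm{Af}_n(\mathbb C)$ and $d\omega+\tfrac12[\omega\wedge\omega]=0$. A morphism of flat affine bundles is a morphism $f:A\to A'$ of principal bundles over the identity of $X$ with $f^*\omega'=\omega$. Let $\mathit{FlatExtn}$ be the category whose objects are short exact sequences $0\to E\to F\to O_X\to 0$ of smooth complex vector bundles over $X$, where $\operatorname{rk}E=n$, $\operatorname{rk}F=n+1$ and $O_X=X\times\mathbb C$ is the trivial line bundle, together with a flat connection $D_F$ on $F$ that preserves $E$ and induces the trivial connection $d$ on $O_X$. A morphism is a pair $(\varphi,\psi)$ of smooth vector bundle isomorphisms $\varphi:E\to E'$,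 $\psi:F\to F'$ over the identity of $X$, compatible with the maps $E\to F$ and $E'\to F'$ and with the projections to $O_X$ (with the identity on $O_X$), such that $\psi^*D_{F'}=D_F$, that is, $D_{F'}(\psi s)=\psi(D_Fs)$ for all sections $s$ of $F$. **Lemma.** The category of flat affine bundles over $X$ is equivalent to $\mathit{FlatExtn}$. More precisely, there is an equivalence which sends $(A,\omega)$ to the associated bundle $F=A\times_{\mathrm{Af}_n(\mathbb C)}\mathbb C^{n+1}$, with the projection $F\to O_X$ induced by the last coordinate of $\mathbb C^{n+1}$ (so that $E$ is the subbundle coming from $\mathbb C^n\times\{0\}$) and with the connection $D_F$ induced by $\omega$ (if a section $s$ corresponds to the equivariant function $S:A\to\mathbb C^{n+1}$, then $D_Fs$ corresponds to $dS+\omega S$), and which sends a morphism $f$ to a morphism with $\psi([p,w])=[f(p),w]$ for $p\in A$, $w\in\mathbb C^{n+1}$. -/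

import Mathlib

open Matrix Topology Bundle CategoryTheory
open scoped Manifold ContDiff

universe u v

noncomputable section

namespace FlatAffine

/-! ### The affine group -/

/-- The affine group `Af_n(ℂ)`: the subgroup of `GL_{n+1}(ℂ)` of the matrices with last row
`(0, …, 0, 1)`. -/
def Af (n : ℕ) : Subgroup (GL (Fin (n + 1)) ℂ) where
  carrier := {g | ∀ j, (g : Matrix (Fin (n + 1)) (Fin (n + 1)) ℂ) (Fin.last n) j =
    (1 : Matrix (Fin (n + 1)) (Fin (n + 1)) ℂ) (Fin.last n) j}
  one_mem' _ := rfl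
  mul_mem' {a b} ha hb j := by
    simp only [Set.mem_ofPred_eq] at ha hb
    simp [Matrix.mul_apply, ha, hb, Matrix.one_apply]
  inv_mem' {a} ha j := by
    have h := congrFun (congrFun (a.mul_inv) (Fin.last n)) j
    simp only [Set.mem_ofPred_eq] at ha
    rw [← h]
    simp [Matrix.mul_apply, ha, Matrix.one_apply]

/-- The Lie algebra of `Af_n(ℂ)`, which is also the affine space in which `Af_n(ℂ)` is open:
the `n × (n + 1)` matrices `(B b)`, made of the first `n` rows. -/
abbrev AfLie (n : ℕ) : Type := Fin n → Fin (n + 1) → ℂ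

/-- An element `(B b)` of the Lie algebra as the square matrix with rows `(B b)` and `(0 0)`. -/
def AfLie.toMatrix {n : ℕ} (ξ : AfLie n) : Matrix (Fin (n + 1)) (Fin (n + 1)) ℂ :=
  Matrix.of (Fin.snoc (α := fun _ => Fin (n + 1) → ℂ) ξ 0)

/-- The global coordinates `(A t)` on `Af_n(ℂ)`: the first `n` rows of the matrix. -/
def Af.coord {n : ℕ} (g : Af n) : AfLie n :=
  fun i j => (g.1 : Matrix (Fin (n + 1)) (Fin (n + 1)) ℂ) i.castSucc j

theorem Af.isOpenEmbedding_coord (n : ℕ) : IsOpenEmbedding (Af.coord (n := n)) := by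
  classical
  let M : AfLie n → Matrix (Fin (n + 1)) (Fin (n + 1)) ℂ := fun ξ =>
    Matrix.of (Fin.snoc (α := fun _ => Fin (n + 1) → ℂ) ξ
      ((1 : Matrix (Fin (n + 1)) (Fin (n + 1)) ℂ) (Fin.last n)))
  have hM : Continuous M := by
    refine continuous_matrix fun i j => ?_
    refine Fin.lastCases ?_ (fun i => ?_) i
    · simpa [M] using continuous_const
    · simpa [M] using (continuous_apply_apply i j)
  have hMc : ∀ g : Af n, M (Af.coord g) = g.1 := by
    intro g
    ext i j
    refine Fin.lastCases ?_ (fun i => ?_) i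
    · simpa [M] using (g.2 j).symm
    · simp [M, Af.coord]
  have hcont : Continuous (Af.coord (n := n)) := by
    refine continuous_pi fun i => continuous_pi fun j => ?_
    exact (Units.continuous_val.comp continuous_subtype_val).matrix_elem i.castSucc j
  have hinj : Function.Injective (Af.coord (n := n)) := fun g h hgh =>
    Subtype.ext (Units.ext (by rw [← hMc g, ← hMc h, hgh]))
  have hdet : IsOpen {ξ : AfLie n | (M ξ).det ≠ 0} :=
    isOpen_ne_fun hM.matrix_det continuous_const
  have hrange : Set.range (Af.coord (n := n)) = {ξ : AfLie n | (M ξ).det ≠ 0} := by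
    ext ξ
    constructor
    · rintro ⟨g, rfl⟩
      have : IsUnit (g.1 : Matrix (Fin (n + 1)) (Fin (n + 1)) ℂ).det :=
        (Matrix.isUnit_iff_isUnit_det _).1 g.1.isUnit
      change (M (Af.coord g)).det ≠ 0
      rw [hMc]
      exact this.ne_zero
    · intro h
      refine ⟨⟨Matrix.GeneralLinearGroup.mkOfDetNeZero (M ξ) h, fun j => ?_⟩, ?_⟩
      · simp [Matrix.GeneralLinearGroup.mkOfDetNeZero, M]
      · ext i j
        simp [Matrix.GeneralLinearGroup.mkOfDetNeZero, M, Af.coord]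
  have hind : IsInducing (Af.coord (n := n)) := by
    refine isInducing_iff_nhds.2 fun g => le_antisymm hcont.continuousAt.le_comap ?_
    rw [(Units.isInducing_embedProduct.comp IsInducing.subtypeVal).nhds_eq_comap,
      ← Filter.tendsto_iff_comap]
    have hg : (M (Af.coord g)).det ≠ 0 := by
      have : Af.coord g ∈ Set.range (Af.coord (n := n)) := ⟨g, rfl⟩
      rwa [hrange] at this
    have h1 : ContinuousAt (fun ξ : AfLie n => (M ξ)) (Af.coord g) := hM.continuousAt
    have h2 : ContinuousAt (fun ξ : AfLie n => MulOpposite.op ((M ξ)⁻¹)) (Af.coord g) := by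
      simp only [Matrix.inv_def, Ring.inverse_eq_inv']
      exact MulOpposite.continuous_op.continuousAt.comp
        ((hM.matrix_det.continuousAt.inv₀ hg).smul hM.matrix_adjugate.continuousAt)
    have h3 := (h1.prodMk h2).tendsto.comp (Filter.tendsto_comap (f := Af.coord (n := n)))
    have he : (fun ξ : AfLie n => (M ξ, MulOpposite.op ((M ξ)⁻¹))) ∘ Af.coord (n := n) =
        Units.embedProduct _ ∘ Subtype.val := by
      funext h
      simp [hMc, Matrix.coe_units_inv]
    rw [he] at h3
    have hg' := congrFun he g
    simp only [Function.comp_apply] at hg'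
    rw [hg'] at h3
    exact h3
  exact ⟨⟨hind, hinj⟩, hrange ▸ hdet⟩

/-- The smooth structure of `Af_n(ℂ)`, given by the single chart `Af.coord`. -/
instance (n : ℕ) : ChartedSpace (AfLie n) (Af n) :=
  (Af.isOpenEmbedding_coord n).singletonChartedSpace

instance (n : ℕ) : IsManifold 𝓘(ℝ, AfLie n) ∞ (Af n) :=
  (Af.isOpenEmbedding_coord n).isManifold_singleton

/-- The action of the affine group on `ℂ^{n+1}`. -/
def Af.mulVec {n : ℕ} (g : Af n) (w : Fin (n + 1) → ℂ) : Fin (n + 1) → ℂ :=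
  (g.1 : Matrix (Fin (n + 1)) (Fin (n + 1)) ℂ) *ᵥ w

variable (V : Type v) [NormedAddCommGroup V] [NormedSpace ℝ V]
  (X : Type u) [TopologicalSpace X] [ChartedSpace V X]

/-! ### Flat affine bundles -/

/-- The model of the total space of a principal `Af_n(ℂ)`-bundle over a manifold modelled
on `V`. -/
abbrev totalModel (n : ℕ) : ModelWithCorners ℝ (V × AfLie n) (ModelProd V (AfLie n)) :=
  𝓘(ℝ, V).prod 𝓘(ℝ, AfLie n)

/-- A smooth affine bundle over `X`: a smooth principal `Af_n(ℂ)`-bundle. The group acts on the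
right, `MulOpposite.op g • p` being `p · g`. -/
structure AffineBundle (n : ℕ) where
  /-- The total space. -/
  carrier : Type u
  [top : TopologicalSpace carrier]
  [charted : ChartedSpace (ModelProd V (AfLie n)) carrier]
  [manifold : IsManifold (totalModel V n) ∞ carrier]
  [action : MulAction (Af n)ᵐᵒᵖ carrier]
  /-- The projection to the base. -/
  proj : carrier → X
  contMDiff_proj : ContMDiff (totalModel V n) 𝓘(ℝ, V) ∞ proj
  contMDiff_action : ContMDiff ((totalModel V n).prod 𝓘(ℝ, AfLie n)) (totalModel V n) ∞
    (fun q : carrier × Af n => MulOpposite.op q.2 • q.1)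
  proj_action : ∀ (g : Af n) (p : carrier), proj (MulOpposite.op g • p) = proj p
  locally_trivial : ∀ x : X, ∃ e : Trivialization (Af n) proj, x ∈ e.baseSet ∧
    ContMDiffOn (totalModel V n) (𝓘(ℝ, V).prod 𝓘(ℝ, AfLie n)) ∞ e e.source ∧
    ContMDiffOn (𝓘(ℝ, V).prod 𝓘(ℝ, AfLie n)) (totalModel V n) ∞
      e.toOpenPartialHomeomorph.symm e.target ∧
    ∀ p ∈ e.source, ∀ g : Af n, e (MulOpposite.op g • p) = ((e p).1, (e p).2 * g)

attribute [instance] AffineBundle.top AffineBundle.charted AffineBundle.manifold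
  AffineBundle.action

variable {V X}

/-- A connection on a principal `Af_n(ℂ)`-bundle, as a smooth 1-form on the total space with values
in the Lie algebra, which reproduces the generators of the action and satisfies
`R_g^* ω = Ad(g⁻¹) ω`. -/
structure PrincipalConnection {n : ℕ} (A : AffineBundle.{u, v} V X n) where
  form : ∀ p : A.carrier, TangentSpace (totalModel V n) p →L[ℝ] AfLie n
  contMDiff_form : ContMDiff (totalModel V n).tangent 𝓘(ℝ, AfLie n) ∞
    (fun w : TangentBundle (totalModel V n) A.carrier => form w.proj w.snd)
  vertical : ∀ (p : A.carrier) (ξ : TangentSpace 𝓘(ℝ, AfLie n) (1 : Af n)),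
    form (MulOpposite.op (1 : Af n) • p)
      (mfderiv 𝓘(ℝ, AfLie n) (totalModel V n) (fun g : Af n => MulOpposite.op g • p) 1 ξ) =
      (ξ : AfLie n)
  equivariant : ∀ (g : Af n) (p : A.carrier) (w : TangentSpace (totalModel V n) p),
    (form (MulOpposite.op g • p) (mfderiv (totalModel V n) (totalModel V n)
      (fun q : A.carrier => MulOpposite.op g • q) p w)).toMatrix =
    ((g⁻¹ : Af n).1 : Matrix (Fin (n + 1)) (Fin (n + 1)) ℂ) * (form p w).toMatrix *
      (g.1 : Matrix (Fin (n + 1)) (Fin (n + 1)) ℂ)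

/-- The curvature `dω + ½ [ω ∧ ω]` of `ω = C.form` evaluated on two vector fields:
`Y(ω(Z)) - Z(ω(Y)) - ω([Y, Z]) + [ω(Y), ω(Z)]`. -/
def PrincipalConnection.curvature {n : ℕ} {A : AffineBundle.{u, v} V X n}
    (C : PrincipalConnection A) (Y Z : ∀ p : A.carrier, TangentSpace (totalModel V n) p)
    (p : A.carrier) : Matrix (Fin (n + 1)) (Fin (n + 1)) ℂ :=
  AfLie.toMatrix (mvfderiv (totalModel V n) (fun q => C.form q (Z q)) p (Y p)) -
  AfLie.toMatrix (mvfderiv (totalModel V n) (fun q => C.form q (Y q)) p (Z p)) -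
  AfLie.toMatrix (C.form p (VectorField.mlieBracket (totalModel V n) Y Z p)) +
  ((C.form p (Y p)).toMatrix * (C.form p (Z p)).toMatrix -
    (C.form p (Z p)).toMatrix * (C.form p (Y p)).toMatrix)

/-- Flatness: the curvature vanishes on all smooth vector fields over open sets. -/
def PrincipalConnection.IsFlat {n : ℕ} {A : AffineBundle.{u, v} V X n}
    (C : PrincipalConnection A) : Prop :=
  ∀ (U : Set A.carrier), IsOpen U →
    ∀ Y Z : (∀ p : A.carrier, TangentSpace (totalModel V n) p),
    ContMDiffOn (totalModel V n) (totalModel V n).tangent ∞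
      (fun p => (⟨p, Y p⟩ : TangentBundle (totalModel V n) A.carrier)) U →
    ContMDiffOn (totalModel V n) (totalModel V n).tangent ∞
      (fun p => (⟨p, Z p⟩ : TangentBundle (totalModel V n) A.carrier)) U →
    ∀ p ∈ U, C.curvature Y Z p = 0

variable (V X) in
/-- A flat affine bundle: an affine bundle with a flat connection. -/
structure FlatAffineBundle (n : ℕ) extends AffineBundle.{u, v} V X n where
  conn : PrincipalConnection toAffineBundle
  flat : conn.IsFlat

/-- A morphism of flat affine bundles: a morphism of principal bundles over the identity of `X`
which pulls the connection of the target back to the connection of the source. -/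
@[ext]
structure FlatAffineBundle.Hom {n : ℕ} (A B : FlatAffineBundle.{u, v} V X n) where
  toFun : A.carrier → B.carrier
  contMDiff_toFun : ContMDiff (totalModel V n) (totalModel V n) ∞ toFun
  proj_toFun : ∀ p, B.proj (toFun p) = A.proj p
  map_action : ∀ (g : Af n) (p : A.carrier),
    toFun (MulOpposite.op g • p) = MulOpposite.op g • toFun p
  pullback_form : ∀ (p : A.carrier) (w : TangentSpace (totalModel V n) p),
    B.conn.form (toFun p) (mfderiv (totalModel V n) (totalModel V n) toFun p w) = A.conn.form p w

/-- The category of flat affine bundles over `X`. -/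
instance (n : ℕ) : Category (FlatAffineBundle.{u, v} V X n) where
  Hom A B := FlatAffineBundle.Hom A B
  id A :=
    { toFun := id
      contMDiff_toFun := contMDiff_id
      proj_toFun := fun _ => rfl
      map_action := fun _ _ => rfl
      pullback_form := fun p w => by simp [mfderiv_id] }
  comp {A B C} f g :=
    { toFun := g.toFun ∘ f.toFun
      contMDiff_toFun := g.contMDiff_toFun.comp f.contMDiff_toFun
      proj_toFun := fun p => by simp [g.proj_toFun, f.proj_toFun]
      map_action := fun a p => by simp [g.map_action, f.map_action]
      pullback_form := fun p w => by
        rw [mfderiv_comp p (g.contMDiff_toFun.mdifferentiable (by simp) _)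
          (f.contMDiff_toFun.mdifferentiable (by simp) _)]
        simpa [f.pullback_form] using g.pullback_form (f.toFun p)
          (mfderiv (totalModel V n) (totalModel V n) f.toFun p w) }

/-! ### Flat extensions -/

variable (V X) in
/-- A smooth complex vector bundle of rank `r` on the real manifold `X`: a fibre bundle with fibre
`ℂ^r` whose local trivializations are `ℂ`-linear on the fibres and whose transition functions are
smooth (over `ℝ`). The fibres are taken in `Type`; as they are isomorphic to `ℂ^r`, this is no
restriction up to isomorphism. -/
structure ComplexVectorBundle (r : ℕ) where
  fib : X → Type
  [addCommGroup : ∀ x, AddCommGroup (fib x)]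
  [module : ∀ x, Module ℂ (fib x)]
  [top : ∀ x, TopologicalSpace (fib x)]
  [topAddGroup : ∀ x, IsTopologicalAddGroup (fib x)]
  [contSMul : ∀ x, ContinuousSMul ℝ (fib x)]
  [topTotal : TopologicalSpace (TotalSpace (Fin r → ℂ) fib)]
  [fiberBundle : FiberBundle (Fin r → ℂ) fib]
  [vectorBundleComplex : VectorBundle ℂ (Fin r → ℂ) fib]
  [vectorBundleReal : VectorBundle ℝ (Fin r → ℂ) fib]
  [contMDiff : ContMDiffVectorBundle ∞ (Fin r → ℂ) fib 𝓘(ℝ, V)]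

attribute [instance] ComplexVectorBundle.addCommGroup ComplexVectorBundle.module
  ComplexVectorBundle.top ComplexVectorBundle.topAddGroup ComplexVectorBundle.contSMul
  ComplexVectorBundle.topTotal ComplexVectorBundle.fiberBundle
  ComplexVectorBundle.vectorBundleComplex ComplexVectorBundle.vectorBundleReal
  ComplexVectorBundle.contMDiff

/-- The total space of a complex vector bundle. -/
abbrev ComplexVectorBundle.Total {r : ℕ} (E : ComplexVectorBundle.{u, v} V X r) : Type u :=
  TotalSpace (Fin r → ℂ) E.fib

/-- The model of the total space of a complex vector bundle of rank `r`. -/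
abbrev bundleModel (V : Type v) [NormedAddCommGroup V] [NormedSpace ℝ V] (r : ℕ) :
    ModelWithCorners ℝ (V × (Fin r → ℂ)) (ModelProd V (Fin r → ℂ)) :=
  𝓘(ℝ, V).prod 𝓘(ℝ, Fin r → ℂ)

variable (V X) in
/-- A smooth extension `0 → E → F → O_X → 0`, with `rk E = n` and `rk F = n + 1`. A morphism from
`F` to the trivial line bundle `O_X = X × ℂ` is a smooth function `F → ℂ` that is linear on the
fibres. -/
structure Extn (n : ℕ) where
  E : ComplexVectorBundle.{u, v} V X n
  F : ComplexVectorBundle.{u, v} V X (n + 1)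
  incl : ∀ x, E.fib x →ₗ[ℂ] F.fib x
  contMDiff_incl : ContMDiff (bundleModel V n) (bundleModel V (n + 1)) ∞
    (fun e : E.Total => (⟨e.proj, incl e.proj e.snd⟩ : F.Total))
  quot : ∀ x, F.fib x →ₗ[ℂ] ℂ
  contMDiff_quot : ContMDiff (bundleModel V (n + 1)) 𝓘(ℝ, ℂ) ∞
    (fun e : F.Total => quot e.proj e.snd)
  incl_injective : ∀ x, Function.Injective (incl x)
  exact : ∀ x, Function.Exact (incl x) (quot x)
  quot_surjective : ∀ x, Function.Surjective (quot x)

/-- The section `s` of `F` is differentiable at `x`. -/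
def ComplexVectorBundle.DiffAt {r : ℕ} (F : ComplexVectorBundle.{u, v} V X r)
    (s : ∀ x, F.fib x) (x : X) : Prop :=
  MDifferentiableAt 𝓘(ℝ, V) (bundleModel V r) (fun y => (⟨y, s y⟩ : F.Total)) x

/-- A smooth `ℂ`-linear connection `D` on a complex vector bundle; `cov s x w` is `(D_w s)(x)`. -/
structure Connection [IsManifold 𝓘(ℝ, V) ∞ X] {r : ℕ} (F : ComplexVectorBundle.{u, v} V X r) where
  cov : CovariantDerivative 𝓘(ℝ, V) (Fin r → ℂ) F.fib
  contMDiff_cov : cov.ContMDiffCovariantDerivative ∞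
  smul : ∀ (c : ℂ) (s : ∀ x, F.fib x) (x : X), F.DiffAt s x →
    ∀ w : TangentSpace 𝓘(ℝ, V) x, cov (fun y => c • s y) x w = c • cov s x w

/-- Flatness `D² = 0`: one has `D_Y D_Z s - D_Z D_Y s - D_{[Y, Z]} s = 0` for all smooth vector
fields `Y`, `Z` and smooth sections `s` over open sets. -/
def Connection.IsFlat [IsManifold 𝓘(ℝ, V) ∞ X] {r : ℕ} {F : ComplexVectorBundle.{u, v} V X r}
    (D : Connection F) : Prop :=
  ∀ U : Set X, IsOpen U → ∀ (Y Z : ∀ x : X, TangentSpace 𝓘(ℝ, V) x) (s : ∀ x, F.fib x),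
    ContMDiffOn 𝓘(ℝ, V) 𝓘(ℝ, V).tangent ∞ (fun x => (⟨x, Y x⟩ : TangentBundle 𝓘(ℝ, V) X)) U →
    ContMDiffOn 𝓘(ℝ, V) 𝓘(ℝ, V).tangent ∞ (fun x => (⟨x, Z x⟩ : TangentBundle 𝓘(ℝ, V) X)) U →
    ContMDiffOn 𝓘(ℝ, V) (bundleModel V r) ∞ (fun x => (⟨x, s x⟩ : F.Total)) U →
    ∀ x ∈ U, D.cov (fun y => D.cov s y (Z y)) x (Y x) - D.cov (fun y => D.cov s y (Y y)) x (Z x) -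
      D.cov s x (VectorField.mlieBracket 𝓘(ℝ, V) Y Z x) = 0

variable (V X) in
/-- An extension with a flat connection on `F` that preserves `E` and induces the trivial
connection `d` on `O_X`. -/
structure FlatExtn [IsManifold 𝓘(ℝ, V) ∞ X] (n : ℕ) extends Extn.{u, v} V X n where
  conn : Connection F
  flat : conn.IsFlat
  preserves : ∀ (s : ∀ x, E.fib x) (x : X), E.DiffAt s x → ∀ w : TangentSpace 𝓘(ℝ, V) x,
    conn.cov (fun y => incl y (s y)) x w ∈ LinearMap.range (incl x)
  induces_trivial : ∀ (s : ∀ x, F.fib x) (x : X), F.DiffAt s x → ∀ w : TangentSpace 𝓘(ℝ, V) x,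
    quot x (conn.cov s x w) = mvfderiv 𝓘(ℝ, V) (fun y => quot y (s y)) x w

variable [IsManifold 𝓘(ℝ, V) ∞ X]

/-- A morphism of flat extensions: a pair `(φ, ψ)` of isomorphisms of smooth vector bundles,
compatible with the inclusions and with the projections to `O_X` (with the identity on `O_X`), such
that `ψ^* D' = D`, that is, `D' (ψ s) = ψ (D s)` for all sections `s`. -/
@[ext]
structure FlatExtn.Hom {n : ℕ} (A B : FlatExtn.{u, v} V X n) where
  φ : ∀ x, A.E.fib x ≃ₗ[ℂ] B.E.fib x
  ψ : ∀ x, A.F.fib x ≃ₗ[ℂ] B.F.fib x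
  contMDiff_φ : ContMDiff (bundleModel V n) (bundleModel V n) ∞
    (fun e : A.E.Total => (⟨e.proj, φ e.proj e.snd⟩ : B.E.Total))
  contMDiff_ψ : ContMDiff (bundleModel V (n + 1)) (bundleModel V (n + 1)) ∞
    (fun e : A.F.Total => (⟨e.proj, ψ e.proj e.snd⟩ : B.F.Total))
  comm_incl : ∀ x e, ψ x (A.incl x e) = B.incl x (φ x e)
  comm_quot : ∀ x e, B.quot x (ψ x e) = A.quot x e
  pullback_conn : ∀ (s : ∀ x, A.F.fib x) (x : X), A.F.DiffAt s x →
    ∀ w : TangentSpace 𝓘(ℝ, V) x,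
      B.conn.cov (fun y => ψ y (s y)) x w = ψ x (A.conn.cov s x w)

/-- The category of flat extensions. -/
instance (n : ℕ) : Category (FlatExtn.{u, v} V X n) where
  Hom A B := FlatExtn.Hom A B
  id A :=
    { φ := fun x => LinearEquiv.refl ℂ _
      ψ := fun x => LinearEquiv.refl ℂ _
      contMDiff_φ := contMDiff_id
      contMDiff_ψ := contMDiff_id
      comm_incl := fun _ _ => rfl
      comm_quot := fun _ _ => rfl
      pullback_conn := fun _ _ _ _ => rfl }
  comp {A B C} f g :=
    { φ := fun x => (f.φ x).trans (g.φ x)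
      ψ := fun x => (f.ψ x).trans (g.ψ x)
      contMDiff_φ := g.contMDiff_φ.comp f.contMDiff_φ
      contMDiff_ψ := g.contMDiff_ψ.comp f.contMDiff_ψ
      comm_incl := fun x e => by simp [f.comm_incl, g.comm_incl]
      comm_quot := fun x e => by simp [f.comm_quot, g.comm_quot]
      pullback_conn := fun s x hs w => by
        have h : B.F.DiffAt (fun y => f.ψ y (s y)) x :=
          (f.contMDiff_ψ.mdifferentiable (by simp) _).comp x hs
        have h' := g.pullback_conn _ x h w
        rw [f.pullback_conn s x hs w] at h'
        exact h' }

/-! ### The associated extension -/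

/-- The data exhibiting the flat extension `B` as the one associated with the flat affine bundle
`A` by the inclusion `Af_n(ℂ) ⊂ GL_{n+1}(ℂ)`. A point `p` of `A` over `x` gives a frame
`w ↦ [p, w]` of `F_x`, such that `[p · g, w] = [p, g w]`, such that `F → O_X` is the last coordinate
(so that `E` corresponds to `ℂ^n ⊂ ℂ^{n+1}`), and such that the connection on `F` is the one induced
by `ω`: if the section `s` of `F` is given by the equivariant function `S : A → ℂ^{n+1}`,
`s(π(p)) = [p, S(p)]`, then `D s` is given by `dS + ω S`. -/
structure AssociatedExtn {n : ℕ} (A : FlatAffineBundle.{u, v} V X n)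
    (B : FlatExtn.{u, v} V X n) where
  frame : ∀ (x : X) (p : A.carrier), A.proj p = x → ((Fin (n + 1) → ℂ) ≃ₗ[ℂ] B.F.fib x)
  contMDiff_frame : ContMDiff ((totalModel V n).prod 𝓘(ℝ, Fin (n + 1) → ℂ))
    (bundleModel V (n + 1)) ∞
    (fun q : A.carrier × (Fin (n + 1) → ℂ) =>
      (⟨A.proj q.1, frame (A.proj q.1) q.1 rfl q.2⟩ : B.F.Total))
  frame_action : ∀ (x : X) (p : A.carrier) (hp : A.proj p = x) (g : Af n) (w : Fin (n + 1) → ℂ),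
    frame x (MulOpposite.op g • p) ((A.proj_action g p).trans hp) w = frame x p hp (Af.mulVec g w)
  quot_frame : ∀ (x : X) (p : A.carrier) (hp : A.proj p = x) (w : Fin (n + 1) → ℂ),
    B.quot x (frame x p hp w) = w (Fin.last n)
  conn_frame : ∀ (s : ∀ x, B.F.fib x) (p : A.carrier), B.F.DiffAt s (A.proj p) →
    ∀ w : TangentSpace (totalModel V n) p,
      B.conn.cov s (A.proj p) (mfderiv (totalModel V n) 𝓘(ℝ, V) A.proj p w) =
      frame (A.proj p) p rfl
        (mvfderiv (totalModel V n) (fun q => (frame (A.proj q) q rfl).symm (s (A.proj q))) p w +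
          (A.conn.form p w).toMatrix *ᵥ (frame (A.proj p) p rfl).symm (s (A.proj p)))

end FlatAffine

end

/-! A point `p` of an affine bundle amounts to a frame `w ↦ [p, w]` of `F` in which the projection
to `O_X` is the last coordinate. Conversely, two such frames of one fibre differ by a complex
automorphism of `ℂ^{n+1}` preserving the last coordinate, and these automorphisms form exactly
`Af_n(ℂ)` (`Af.exists_rep_eq`). Since `E` is the kernel of the projection, the principal bundle and
the extension carry the same information. `FrameData` records the relation between the two without
fixing a model of the associated bundle. Most statements are proved for arbitrary frame data and
then applied to two cases: the associated extension `assocExtn` of a bundle and the bundle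
`frameBundle` of adapted frames of an extension.

For the connections, let `θ` be the pullback of `ω` along a local section and `γ` the group
coordinate of the resulting trivialization. Then `γ ω = (π^*θ) γ + dγ`
(`PrincipalConnection.coord_mul_opForm`), and in the corresponding gauge `D = d + θ`. This relation
does three things. It shows that `dS + ω S` descends to a connection on `F`. Solved for `ω`, it
recovers the connection form from `D`; the result has zero last row, hence lies in the Lie algebra,
because `D` induces `d` on `O_X`. And it is a gauge transformation, which conjugates the curvature
(`vcurv_gauge`), so `ω` is flat if and only if `D` is (`FrameData.Compatible.isFlat_iff`).

Morphisms correspond by `ψ [p, w] = [f p, w]`. Given `ψ`, the image under `ψ` of the frame at `p` is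
an adapted frame of the target, hence the frame at a unique point `f p`. Computing `D' (ψ s)`
produces `f^*ω'` in place of `ω` (`FrameData.cov_map`), and a form is determined by the connection
it induces (`FrameData.eq_of_frame_eq`), so `ψ^*D' = D` and `f^*ω' = ω` are equivalent. The map `φ`
is the restriction of `ψ` to the kernels. This gives full faithfulness. Essential surjectivity holds
because an extension is associated with its own frame bundle, and extensions associated with the
same bundle are isomorphic.

The calculus is done in the real normed algebra of operators on `ℂ^{n+1}`, into which `Af.rep` and
`AfLie.op` embed the group and its Lie algebra. -/

noncomputable section

namespace FlatAffine

/-! ### Smoothness of families of linear maps -/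

section LinearFamilies

variable {E H M : Type*} [NormedAddCommGroup E] [NormedSpace ℝ E] [TopologicalSpace H]
  {I : ModelWithCorners ℝ E H} [TopologicalSpace M] [ChartedSpace H M]
  {W₁ W₂ : Type*} [NormedAddCommGroup W₁] [NormedSpace ℝ W₁] [NormedAddCommGroup W₂]
  [NormedSpace ℝ W₂] [FiniteDimensional ℝ W₁] {k : ℕ∞ω}

/-- A family of linear maps on a finite-dimensional space is smooth if it is pointwise smooth. -/
theorem contMDiffWithinAt_clm_of_apply {T : M → W₁ →L[ℝ] W₂} {s : Set M} {m : M}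
    (h : ∀ w, ContMDiffWithinAt I 𝓘(ℝ, W₂) k (fun x => T x w) s m) :
    ContMDiffWithinAt I 𝓘(ℝ, W₁ →L[ℝ] W₂) k T s m := by
  let b := Module.finBasis ℝ W₁
  have hT : T = fun x => ∑ i, (ContinuousLinearMap.smulRightL ℝ W₁ W₂
      (LinearMap.toContinuousLinearMap (b.coord i))) (T x (b i)) := by
    funext x
    ext w
    conv_lhs => rw [← b.sum_repr w]
    simp [-Module.Basis.sum_repr]
  rw [hT]
  refine ContMDiffWithinAt.sum fun i _ => ?_
  exact (ContinuousLinearMap.contMDiff _).contMDiffAt.comp_contMDiffWithinAt m (h (b i))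

theorem contMDiffAt_clm_of_apply {T : M → W₁ →L[ℝ] W₂} {m : M}
    (h : ∀ w, ContMDiffAt I 𝓘(ℝ, W₂) k (fun x => T x w) m) :
    ContMDiffAt I 𝓘(ℝ, W₁ →L[ℝ] W₂) k T m := by
  simp_rw [← contMDiffWithinAt_univ] at h ⊢
  exact contMDiffWithinAt_clm_of_apply h

/-- If `T m (h m)` and `T` are smooth and `T m₀` is injective, then `h` is smooth at `m₀`. -/
theorem contMDiffWithinAt_of_injective_apply [FiniteDimensional ℝ W₂]
    {T : M → W₁ →L[ℝ] W₂} {h : M → W₁} {s : Set M} {m : M}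
    (hT : ContMDiffWithinAt I 𝓘(ℝ, W₁ →L[ℝ] W₂) k T s m) (hinj : Function.Injective (T m))
    (hh : ContMDiffWithinAt I 𝓘(ℝ, W₂) k (fun x => T x (h x)) s m) :
    ContMDiffWithinAt I 𝓘(ℝ, W₁) k h s m := by
  -- A left inverse `R` of `T m` makes `S = R ∘ T` the identity at `m`, hence invertible nearby, and
  -- `h` is recovered as `S⁻¹ (R (T h))`.
  obtain ⟨R, hR⟩ : ∃ R : W₂ →L[ℝ] W₁, R.comp (T m) = ContinuousLinearMap.id ℝ W₁ := by
    obtain ⟨g, hg⟩ := ((T m : W₁ →L[ℝ] W₂) : W₁ →ₗ[ℝ] W₂).exists_leftInverse_of_injective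
      (LinearMap.ker_eq_bot.2 hinj)
    exact ⟨LinearMap.toContinuousLinearMap g, by ext w; exact congrArg (fun l => l w) hg⟩
  let S : M → W₁ →L[ℝ] W₁ := fun x => R.comp (T x)
  have hS : ContMDiffWithinAt I 𝓘(ℝ, W₁ →L[ℝ] W₁) k S s m :=
    (contMDiffWithinAt_const (c := R)).clm_comp hT
  have hSm : S m = 1 := hR
  have : CompleteSpace W₁ := FiniteDimensional.complete ℝ W₁
  have hinv : ContMDiffWithinAt I 𝓘(ℝ, W₁ →L[ℝ] W₁) k (fun x => Ring.inverse (S x)) s m := by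
    have h1 : ContDiffAt ℝ k Ring.inverse (S m) := by
      rw [hSm]
      exact contDiffAt_ringInverse ℝ (1 : (W₁ →L[ℝ] W₁)ˣ)
    exact h1.contMDiffAt.comp_contMDiffWithinAt m hS
  have hunit : ∀ᶠ x in 𝓝[s] m, IsUnit (S x) := by
    refine hS.continuousWithinAt.eventually (Units.isOpen.mem_nhds ?_)
    rw [hSm]
    exact isUnit_one
  have hmain : ContMDiffWithinAt I 𝓘(ℝ, W₁) k
      (fun x => Ring.inverse (S x) (R (T x (h x)))) s m :=
    hinv.clm_apply ((contMDiffWithinAt_const (c := R)).clm_apply hh)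
  have key : ∀ x, IsUnit (S x) → h x = Ring.inverse (S x) (R (T x (h x))) := by
    intro x hx
    have := congrArg (fun A : W₁ →L[ℝ] W₁ => A (h x)) (Ring.inverse_mul_cancel _ hx)
    exact this.symm
  exact hmain.congr_of_eventuallyEq (hunit.mono key) (key m (by rw [hSm]; exact isUnit_one))

theorem contMDiffAt_of_injective_apply [FiniteDimensional ℝ W₂] {T : M → W₁ →L[ℝ] W₂} {h : M → W₁} {m : M}
    (hT : ContMDiffAt I 𝓘(ℝ, W₁ →L[ℝ] W₂) k T m) (hinj : Function.Injective (T m))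
    (hh : ContMDiffAt I 𝓘(ℝ, W₂) k (fun x => T x (h x)) m) :
    ContMDiffAt I 𝓘(ℝ, W₁) k h m := by
  rw [← contMDiffWithinAt_univ] at hT hh ⊢
  exact contMDiffWithinAt_of_injective_apply hT hinj hh

end LinearFamilies

/-! ### Curvature of matrix-valued one-forms -/

section VectorSpace

variable {E E' : Type*} [NormedAddCommGroup E] [NormedSpace ℝ E] [NormedAddCommGroup E']
  [NormedSpace ℝ E'] {𝔸 : Type*} [NormedRing 𝔸] [NormedAlgebra ℝ 𝔸]

/-- The curvature `da + a ∧ a` of an algebra-valued one-form on a vector space. -/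
def vcurv (a : E → E →L[ℝ] 𝔸) (u y z : E) : 𝔸 :=
  fderiv ℝ a u y z - fderiv ℝ a u z y + (a u y * a u z - a u z * a u y)

/-- Differentiate the relation `γ b = (f^*a) γ + dγ` and antisymmetrize: the second derivatives of
`f` and `γ` are symmetric and disappear, and the mixed terms cancel against those of the quadratic
part. No inverse of `γ` is needed. -/
theorem vcurv_gauge {a : E' → E' →L[ℝ] 𝔸} {b : E → E →L[ℝ] 𝔸} {f : E → E'} {γ : E → 𝔸} {u : E}
    (ha : DifferentiableAt ℝ a (f u)) (hb : DifferentiableAt ℝ b u) (hf : ContDiffAt ℝ 2 f u)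
    (hγ : ContDiffAt ℝ 2 γ u)
    (h : ∀ᶠ v in 𝓝 u, ∀ w, γ v * b v w = a (f v) (fderiv ℝ f v w) * γ v + fderiv ℝ γ v w) (y z : E) :
    γ u * vcurv b u y z = vcurv a (f u) (fderiv ℝ f u y) (fderiv ℝ f u z) * γ u := by
  have hfd : DifferentiableAt ℝ f u := hf.differentiableAt (by simp)
  have hγd : DifferentiableAt ℝ γ u := hγ.differentiableAt (by simp)
  have hf' : DifferentiableAt ℝ (fderiv ℝ f) u :=
    (hf.fderiv_right (m := 1) (by norm_num)).differentiableAt (by simp)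
  have hγ' : DifferentiableAt ℝ (fderiv ℝ γ) u :=
    (hγ.fderiv_right (m := 1) (by norm_num)).differentiableAt (by simp)
  -- The gauge relation evaluated on `z`, differentiated in the direction `y`.
  have key : ∀ y z : E, fderiv ℝ γ u y * b u z + γ u * fderiv ℝ b u y z =
      (fderiv ℝ a (f u) (fderiv ℝ f u y) (fderiv ℝ f u z) +
        a (f u) (fderiv ℝ (fderiv ℝ f) u y z)) * γ u +
        a (f u) (fderiv ℝ f u z) * fderiv ℝ γ u y + fderiv ℝ (fderiv ℝ γ) u y z := by
    intro y z
    have e1 : (fun v => γ v * b v z) =ᶠ[𝓝 u]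
        fun v => a (f v) (fderiv ℝ f v z) * γ v + fderiv ℝ γ v z := h.mono fun v hv => hv z
    have d1 : HasFDerivAt (fun v => γ v * b v z) _ u :=
      hγd.hasFDerivAt.mul' (hb.hasFDerivAt.clm_apply (hasFDerivAt_const z u))
    have haf : HasFDerivAt (fun v => a (f v)) _ u := ha.hasFDerivAt.comp u hfd.hasFDerivAt
    have d2 : HasFDerivAt (fun v => a (f v) (fderiv ℝ f v z) * γ v + fderiv ℝ γ v z) _ u :=
      ((haf.clm_apply (hf'.hasFDerivAt.clm_apply (hasFDerivAt_const z u))).mul'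
        hγd.hasFDerivAt).add (hγ'.hasFDerivAt.clm_apply (hasFDerivAt_const z u))
    have d3 := congrArg (fun A : E →L[ℝ] 𝔸 => A y) ((d1.congr_of_eventuallyEq e1.symm).unique d2)
    simp at d3
    have d4 : γ u * fderiv ℝ b u y z + fderiv ℝ γ u y * b u z = _ := d3
    rw [add_comm, d4]
    noncomm_ring
  have s1 : fderiv ℝ (fderiv ℝ f) u y z = fderiv ℝ (fderiv ℝ f) u z y :=
    (hf.isSymmSndFDerivAt (by simp)).eq y z
  have s2 : fderiv ℝ (fderiv ℝ γ) u y z = fderiv ℝ (fderiv ℝ γ) u z y :=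
    (hγ.isSymmSndFDerivAt (by simp)).eq y z
  have k1 := key y z
  have k2 := key z y
  rw [← s1, ← s2] at k2
  have hu := h.self_of_nhds
  unfold vcurv
  have r1 : γ u * fderiv ℝ b u y z - γ u * fderiv ℝ b u z y = 
     (fderiv ℝ a (f u) (fderiv ℝ f u y) (fderiv ℝ f u z) -
      fderiv ℝ a (f u) (fderiv ℝ f u z) (fderiv ℝ f u y)) * γ u +
        a (f u) (fderiv ℝ f u z) * fderiv ℝ γ u y - a (f u) (fderiv ℝ f u y) * fderiv ℝ γ u z
        - fderiv ℝ γ u y * b u z + fderiv ℝ γ u z * b u y := by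
    rw [eq_sub_of_add_eq' k1, eq_sub_of_add_eq' k2]
    noncomm_ring
  -- Applying the relation twice moves `γ` past both factors; the terms containing `dγ` are the ones
  -- left over in `r1`.
  have r2 : ∀ y z, γ u * b u y * b u z = 
      a (f u) (fderiv ℝ f u y) * a (f u) (fderiv ℝ f u z) * γ u + 
      a (f u) (fderiv ℝ f u y) * fderiv ℝ γ u z + fderiv ℝ γ u y * b u z := by
    intro y z
    rw [hu y, add_mul, mul_assoc, hu z]
    noncomm_ring
  calc _ = (γ u * fderiv ℝ b u y z - γ u * fderiv ℝ b u z y) + 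
      (γ u * b u y * b u z - γ u * b u z * b u y) := by noncomm_ring
    _ = _ := by
      rw [r1, r2 y z, r2 z y]
      noncomm_ring

end VectorSpace

end FlatAffine

namespace FlatAffine

/-! ### One-forms on manifolds and their curvature in charts -/

section Forms

variable {E H M : Type*} [NormedAddCommGroup E] [NormedSpace ℝ E] [TopologicalSpace H]
  {I : ModelWithCorners ℝ E H} [TopologicalSpace M] [ChartedSpace H M]
  {𝔸 : Type*} [NormedRing 𝔸] [NormedAlgebra ℝ 𝔸]

/-- A one-form read in the preferred chart at `p`. -/
def chartForm (α : ∀ p : M, TangentSpace I p →L[ℝ] 𝔸) (p : M) (u : E) : E →L[ℝ] 𝔸 :=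
  (α ((extChartAt I p).symm u)).comp (mfderiv 𝓘(ℝ, E) I (extChartAt I p).symm u)

/-- The curvature of an algebra-valued one-form at `p` vanishes, as computed in the chart at `p`. -/
def IsFlatAt (α : ∀ p : M, TangentSpace I p →L[ℝ] 𝔸) (p : M) : Prop :=
  ∀ y z : E, vcurv (chartForm α p) (extChartAt I p p) y z = 0

/-- The curvature of an algebra-valued one-form evaluated on two vector fields. -/
def formCurvature (α : ∀ p : M, TangentSpace I p →L[ℝ] 𝔸) (Y Z : ∀ p : M, TangentSpace I p)
    (p : M) : 𝔸 :=
  mvfderiv I (fun q => α q (Z q)) p (Y p) - mvfderiv I (fun q => α q (Y q)) p (Z p) -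
    α p (VectorField.mlieBracket I Y Z p) + (α p (Y p) * α p (Z p) - α p (Z p) * α p (Y p))

variable [I.Boundaryless] [IsManifold I ∞ M] [FiniteDimensional ℝ E]

omit [FiniteDimensional ℝ E] in
theorem isInvertible_mfderiv_extChartAt_symm {p : M} {u : E} (hu : u ∈ (extChartAt I p).target) :
    (mfderiv 𝓘(ℝ, E) I (extChartAt I p).symm u).IsInvertible := by
  have h := isInvertible_mfderivWithin_extChartAt_symm (I := I) hu
  rwa [I.range_eq_univ, mfderivWithin_univ] at h

omit [FiniteDimensional ℝ E] in
theorem mfderiv_extChartAt_comp_mfderiv_symm {p : M} {u : E} (hu : u ∈ (extChartAt I p).target)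
    (w : E) : mfderiv I 𝓘(ℝ, E) (extChartAt I p) ((extChartAt I p).symm u)
      (mfderiv 𝓘(ℝ, E) I (extChartAt I p).symm u w) = w := by
  have h := mfderiv_extChartAt_comp_mfderivWithin_extChartAt_symm (I := I) hu
  rw [I.range_eq_univ, mfderivWithin_univ] at h
  exact congrArg (fun A => A w) h

omit [FiniteDimensional ℝ E] in
theorem mfderiv_symm_comp_mfderiv_extChartAt {p q : M} (hq : q ∈ (extChartAt I p).source)
    (w : TangentSpace I q) : mfderiv 𝓘(ℝ, E) I (extChartAt I p).symm (extChartAt I p q)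
      (mfderiv I 𝓘(ℝ, E) (extChartAt I p) q w) = w := by
  have h := mfderivWithin_extChartAt_symm_comp_mfderiv_extChartAt' (I := I) hq
  rw [I.range_eq_univ, mfderivWithin_univ] at h
  exact congrArg (fun A => A w) h

omit [FiniteDimensional ℝ E] in
theorem form_eq_chartForm (α : ∀ p : M, TangentSpace I p →L[ℝ] 𝔸) {p q : M}
    (hq : q ∈ (extChartAt I p).source) (w : TangentSpace I q) :
    α q w = chartForm α p (extChartAt I p q) (mfderiv I 𝓘(ℝ, E) (extChartAt I p) q w) := by
  have h1 := mfderiv_symm_comp_mfderiv_extChartAt hq w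
  have h2 := (extChartAt I p).left_inv hq
  unfold chartForm
  -- All tangent spaces are the model space by definition, so `w' = w` typechecks and the two base
  -- points can be identified by substitution.
  have : ∀ (q' : M) (w' : E), q' = q → w' = w → α q w = α q' w' := by
    rintro q' w' rfl rfl; rfl
  exact this _ _ h2 h1

/-- The vector field `Y` read in the chart at `p`. -/
def chartField (Y : ∀ p : M, TangentSpace I p) (p : M) (u : E) : E :=
  mfderiv I 𝓘(ℝ, E) (extChartAt I p) ((extChartAt I p).symm u) (Y ((extChartAt I p).symm u))

omit [FiniteDimensional ℝ E] in
theorem chartField_eq_mpullback (Y : ∀ p : M, TangentSpace I p) {p : M} {u : E}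
    (hu : u ∈ (extChartAt I p).target) :
    chartField Y p u = VectorField.mpullbackWithin 𝓘(ℝ, E) I (extChartAt I p).symm Y
      (Set.range I) u := by
  rw [I.range_eq_univ, VectorField.mpullbackWithin_univ]
  have hi := isInvertible_mfderiv_extChartAt_symm hu
  have h := mfderiv_symm_comp_mfderiv_extChartAt ((extChartAt I p).map_target hu)
    (Y ((extChartAt I p).symm u))
  rw [(extChartAt I p).right_inv hu] at h
  exact (hi.inverse_apply_eq.2 h.symm).symm

theorem eventuallyEq_chartField (Y : ∀ p : M, TangentSpace I p) (p : M) :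
    VectorField.mpullbackWithin 𝓘(ℝ, E) I (extChartAt I p).symm Y Set.univ
      =ᶠ[𝓝 (extChartAt I p p)] chartField Y p := by
  filter_upwards [extChartAt_target_mem_nhds (I := I) p] with u hu
  rw [chartField_eq_mpullback Y hu, I.range_eq_univ]

theorem differentiableAt_chartField {Y : ∀ p : M, TangentSpace I p} {p : M}
    (hY : MDifferentiableAt I I.tangent (fun q => (⟨q, Y q⟩ : TangentBundle I M)) p) :
    DifferentiableAt ℝ (chartField Y p) (extChartAt I p p) := by
  have := FiniteDimensional.complete ℝ E
  have h := (mdifferentiableWithinAt_univ.2 hY).differentiableWithinAt_mpullbackWithin_vectorField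
  have hs : (extChartAt I p).symm ⁻¹' Set.univ ∩ Set.range I = Set.univ := by
    rw [I.range_eq_univ]; simp
  rw [hs, I.range_eq_univ] at h
  have h' : DifferentiableAt ℝ (E := E) (F := E)
      (VectorField.mpullbackWithin 𝓘(ℝ, E) I (extChartAt I p).symm Y Set.univ)
      (extChartAt I p p) := differentiableWithinAt_univ.1 h
  exact h'.congr_of_eventuallyEq (eventuallyEq_chartField Y p).symm

/-- The bracket on a manifold is defined through the chart at `p`, so in that chart it is the
bracket of the fields read there. -/
theorem mfderiv_extChartAt_mlieBracket {Y Z : ∀ p : M, TangentSpace I p}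
    {p : M} : mfderiv I 𝓘(ℝ, E) (extChartAt I p) p (VectorField.mlieBracket I Y Z p) =
      VectorField.lieBracket ℝ (chartField Y p) (chartField Z p) (extChartAt I p p) := by
  rw [← VectorField.mlieBracketWithin_univ, VectorField.mlieBracketWithin_apply]
  have hi : (mfderiv I 𝓘(ℝ, E) (extChartAt I p) p).IsInvertible :=
    isInvertible_mfderiv_extChartAt (mem_extChartAt_source p)
  refine (DFunLike.congr_fun hi.self_comp_inverse _).trans ?_
  have hs : (extChartAt I p).symm ⁻¹' Set.univ ∩ Set.range I = Set.univ := by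
    rw [I.range_eq_univ]; simp
  rw [hs, I.range_eq_univ]
  refine (congrFun (VectorField.lieBracketWithin_univ (E := E)) _).trans ?_
  exact Filter.EventuallyEq.lieBracket_vectorField_eq (eventuallyEq_chartField Y p)
    (eventuallyEq_chartField Z p)

omit [I.Boundaryless] [FiniteDimensional ℝ E] in
theorem mvfderiv_eq_chart {F : Type*} [NormedAddCommGroup F] [NormedSpace ℝ F] {f : M → F}
    {g : E → F} {p : M} (hg : DifferentiableAt ℝ g (extChartAt I p p))
    (h : f =ᶠ[𝓝 p] fun q => g (extChartAt I p q)) (w : TangentSpace I p) :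
    mvfderiv I f p w = fderiv ℝ g (extChartAt I p p) (mfderiv I 𝓘(ℝ, E) (extChartAt I p) p w) := by
  have h1 : HasMFDerivAt I 𝓘(ℝ, F) (fun q => g (extChartAt I p q)) p _ :=
    hg.mdifferentiableAt.hasMFDerivAt.comp p
      ((mdifferentiableAt_extChartAt (mem_chart_source H p)).hasMFDerivAt)
  have h2 := (h1.congr_of_eventuallyEq h).mfderiv
  unfold mvfderiv
  rw [h2]
  simp [mfderiv_eq_fderiv]
  rfl

/-- In the chart, the derivatives of `Y` and `Z` coming from the first two terms add up to `α [Y,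
Z]` and cancel. The curvature is therefore tensorial and depends only on the values of the fields at
`p`. -/
theorem formCurvature_eq {α : ∀ p : M, TangentSpace I p →L[ℝ] 𝔸} {Y Z : ∀ p : M, TangentSpace I p}
    {p : M} (hα : DifferentiableAt ℝ (chartForm α p) (extChartAt I p p))
    (hY : MDifferentiableAt I I.tangent (fun q => (⟨q, Y q⟩ : TangentBundle I M)) p)
    (hZ : MDifferentiableAt I I.tangent (fun q => (⟨q, Z q⟩ : TangentBundle I M)) p) :
    formCurvature α Y Z p = vcurv (chartForm α p) (extChartAt I p p)
      (mfderiv I 𝓘(ℝ, E) (extChartAt I p) p (Y p))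
      (mfderiv I 𝓘(ℝ, E) (extChartAt I p) p (Z p)) := by
  have hY' := differentiableAt_chartField hY
  have hZ' := differentiableAt_chartField hZ
  have hsrc : ∀ᶠ q in 𝓝 p, q ∈ (extChartAt I p).source := extChartAt_source_mem_nhds p
  have e : ∀ Y : ∀ p : M, TangentSpace I p, (fun q => α q (Y q)) =ᶠ[𝓝 p]
      fun q => (fun u => chartForm α p u (chartField Y p u)) (extChartAt I p q) := by
    intro Y
    filter_upwards [hsrc] with q hq
    rw [form_eq_chartForm α hq]
    simp only [chartField]
    congr 1
    rw [(extChartAt I p).left_inv hq]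
  have c0 : ∀ Y : ∀ p : M, TangentSpace I p, chartField Y p (extChartAt I p p) =
      mfderiv I 𝓘(ℝ, E) (extChartAt I p) p (Y p) := by
    intro Y
    simp only [chartField]
    rw [extChartAt_to_inv]
  unfold formCurvature
  have d : ∀ {Y : ∀ p : M, TangentSpace I p}
      (_ : DifferentiableAt ℝ (chartField Y p) (extChartAt I p p)) (w : TangentSpace I p),
      mvfderiv I (fun q => α q (Y q)) p w =
        fderiv ℝ (chartForm α p) (extChartAt I p p) (mfderiv I 𝓘(ℝ, E) (extChartAt I p) p w)
          (mfderiv I 𝓘(ℝ, E) (extChartAt I p) p (Y p)) +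
        chartForm α p (extChartAt I p p) (fderiv ℝ (chartField Y p) (extChartAt I p p)
          (mfderiv I 𝓘(ℝ, E) (extChartAt I p) p w)) := by
    intro Y hY' w
    rw [mvfderiv_eq_chart (hα.clm_apply hY') (e Y), fderiv_clm_apply hα hY', add_comm]
    rw [← c0 Y]
    rfl
  rw [d hZ', d hY']
  simp only [form_eq_chartForm α (mem_extChartAt_source (I := I) p)]
  rw [mfderiv_extChartAt_mlieBracket, VectorField.lieBracket_eq]
  simp only [map_sub, vcurv, c0]
  abel

/-- The vector field with constant value `y` in the chart at `p`. -/
def coordField (p : M) (y : E) (q : M) : TangentSpace I q :=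
  (trivializationAt E (TangentSpace I) p).symm q y

omit [FiniteDimensional ℝ E] in
theorem coordField_eq {p q : M} (hq : q ∈ (chartAt H p).source) (y : E) :
    coordField (I := I) p y q =
      mfderiv 𝓘(ℝ, E) I (extChartAt I p).symm (extChartAt I p q) y := by
  have := TangentBundle.symmL_trivializationAt (I := I) hq
  rw [I.range_eq_univ, mfderivWithin_univ] at this
  refine Eq.trans ?_ (DFunLike.congr_fun this y)
  exact (Trivialization.symmL_apply _ (by exact hq) y).symm

omit [FiniteDimensional ℝ E] in
theorem mfderiv_extChartAt_coordField (p : M) (y : E) :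
    mfderiv I 𝓘(ℝ, E) (extChartAt I p) p (coordField p y p) = y := by
  have h2 := mfderiv_extChartAt_comp_mfderiv_symm (mem_extChartAt_target (I := I) p) y
  rw [coordField_eq (mem_chart_source H p)]
  rw [extChartAt_to_inv] at h2
  exact h2

omit [I.Boundaryless] [FiniteDimensional ℝ E] in
theorem contMDiffOn_coordField (p : M) (y : E) :
    ContMDiffOn I I.tangent ∞ (fun q => (⟨q, coordField p y q⟩ : TangentBundle I M))
      (chartAt H p).source := by
  have h1 := (trivializationAt E (TangentSpace I : M → Type _) p).contMDiffOn_symm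
    (IB := I) (n := ∞)
  have h2 : ContMDiffOn I (I.prod 𝓘(ℝ, E)) ∞ (fun q : M => (q, y)) (chartAt H p).source :=
    contMDiffOn_id.prodMk contMDiffOn_const
  refine (h1.comp h2 ?_).congr ?_
  · intro q hq
    exact (trivializationAt E (TangentSpace I : M → Type _) p).mem_target.2 hq
  · intro q hq
    exact (Trivialization.mk_symm _ (by exact hq) y)

omit [I.Boundaryless] [FiniteDimensional ℝ E] in
theorem mdifferentiableAt_coordField (p : M) (y : E) :
    MDifferentiableAt I I.tangent (fun q => (⟨q, coordField p y q⟩ : TangentBundle I M)) p :=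
  ((contMDiffOn_coordField p y).contMDiffAt ((chartAt H p).open_source.mem_nhds
      (mem_chart_source H p))).mdifferentiableAt (by simp)

/-- On a constant vector `y` the chart form is `α` evaluated on the coordinate field of `y`, which
is smooth near `p`; finite dimension passes from pointwise smoothness to smoothness of the
operator-valued map. -/
theorem differentiableAt_chartForm {α : ∀ p : M, TangentSpace I p →L[ℝ] 𝔸} {U : Set M}
    (hU : IsOpen U) (hα : ContMDiffOn I.tangent 𝓘(ℝ, 𝔸) ∞
      (fun w : TangentBundle I M => α w.proj w.snd) (TotalSpace.proj ⁻¹' U)) {p : M} (hp : p ∈ U) :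
    DifferentiableAt ℝ (chartForm α p) (extChartAt I p p) := by
  refine (contMDiffAt_iff_contDiffAt.1 (contMDiffAt_clm_of_apply (k := 1) fun y => ?_)
    ).differentiableAt (by simp)
  have hsymm : ContMDiffAt 𝓘(ℝ, E) I ∞ (extChartAt I p).symm (extChartAt I p p) := by
    have := contMDiffWithinAt_extChartAt_symm_range (I := I) (n := ∞) p (mem_extChartAt_target p)
    rwa [I.range_eq_univ, contMDiffWithinAt_univ] at this
  have h1 : ContMDiffAt I 𝓘(ℝ, 𝔸) ∞ (fun q => α q (coordField p y q)) p := by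
    have hp' : (⟨p, coordField p y p⟩ : TangentBundle I M) ∈ TotalSpace.proj ⁻¹' U := hp
    have h2 := hα.contMDiffAt ((hU.preimage (FiberBundle.continuous_proj E
      (TangentSpace I : M → Type _))).mem_nhds hp')
    exact ContMDiffAt.comp p h2 ((contMDiffOn_coordField p y).contMDiffAt
      ((chartAt H p).open_source.mem_nhds (mem_chart_source H p)))
  have h3 : ContMDiffAt 𝓘(ℝ, E) 𝓘(ℝ, 𝔸) ∞ ((fun q => α q (coordField p y q)) ∘ (extChartAt I p).symm)
      (extChartAt I p p) := by
    refine ContMDiffAt.comp (I' := I) _ ?_ hsymm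
    rw [extChartAt_to_inv]
    exact h1
  refine (h3.of_le (by simp)).congr_of_eventuallyEq ?_
  filter_upwards [extChartAt_target_mem_nhds (I := I) p] with u hu
  have hu' := (extChartAt I p).map_target hu
  rw [extChartAt_source] at hu'
  simp only [Function.comp_apply]
  rw [coordField_eq hu', (extChartAt I p).right_inv hu]
  rfl

/-- If the curvature of `α` vanishes on all smooth vector fields near `p`, then `α` is flat
at `p`. -/
theorem isFlatAt_of_formCurvature {α : ∀ p : M, TangentSpace I p →L[ℝ] 𝔸} {p : M}
    (hα : DifferentiableAt ℝ (chartForm α p) (extChartAt I p p))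
    (h : ∀ Y Z : ∀ p : M, TangentSpace I p,
      ContMDiffOn I I.tangent ∞ (fun q => (⟨q, Y q⟩ : TangentBundle I M)) (chartAt H p).source →
      ContMDiffOn I I.tangent ∞ (fun q => (⟨q, Z q⟩ : TangentBundle I M)) (chartAt H p).source →
      formCurvature α Y Z p = 0) : IsFlatAt α p := by
  intro y z
  have := formCurvature_eq hα (mdifferentiableAt_coordField p y) (mdifferentiableAt_coordField p z)
  rw [h _ _ (contMDiffOn_coordField p y) (contMDiffOn_coordField p z),
    mfderiv_extChartAt_coordField, mfderiv_extChartAt_coordField] at this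
  exact this.symm

-- The manifold form of `vcurv_gauge`, obtained by reading `f` and `γ` in charts. It transfers
-- flatness from a principal bundle to its base with `f` a local section and `γ = 1`, and back with
-- `f` the projection and `γ` the group coordinate.
omit [FiniteDimensional ℝ E] in
theorem isFlatAt_of_gauge {E' H' N : Type*} [NormedAddCommGroup E'] [NormedSpace ℝ E']
    [TopologicalSpace H'] {I' : ModelWithCorners ℝ E' H'} [TopologicalSpace N] [ChartedSpace H' N]
    [I'.Boundaryless] [IsManifold I' ∞ N] [FiniteDimensional ℝ E']
    {α : ∀ p : N, TangentSpace I' p →L[ℝ] 𝔸} {β : ∀ p : M, TangentSpace I p →L[ℝ] 𝔸}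
    {f : M → N} {γ : M → 𝔸} {p : M} (hfe : ∀ᶠ q in 𝓝 p, ContMDiffAt I I' 2 f q)
    (hγe : ∀ᶠ q in 𝓝 p, ContMDiffAt I 𝓘(ℝ, 𝔸) 2 γ q) (hγp : IsUnit (γ p))
    (hα : DifferentiableAt ℝ (chartForm α (f p)) (extChartAt I' (f p) (f p)))
    (hβ : DifferentiableAt ℝ (chartForm β p) (extChartAt I p p))
    (h : ∀ᶠ q in 𝓝 p, ∀ w : TangentSpace I q,
      γ q * β q w = α (f q) (mfderiv I I' f q w) * γ q + mvfderiv I γ q w)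
    (hflat : IsFlatAt α (f p)) : IsFlatAt β p := by
  intro y z
  have hf := hfe.self_of_nhds
  have hγ := hγe.self_of_nhds
  have hx : (extChartAt I p).symm (extChartAt I p p) = p := extChartAt_to_inv p
  have hsymm : ContMDiffAt 𝓘(ℝ, E) I 2 (extChartAt I p).symm (extChartAt I p p) := by
    have := contMDiffWithinAt_extChartAt_symm_range (I := I) (n := 2) p (mem_extChartAt_target p)
    rwa [I.range_eq_univ, contMDiffWithinAt_univ] at this
  have hf' : ContDiffAt ℝ 2 (fun u => extChartAt I' (f p) (f ((extChartAt I p).symm u)))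
      (extChartAt I p p) := by
    rw [← contMDiffAt_iff_contDiffAt]
    refine ContMDiffAt.comp (I' := I') _ ?_ (ContMDiffAt.comp (I' := I) _ ?_ hsymm)
    · rw [hx]; exact contMDiffAt_extChartAt
    · rw [hx]; exact hf
  have hγ' : ContDiffAt ℝ 2 (fun u => γ ((extChartAt I p).symm u)) (extChartAt I p p) := by
    rw [← contMDiffAt_iff_contDiffAt]
    refine ContMDiffAt.comp (I' := I) _ ?_ hsymm
    rw [hx]; exact hγ
  have hev : ∀ᶠ q in 𝓝 p, q ∈ (extChartAt I p).source ∧ f q ∈ (extChartAt I' (f p)).source ∧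
      MDifferentiableAt I I' f q ∧ MDifferentiableAt I 𝓘(ℝ, 𝔸) γ q ∧
      ∀ w : TangentSpace I q, γ q * β q w = α (f q) (mfderiv I I' f q w) * γ q + mvfderiv I γ q w := by
    filter_upwards [extChartAt_source_mem_nhds (I := I) p,
      hf.continuousAt.eventually (extChartAt_source_mem_nhds (I := I') (f p)),
      hfe, hγe, h] with q h1 h2 h3 h4 h5
    exact ⟨h1, h2, h3.mdifferentiableAt (by simp), h4.mdifferentiableAt (by simp), h5⟩
  have hcont : Filter.Tendsto (extChartAt I p).symm (𝓝 (extChartAt I p p)) (𝓝 p) := by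
    have := hsymm.continuousAt.tendsto
    rwa [hx] at this
  have key := vcurv_gauge (a := chartForm α (f p)) (b := chartForm β p)
    (f := fun u => extChartAt I' (f p) (f ((extChartAt I p).symm u)))
    (γ := fun u => γ ((extChartAt I p).symm u)) (u := extChartAt I p p)
    (by simpa only [hx] using hα) hβ hf' hγ' (by
      filter_upwards [hcont.eventually hev, extChartAt_target_mem_nhds (I := I) p] with u hu hut w
      obtain ⟨h1, h2, h3, h4, h5⟩ := hu
      have hs : MDifferentiableAt 𝓘(ℝ, E) I (extChartAt I p).symm u := by
        have := contMDiffWithinAt_extChartAt_symm_range (I := I) (n := 1) p hut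
        rw [I.range_eq_univ, contMDiffWithinAt_univ] at this
        exact this.mdifferentiableAt (by simp)
      refine (h5 (mfderiv 𝓘(ℝ, E) I (extChartAt I p).symm u w)).trans ?_
      congr 1
      · congr 1
        rw [form_eq_chartForm α h2]
        congr 1
        have hψ : MDifferentiableAt I' 𝓘(ℝ, E') (extChartAt I' (f p))
            (f ((extChartAt I p).symm u)) := mdifferentiableAt_extChartAt (by simpa using h2)
        have := (hψ.hasMFDerivAt.comp u (h3.hasMFDerivAt.comp u hs.hasMFDerivAt)).mfderiv
        rw [← mfderiv_eq_fderiv]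
        exact (congrArg (fun A : E →L[ℝ] E' => A w) this).symm
      · have := (h4.hasMFDerivAt.comp u hs.hasMFDerivAt).mfderiv
        rw [← mfderiv_eq_fderiv]
        exact (congrArg (fun A : E →L[ℝ] 𝔸 => A w) this).symm) y z
  rw [hx, hflat, zero_mul] at key
  exact hγp.mul_right_eq_zero.1 key

end Forms

end FlatAffine

namespace FlatAffine

/-! ### Calculus on the affine group -/

section AffineGroup

variable {n : ℕ}

/-- The space `ℂ^{n+1}` on which `Af_n(ℂ)` acts. -/
abbrev Vec (n : ℕ) : Type := Fin (n + 1) → ℂ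

theorem AfLie.toMatrix_mulVec_castSucc (ξ : AfLie n) (w : Vec n) (i : Fin n) :
    (ξ.toMatrix *ᵥ w) i.castSucc = ∑ j, ξ i j * w j := by
  simp [AfLie.toMatrix, Matrix.mulVec, dotProduct]

theorem AfLie.toMatrix_mulVec_last (ξ : AfLie n) (w : Vec n) :
    (ξ.toMatrix *ᵥ w) (Fin.last n) = 0 := by
  simp [AfLie.toMatrix, Matrix.mulVec, dotProduct]

theorem Af.mulVec_castSucc (g : Af n) (w : Vec n) (i : Fin n) :
    Af.mulVec g w i.castSucc = ∑ j, Af.coord g i j * w j := by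
  simp [Af.mulVec, Matrix.mulVec, dotProduct, Af.coord]

theorem Af.mulVec_last (g : Af n) (w : Vec n) : Af.mulVec g w (Fin.last n) = w (Fin.last n) := by
  simp [Af.mulVec, Matrix.mulVec, dotProduct, g.2 _, Matrix.one_apply]

/-- The affine group acting on `ℂ^{n+1}` by real-linear operators. -/
def Af.rep : Af n →* (Vec n →L[ℝ] Vec n) where
  toFun g := LinearMap.toContinuousLinearMap
    ((Matrix.mulVecLin (g.1 : Matrix (Fin (n + 1)) (Fin (n + 1)) ℂ)).restrictScalars ℝ)
  map_one' := by ext1 w; simp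
  map_mul' g h := by ext1 w; simp [Matrix.mulVec_mulVec]

theorem Af.rep_apply (g : Af n) (w : Vec n) : Af.rep g w = Af.mulVec g w := rfl

/-- The Lie algebra acting on `ℂ^{n+1}` by real-linear operators. -/
def AfLie.op : AfLie n →L[ℝ] (Vec n →L[ℝ] Vec n) :=
  LinearMap.toContinuousLinearMap
    { toFun := fun ξ => LinearMap.toContinuousLinearMap
        ((Matrix.mulVecLin ξ.toMatrix).restrictScalars ℝ)
      map_add' := fun ξ η => by
        ext w i
        refine Fin.lastCases ?_ (fun i => ?_) i
        · simp [AfLie.toMatrix_mulVec_last]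
        · simp [AfLie.toMatrix_mulVec_castSucc, add_mul, Finset.sum_add_distrib]
      map_smul' := fun c ξ => by
        ext w i
        refine Fin.lastCases ?_ (fun i => ?_) i
        · simp [AfLie.toMatrix_mulVec_last]
        · simp [AfLie.toMatrix_mulVec_castSucc, Finset.mul_sum, mul_assoc] }

theorem AfLie.op_apply (ξ : AfLie n) (w : Vec n) : AfLie.op ξ w = ξ.toMatrix *ᵥ w := rfl

/-- The first `n` rows of the matrix of an operator on `ℂ^{n+1}`. -/
def AfLie.ofOp : (Vec n →L[ℝ] Vec n) →L[ℝ] AfLie n :=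
  LinearMap.toContinuousLinearMap
    { toFun := fun T i j => T (Pi.single j 1) i.castSucc
      map_add' := fun _ _ => rfl
      map_smul' := fun _ _ => rfl }

theorem AfLie.ofOp_apply (T : Vec n →L[ℝ] Vec n) (i : Fin n) (j : Fin (n + 1)) :
    AfLie.ofOp T i j = T (Pi.single j 1) i.castSucc := rfl

@[simp] theorem AfLie.ofOp_op (ξ : AfLie n) : AfLie.ofOp (AfLie.op ξ) = ξ := by
  ext i j
  simp [AfLie.ofOp_apply, AfLie.op_apply, AfLie.toMatrix]

theorem AfLie.op_injective : Function.Injective (AfLie.op (n := n)) :=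
  Function.LeftInverse.injective AfLie.ofOp_op

@[simp] theorem AfLie.ofOp_rep (g : Af n) : AfLie.ofOp (Af.rep g) = Af.coord g := by
  ext i j
  simp [AfLie.ofOp_apply, Af.rep_apply, Af.mulVec, Af.coord]

theorem AfLie.op_ofOp {T : Vec n →L[ℝ] Vec n} (hT : ∀ (c : ℂ) (w : Vec n), T (c • w) = c • T w)
    (hl : ∀ w, T w (Fin.last n) = 0) : AfLie.op (AfLie.ofOp T) = T := by
  ext w i
  refine Fin.lastCases ?_ (fun i => ?_) i
  · rw [AfLie.op_apply, AfLie.toMatrix_mulVec_last, hl]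
  · rw [AfLie.op_apply, AfLie.toMatrix_mulVec_castSucc]
    conv_rhs => rw [pi_eq_sum_univ' w]
    simp only [map_sum, hT, Finset.sum_apply, Pi.smul_apply, AfLie.ofOp_apply, smul_eq_mul]
    exact Finset.sum_congr rfl fun j _ => mul_comm _ _

theorem AfLie.op_smul (ξ : AfLie n) (c : ℂ) (w : Vec n) :
    AfLie.op ξ (c • w) = c • AfLie.op ξ w := by
  simp [AfLie.op_apply, Matrix.mulVec_smul]

theorem AfLie.op_last (ξ : AfLie n) (w : Vec n) : AfLie.op ξ w (Fin.last n) = 0 := by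
  rw [AfLie.op_apply, AfLie.toMatrix_mulVec_last]

theorem Af.rep_smul (g : Af n) (c : ℂ) (w : Vec n) : Af.rep g (c • w) = c • Af.rep g w := by
  simp [Af.rep_apply, Af.mulVec, Matrix.mulVec_smul]

theorem Af.rep_last (g : Af n) (w : Vec n) : Af.rep g w (Fin.last n) = w (Fin.last n) := by
  rw [Af.rep_apply, Af.mulVec_last]

theorem Af.rep_inv_mul (g : Af n) : Af.rep g⁻¹ * Af.rep g = 1 := by
  rw [← map_mul, inv_mul_cancel, map_one]

theorem Af.rep_mul_inv (g : Af n) : Af.rep g * Af.rep g⁻¹ = 1 := by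
  rw [← map_mul, mul_inv_cancel, map_one]

@[simp] theorem Af.rep_inv_apply_rep (g : Af n) (w : Vec n) : Af.rep g⁻¹ (Af.rep g w) = w :=
  DFunLike.congr_fun (Af.rep_inv_mul g) w

@[simp] theorem Af.rep_apply_rep_inv (g : Af n) (w : Vec n) : Af.rep g (Af.rep g⁻¹ w) = w :=
  DFunLike.congr_fun (Af.rep_mul_inv g) w

theorem Af.isUnit_rep (g : Af n) : IsUnit (Af.rep g) := (Group.isUnit g).map Af.rep

theorem Af.rep_inv (g : Af n) : Af.rep g⁻¹ = Ring.inverse (Af.rep g) := by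
  let u : (Vec n →L[ℝ] Vec n)ˣ := ⟨Af.rep g, Af.rep g⁻¹, Af.rep_mul_inv g, Af.rep_inv_mul g⟩
  exact (Ring.inverse_unit u).symm

theorem Af.rep_injective : Function.Injective (Af.rep (n := n)) := by
  intro g h hgh
  refine (Af.isOpenEmbedding_coord n).injective ?_
  rw [← AfLie.ofOp_rep, ← AfLie.ofOp_rep, hgh]

/-- Any complex-linear automorphism of `ℂ^{n+1}` preserving the last coordinate is given by an
element of the affine group. -/
theorem Af.exists_rep_eq (T : Vec n ≃ₗ[ℂ] Vec n) (hT : ∀ w, T w (Fin.last n) = w (Fin.last n)) :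
    ∃ g : Af n, ∀ w, Af.rep g w = T w := by
  have hdet : IsUnit (LinearMap.toMatrix' (T : Vec n →ₗ[ℂ] Vec n)).det := by
    rw [LinearMap.det_toMatrix']
    exact T.isUnit_det'
  have hmul : ∀ w, LinearMap.toMatrix' (T : Vec n →ₗ[ℂ] Vec n) *ᵥ w = T w := fun w => by
    rw [LinearMap.toMatrix'_mulVec]; rfl
  refine ⟨⟨Matrix.GeneralLinearGroup.mkOfDetNeZero _ hdet.ne_zero, fun j => ?_⟩, hmul⟩
  have h1 := hT (Pi.single j 1)
  rw [← hmul] at h1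
  simpa [Matrix.GeneralLinearGroup.mkOfDetNeZero, Matrix.one_apply, Pi.single_apply] using h1

/-- The projection of `ℂ^{n+1}` to the last coordinate line. -/
def lastProj (n : ℕ) : Vec n →L[ℝ] Vec n :=
  LinearMap.toContinuousLinearMap
    { toFun := fun w => Pi.single (Fin.last n) (w (Fin.last n))
      map_add' := fun _ _ => by simp [Pi.single_add]
      map_smul' := fun _ _ => by
        ext i
        by_cases h : i = Fin.last n <;> simp [h] }

/-- In the chart `Af.coord` the representation is an affine map; the constant term comes from the
fixed last row. Smoothness questions on the group and the derivative of `Af.rep` reduce to this. -/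
theorem Af.rep_eq (g : Af n) : Af.rep g = AfLie.op (Af.coord g) + lastProj n := by
  ext w i
  refine Fin.lastCases ?_ (fun i => ?_) i
  · simp [Af.rep_apply, Af.mulVec_last, AfLie.op_last, lastProj]
  · simp [Af.rep_apply, Af.mulVec_castSucc, AfLie.op_apply, AfLie.toMatrix_mulVec_castSucc, lastProj]

variable {E H M : Type*} [NormedAddCommGroup E] [NormedSpace ℝ E] [TopologicalSpace H]
  {I : ModelWithCorners ℝ E H} [TopologicalSpace M] [ChartedSpace H M]

theorem extChartAt_Af (g : Af n) : (extChartAt 𝓘(ℝ, AfLie n) g : Af n → AfLie n) = Af.coord := by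
  ext1 h
  simp [extChartAt]

/-- `Af.coord` and `Af.rep` determine each other through the linear maps `AfLie.ofOp` and
`AfLie.op`. Maps to the group can thus be treated as operator-valued maps, for which products and
inverses are known to be smooth. -/
theorem contMDiffWithinAt_Af_iff {k : ℕ∞ω} {f : M → Af n} {s : Set M} {x : M} :
    ContMDiffWithinAt I 𝓘(ℝ, AfLie n) k f s x ↔
      ContMDiffWithinAt I 𝓘(ℝ, Vec n →L[ℝ] Vec n) k (fun y => Af.rep (f y)) s x := by
  have h1 : ContMDiffWithinAt I 𝓘(ℝ, AfLie n) k f s x ↔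
      ContMDiffWithinAt I 𝓘(ℝ, AfLie n) k (Af.coord ∘ f) s x := by
    rw [contMDiffWithinAt_iff_target, extChartAt_Af]
    refine ⟨fun h => h.2, fun h => ⟨?_, h⟩⟩
    exact (Af.isOpenEmbedding_coord n).isInducing.continuousWithinAt_iff.2 h.continuousWithinAt
  rw [h1]
  constructor
  · intro h
    have := ((AfLie.op (n := n)).contMDiff.contMDiffAt.comp_contMDiffWithinAt x h).add
      (contMDiffWithinAt_const (c := lastProj n))
    refine this.congr_of_eventuallyEq ?_ ?_
    · exact Filter.Eventually.of_forall fun y => Af.rep_eq _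
    · exact Af.rep_eq _
  · intro h
    have := (AfLie.ofOp (n := n)).contMDiff.contMDiffAt.comp_contMDiffWithinAt x h
    refine this.congr_of_eventuallyEq ?_ ?_
    · exact Filter.Eventually.of_forall fun y => (AfLie.ofOp_rep _).symm
    · exact (AfLie.ofOp_rep _).symm

theorem contMDiffAt_Af_iff {k : ℕ∞ω} {f : M → Af n} {x : M} :
    ContMDiffAt I 𝓘(ℝ, AfLie n) k f x ↔
      ContMDiffAt I 𝓘(ℝ, Vec n →L[ℝ] Vec n) k (fun y => Af.rep (f y)) x := by
  rw [← contMDiffWithinAt_univ, ← contMDiffWithinAt_univ]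
  exact contMDiffWithinAt_Af_iff

theorem contMDiff_rep : ContMDiff 𝓘(ℝ, AfLie n) 𝓘(ℝ, Vec n →L[ℝ] Vec n) ∞ (Af.rep (n := n)) :=
  fun _ => (contMDiffAt_Af_iff (f := id)).1 contMDiffAt_id

theorem _root_.ContMDiffWithinAt.af_mul {k : ℕ∞ω} {f g : M → Af n} {s : Set M} {x : M}
    (hf : ContMDiffWithinAt I 𝓘(ℝ, AfLie n) k f s x)
    (hg : ContMDiffWithinAt I 𝓘(ℝ, AfLie n) k g s x) :
    ContMDiffWithinAt I 𝓘(ℝ, AfLie n) k (fun y => f y * g y) s x := by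
  rw [contMDiffWithinAt_Af_iff] at hf hg ⊢
  simp only [map_mul]
  exact hf.clm_comp hg

theorem _root_.ContMDiffWithinAt.af_inv {k : ℕ∞ω} {f : M → Af n} {s : Set M} {x : M}
    (hf : ContMDiffWithinAt I 𝓘(ℝ, AfLie n) k f s x) :
    ContMDiffWithinAt I 𝓘(ℝ, AfLie n) k (fun y => (f y)⁻¹) s x := by
  rw [contMDiffWithinAt_Af_iff] at hf ⊢
  simp only [Af.rep_inv]
  have h1 : ContDiffAt ℝ k Ring.inverse (Af.rep (f x)) := by
    obtain ⟨a, ha⟩ := Af.isUnit_rep (f x)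
    rw [← ha]
    exact contDiffAt_ringInverse ℝ a
  exact h1.contMDiffAt.comp_contMDiffWithinAt x hf

theorem _root_.ContMDiffAt.af_mul {k : ℕ∞ω} {f g : M → Af n} {x : M}
    (hf : ContMDiffAt I 𝓘(ℝ, AfLie n) k f x)
    (hg : ContMDiffAt I 𝓘(ℝ, AfLie n) k g x) :
    ContMDiffAt I 𝓘(ℝ, AfLie n) k (fun y => f y * g y) x :=
  ContMDiffWithinAt.af_mul hf hg

theorem _root_.ContMDiffAt.af_inv {k : ℕ∞ω} {f : M → Af n} {x : M}
    (hf : ContMDiffAt I 𝓘(ℝ, AfLie n) k f x) :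
    ContMDiffAt I 𝓘(ℝ, AfLie n) k (fun y => (f y)⁻¹) x :=
  ContMDiffWithinAt.af_inv hf

/-- The differential of the representation is the action of the Lie algebra. -/
theorem mvfderiv_rep (g : Af n) (ξ : TangentSpace 𝓘(ℝ, AfLie n) g) :
    mvfderiv 𝓘(ℝ, AfLie n) (Af.rep (n := n)) g ξ = AfLie.op (ξ : AfLie n) := by
  have h := mvfderiv_eq_chart (I := 𝓘(ℝ, AfLie n)) (f := (Af.rep (n := n) : Af n → _))
    (g := fun ξ : AfLie n => AfLie.op ξ + lastProj n) (p := g)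
    ((AfLie.op (n := n)).differentiableAt.add_const _)
    (Filter.Eventually.of_forall fun h => by rw [extChartAt_Af]; exact Af.rep_eq h) ξ
  rw [h]
  have h1 : fderiv ℝ (fun ξ : AfLie n => AfLie.op ξ + lastProj n)
      (extChartAt 𝓘(ℝ, AfLie n) g g) = AfLie.op := by
    rw [fderiv_add_const]
    exact (AfLie.op (n := n)).fderiv
  rw [h1]
  congr 1
  -- The differential of the chart at its own base point is the identity: it is the tangent
  -- coordinate change from that chart to itself.
  have h2 := TangentBundle.continuousLinearMapAt_trivializationAt (I := 𝓘(ℝ, AfLie n))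
    (mem_chart_source (AfLie n) g)
  have h3 := TangentBundle.continuousLinearMapAt_trivializationAt_eq_core (I := 𝓘(ℝ, AfLie n))
    (mem_chart_source (AfLie n) g)
  refine (DFunLike.congr_fun (h2.symm.trans h3) ξ).trans ?_
  exact (tangentBundleCore 𝓘(ℝ, AfLie n) (Af n)).coordChange_self (achart (AfLie n) g) g
    (mem_chart_source (AfLie n) g) ξ

/-- The derivative of an operator-valued function coming from the affine group. -/
theorem mvfderiv_rep_comp {f : M → Af n} {x : M} (hf : MDifferentiableAt I 𝓘(ℝ, AfLie n) f x)
    (w : TangentSpace I x) :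
    mvfderiv I (fun y => Af.rep (f y)) x w =
      AfLie.op (mfderiv I 𝓘(ℝ, AfLie n) f x w : AfLie n) := by
  rw [← mvfderiv_rep]
  have h := (((contMDiff_rep (n := n)).mdifferentiable (by simp) (f x)).hasMFDerivAt.comp x
    hf.hasMFDerivAt).mfderiv
  exact congrArg (fun A : E →L[ℝ] (Vec n →L[ℝ] Vec n) => A w) h

end AffineGroup

end FlatAffine

namespace FlatAffine

variable {V : Type v} [NormedAddCommGroup V] [NormedSpace ℝ V]
  {X : Type u} [TopologicalSpace X] [ChartedSpace V X] {n : ℕ}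

/-! ### Principal bundles -/

namespace AffineBundle

variable (A : AffineBundle.{u, v} V X n)

/-- A smooth equivariant local trivialization of a principal bundle. -/
structure IsSmoothTriv (e : Trivialization (Af n) A.proj) : Prop where
  contMDiffOn : ContMDiffOn (totalModel V n) (𝓘(ℝ, V).prod 𝓘(ℝ, AfLie n)) ∞ e e.source
  contMDiffOn_symm : ContMDiffOn (𝓘(ℝ, V).prod 𝓘(ℝ, AfLie n)) (totalModel V n) ∞
      e.toOpenPartialHomeomorph.symm e.target
  map_action : ∀ p ∈ e.source, ∀ g : Af n, e (MulOpposite.op g • p) = ((e p).1, (e p).2 * g)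

theorem exists_trivAt (x : X) : ∃ e : Trivialization (Af n) A.proj, x ∈ e.baseSet ∧
    A.IsSmoothTriv e := by
  obtain ⟨e, h1, h2, h3, h4⟩ := A.locally_trivial x
  exact ⟨e, h1, h2, h3, h4⟩

/-- A chosen smooth trivialization around a point. -/
def trivAt (x : X) : Trivialization (Af n) A.proj := (A.exists_trivAt x).choose

theorem mem_trivAt (x : X) : x ∈ (A.trivAt x).baseSet := (A.exists_trivAt x).choose_spec.1

theorem isSmoothTriv_trivAt (x : X) : A.IsSmoothTriv (A.trivAt x) :=
  (A.exists_trivAt x).choose_spec.2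

variable {A}

/-- The local section defined by a trivialization. -/
def sec (e : Trivialization (Af n) A.proj) (y : X) : A.carrier :=
  e.toOpenPartialHomeomorph.symm (y, 1)

/-- The group coordinate defined by a trivialization. -/
def coord (e : Trivialization (Af n) A.proj) (p : A.carrier) : Af n := (e p).2

variable {e : Trivialization (Af n) A.proj}

theorem sec_mem_source {y : X} (hy : y ∈ e.baseSet) : sec e y ∈ e.source :=
  e.map_target (e.mem_target.2 hy)

theorem proj_sec {y : X} (hy : y ∈ e.baseSet) : A.proj (sec e y) = y :=
  e.proj_symm_apply (e.mem_target.2 hy)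

theorem apply_sec {y : X} (hy : y ∈ e.baseSet) : e (sec e y) = (y, 1) :=
  e.apply_symm_apply (e.mem_target.2 hy)

theorem coord_sec {y : X} (hy : y ∈ e.baseSet) : coord e (sec e y) = 1 := by
  rw [coord, apply_sec hy]

theorem smul_mem_source {p : A.carrier} (hp : p ∈ e.source) (g : Af n) :
    MulOpposite.op g • p ∈ e.source := by
  rw [e.mem_source, A.proj_action]
  exact e.mem_source.1 hp

namespace IsSmoothTriv

variable (he : A.IsSmoothTriv e)
include he

theorem coord_smul {p : A.carrier} (hp : p ∈ e.source) (g : Af n) :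
    coord e (MulOpposite.op g • p) = coord e p * g := by
  rw [coord, he.map_action p hp]; rfl

theorem coord_smul_sec {p : A.carrier} (hp : p ∈ e.source) :
    MulOpposite.op (coord e p) • sec e (A.proj p) = p := by
  have hy := e.mem_source.1 hp
  refine e.injOn (smul_mem_source (sec_mem_source hy) _) hp ?_
  change e _ = e _
  rw [he.map_action _ (sec_mem_source hy), apply_sec hy]
  simp only [one_mul]
  refine Prod.ext ?_ rfl
  exact (e.coe_fst hp).symm

theorem contMDiffOn_sec : ContMDiffOn 𝓘(ℝ, V) (totalModel V n) ∞ (sec e) e.baseSet := by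
  refine he.contMDiffOn_symm.comp (contMDiffOn_id.prodMk contMDiffOn_const) ?_
  intro y hy
  exact e.mem_target.2 hy

theorem contMDiffAt_sec {y : X} (hy : y ∈ e.baseSet) :
    ContMDiffAt 𝓘(ℝ, V) (totalModel V n) ∞ (sec e) y :=
  he.contMDiffOn_sec.contMDiffAt (e.open_baseSet.mem_nhds hy)

theorem contMDiffOn_coord : ContMDiffOn (totalModel V n) 𝓘(ℝ, AfLie n) ∞ (coord e) e.source :=
  contMDiff_snd.comp_contMDiffOn he.contMDiffOn

theorem contMDiffAt_coord {p : A.carrier} (hp : p ∈ e.source) :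
    ContMDiffAt (totalModel V n) 𝓘(ℝ, AfLie n) ∞ (coord e) p :=
  he.contMDiffOn_coord.contMDiffAt (e.open_source.mem_nhds hp)

end IsSmoothTriv

variable (A) in
theorem proj_surjective : Function.Surjective A.proj := fun x =>
  ⟨sec (A.trivAt x) x, proj_sec (A.mem_trivAt x)⟩

theorem mem_source_trivAt (p : A.carrier) : p ∈ (A.trivAt (A.proj p)).source :=
  (A.trivAt (A.proj p)).mem_source.2 (A.mem_trivAt _)

theorem exists_smul_eq {p q : A.carrier} (h : A.proj p = A.proj q) :
    ∃ g : Af n, MulOpposite.op g • p = q := by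
  let e := A.trivAt (A.proj p)
  have he := A.isSmoothTriv_trivAt (A.proj p)
  have hp : p ∈ e.source := mem_source_trivAt p
  have hq : q ∈ e.source := by
    rw [e.mem_source, ← h]; exact A.mem_trivAt _
  refine ⟨(coord e p)⁻¹ * coord e q, e.injOn (smul_mem_source hp _) hq ?_⟩
  change e _ = e _
  rw [he.map_action p hp]
  refine Prod.ext ?_ ?_
  · simp only; rw [e.coe_fst hp, e.coe_fst hq, h]
  · exact mul_inv_cancel_left (coord e p) (coord e q)

theorem contMDiff_smul (g : Af n) : ContMDiff (totalModel V n) (totalModel V n) ∞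
    (fun p : A.carrier => MulOpposite.op g • p) :=
  A.contMDiff_action.comp (contMDiff_id.prodMk contMDiff_const)

theorem contMDiff_orbit (p : A.carrier) : ContMDiff 𝓘(ℝ, AfLie n) (totalModel V n) ∞
    (fun g : Af n => MulOpposite.op g • p) :=
  A.contMDiff_action.comp (contMDiff_const.prodMk contMDiff_id)

theorem mfderiv_proj_sec (he : A.IsSmoothTriv e) {y : X} (hy : y ∈ e.baseSet)
    (w : TangentSpace 𝓘(ℝ, V) y) :
    mfderiv (totalModel V n) 𝓘(ℝ, V) A.proj (sec e y)
      (mfderiv 𝓘(ℝ, V) (totalModel V n) (sec e) y w) = w := by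
  have h1 : MDifferentiableAt (totalModel V n) 𝓘(ℝ, V) A.proj (sec e y) :=
    A.contMDiff_proj.mdifferentiable (by simp) _
  have h2 := (he.contMDiffAt_sec hy).mdifferentiableAt (by simp)
  have h3 := (h1.hasMFDerivAt.comp y h2.hasMFDerivAt).congr_of_eventuallyEq
    (f₁ := id) (by filter_upwards [e.open_baseSet.mem_nhds hy] with z hz using (proj_sec hz).symm)
  have h4 := hasMFDerivAt_unique h3 (hasMFDerivAt_id y)
  exact congrArg (fun B : V →L[ℝ] V => B w) h4

/-- A right translate of a local section passes through `p`, and its differential lifts tangent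
vectors. Identities between forms on `X` can then be checked on vectors coming from the total space.
-/
theorem mfderiv_proj_surjective (p : A.carrier) (w : TangentSpace 𝓘(ℝ, V) (A.proj p)) :
    ∃ w' : TangentSpace (totalModel V n) p,
      mfderiv (totalModel V n) 𝓘(ℝ, V) A.proj p w' = w := by
  set e := A.trivAt (A.proj p)
  have he : A.IsSmoothTriv e := A.isSmoothTriv_trivAt (A.proj p)
  have hp : p ∈ e.source := mem_source_trivAt p
  have hy := e.mem_source.1 hp
  have h1 := mfderiv_proj_sec he hy w
  have hact : (fun q : A.carrier => A.proj (MulOpposite.op (coord e p) • q)) = A.proj := by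
    funext q; exact A.proj_action _ _
  have d1 : MDifferentiableAt (totalModel V n) (totalModel V n)
      (fun q : A.carrier => MulOpposite.op (coord e p) • q) (sec e (A.proj p)) :=
    (contMDiff_smul _).mdifferentiable (by simp) _
  have d2 : MDifferentiableAt (totalModel V n) 𝓘(ℝ, V) A.proj
      (MulOpposite.op (coord e p) • sec e (A.proj p)) :=
    A.contMDiff_proj.mdifferentiable (by simp) _
  have h2 := (d2.hasMFDerivAt.comp _ d1.hasMFDerivAt).mfderiv
  have h3 : mfderiv (totalModel V n) 𝓘(ℝ, V) (A.proj ∘ fun q : A.carrier =>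
      MulOpposite.op (coord e p) • q) = mfderiv (totalModel V n) 𝓘(ℝ, V) A.proj :=
    congrArg _ hact
  rw [h3] at h2
  have key : ∀ q : A.carrier, q = p → ∀ u : V × AfLie n,
      (mfderiv (totalModel V n) 𝓘(ℝ, V) A.proj q u : V) =
        mfderiv (totalModel V n) 𝓘(ℝ, V) A.proj p u := by
    rintro q rfl u; rfl
  refine ⟨(mfderiv (totalModel V n) (totalModel V n)
      (fun q : A.carrier => MulOpposite.op (coord e p) • q) (sec e (A.proj p))
      (mfderiv 𝓘(ℝ, V) (totalModel V n) (sec e) (A.proj p) w) : V × AfLie n), ?_⟩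
  refine (key _ (he.coord_smul_sec hp) _).symm.trans ?_
  refine Eq.trans ?_ h1
  exact (congrArg (fun B : (V × AfLie n) →L[ℝ] V => B (mfderiv 𝓘(ℝ, V) (totalModel V n) (sec e)
    (A.proj p) w)) h2).symm

end AffineBundle

/-! ### Principal connections in local trivializations -/

namespace PrincipalConnection

open AffineBundle

variable {A : AffineBundle.{u, v} V X n} (C : PrincipalConnection A)

theorem form_congr {p q : A.carrier} (h : p = q) (w : V × AfLie n) :
    C.form p w = C.form q w := by subst h; rfl

/-- The connection form, with values in the operators on `ℂ^{n+1}`. -/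
def opForm (p : A.carrier) : TangentSpace (totalModel V n) p →L[ℝ] (Vec n →L[ℝ] Vec n) :=
  AfLie.op.comp (C.form p)

theorem opForm_congr {p q : A.carrier} (h : p = q) (w : V × AfLie n) :
    C.opForm p w = C.opForm q w := by subst h; rfl

theorem opForm_smul (g : Af n) (p : A.carrier) (w : TangentSpace (totalModel V n) p) :
    C.opForm (MulOpposite.op g • p) (mfderiv (totalModel V n) (totalModel V n)
      (fun q : A.carrier => MulOpposite.op g • q) p w) =
    Af.rep g⁻¹ * C.opForm p w * Af.rep g := by
  ext1 u
  have h := congrArg (fun B => B *ᵥ u) (C.equivariant g p w)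
  simp only [← Matrix.mulVec_mulVec] at h
  exact h

/-- Along a fibre the connection form is the Maurer–Cartan form. With `q = p · g`, the orbit map of
`p` is that of `q` after left translation by `g⁻¹`, which reduces the claim to `vertical` at `q`. -/
theorem opForm_orbit (g : Af n) (p : A.carrier) (η : TangentSpace 𝓘(ℝ, AfLie n) g) :
    C.opForm (MulOpposite.op g • p)
      (mfderiv 𝓘(ℝ, AfLie n) (totalModel V n) (fun h : Af n => MulOpposite.op h • p) g η) =
    Af.rep g⁻¹ * AfLie.op (η : AfLie n) := by
  have hL : ContMDiff 𝓘(ℝ, AfLie n) 𝓘(ℝ, AfLie n) ∞ (fun h : Af n => g⁻¹ * h) := fun h =>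
    ContMDiffAt.af_mul contMDiffAt_const contMDiffAt_id
  set q := MulOpposite.op g • p with hq
  have horb : (fun h : Af n => MulOpposite.op h • p) =
      (fun h : Af n => MulOpposite.op h • q) ∘ fun h => g⁻¹ * h := by
    funext h
    simp only [Function.comp_apply, hq, smul_smul, ← MulOpposite.op_mul, mul_inv_cancel_left]
  have dL : MDifferentiableAt 𝓘(ℝ, AfLie n) 𝓘(ℝ, AfLie n) (fun h : Af n => g⁻¹ * h) g :=
    hL.mdifferentiable (by simp) g
  let ξ : AfLie n := mfderiv 𝓘(ℝ, AfLie n) 𝓘(ℝ, AfLie n) (fun h : Af n => g⁻¹ * h) g η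
  have hξ : AfLie.op ξ = Af.rep g⁻¹ * AfLie.op (η : AfLie n) := by
    have h1 := mvfderiv_rep_comp dL η
    refine h1.symm.trans ?_
    rw [← mvfderiv_rep g η]
    have h2 : (fun h : Af n => Af.rep (g⁻¹ * h)) =
        (ContinuousLinearMap.compL ℝ (Vec n) (Vec n) (Vec n) (Af.rep g⁻¹)) ∘ Af.rep := by
      funext h; exact map_mul _ _ _
    have h3 := ((ContinuousLinearMap.compL ℝ (Vec n) (Vec n) (Vec n) (Af.rep g⁻¹)).hasMFDerivAt.comp g
      ((contMDiff_rep (n := n)).mdifferentiable (by simp) g).hasMFDerivAt).mfderiv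
    rw [h2]
    exact congrArg (fun B : AfLie n →L[ℝ] (Vec n →L[ℝ] Vec n) => B η) h3
  have d1 : MDifferentiableAt 𝓘(ℝ, AfLie n) (totalModel V n)
      (fun h : Af n => MulOpposite.op h • q) (g⁻¹ * g) :=
    (contMDiff_orbit q).mdifferentiable (by simp) _
  have hd : (mfderiv 𝓘(ℝ, AfLie n) (totalModel V n) (fun h : Af n => MulOpposite.op h • p) g η :
      V × AfLie n) = mfderiv 𝓘(ℝ, AfLie n) (totalModel V n)
        (fun h : Af n => MulOpposite.op h • q) 1 ξ := by
    rw [horb]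
    have h4 := (d1.hasMFDerivAt.comp g dL.hasMFDerivAt).mfderiv
    refine (congrArg (fun B : AfLie n →L[ℝ] V × AfLie n => B η) h4).trans ?_
    have key : ∀ (a b : Af n), a = b → ∀ u : AfLie n,
        (mfderiv 𝓘(ℝ, AfLie n) (totalModel V n) (fun h : Af n => MulOpposite.op h • q) a u :
          V × AfLie n) =
        mfderiv 𝓘(ℝ, AfLie n) (totalModel V n) (fun h : Af n => MulOpposite.op h • q) b u := by
      rintro a b rfl u; rfl
    exact key _ _ (inv_mul_cancel g) ξ
  rw [← hξ]
  have h5 := C.vertical q ξ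
  have h6 : C.form q (mfderiv 𝓘(ℝ, AfLie n) (totalModel V n)
      (fun h : Af n => MulOpposite.op h • q) 1 ξ : V × AfLie n) = ξ := by
    refine Eq.trans (C.form_congr (q := MulOpposite.op (1 : Af n) • q) ?_ _) h5
    rw [MulOpposite.op_one, one_smul]
  exact congrArg AfLie.op ((congrArg (fun u : V × AfLie n => C.form q u) hd).trans h6)

/-- The connection form pulled back along the local section of a trivialization. -/
def localForm (e : Trivialization (Af n) A.proj) (y : X) :
    TangentSpace 𝓘(ℝ, V) y →L[ℝ] (Vec n →L[ℝ] Vec n) :=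
  (C.opForm (sec e y)).comp (mfderiv 𝓘(ℝ, V) (totalModel V n) (sec e) y)

/-- The connection form in a local trivialization. -/
theorem coord_mul_opForm {e : Trivialization (Af n) A.proj} (he : A.IsSmoothTriv e) {p : A.carrier}
    (hp : p ∈ e.source) (w : TangentSpace (totalModel V n) p) :
    Af.rep (coord e p) * C.opForm p w =
      C.localForm e (A.proj p) (mfderiv (totalModel V n) 𝓘(ℝ, V) A.proj p w) *
        Af.rep (coord e p) +
      mvfderiv (totalModel V n) (fun q => Af.rep (coord e q)) p w := by
  have hy := e.mem_source.1 hp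
  set g := coord e p with hg
  set s := sec e (A.proj p) with hs
  have hgs : MulOpposite.op g • s = p := he.coord_smul_sec hp
  have dπ : MDifferentiableAt (totalModel V n) 𝓘(ℝ, V) A.proj p :=
    A.contMDiff_proj.mdifferentiable (by simp) p
  have dσ : MDifferentiableAt 𝓘(ℝ, V) (totalModel V n) (sec e) (A.proj p) :=
    (he.contMDiffAt_sec hy).mdifferentiableAt (by simp)
  have dγ : MDifferentiableAt (totalModel V n) 𝓘(ℝ, AfLie n) (coord e) p :=
    (he.contMDiffAt_coord hp).mdifferentiableAt (by simp)
  have dF : MDifferentiableAt ((totalModel V n).prod 𝓘(ℝ, AfLie n)) (totalModel V n)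
      (fun q : A.carrier × Af n => MulOpposite.op q.2 • q.1) (s, g) :=
    A.contMDiff_action.mdifferentiable (by simp) _
  -- Near `p` every `q` is the translate of `sec e (π q)` by `coord e q`. Differentiating splits `w`
  -- into the translate of `a` and the orbit vector of `b`, to which `opForm_smul` and
  -- `opForm_orbit` apply.
  have h1 : HasMFDerivAt (totalModel V n) (totalModel V n)
      ((fun q : A.carrier × Af n => MulOpposite.op q.2 • q.1) ∘
        fun q => (sec e (A.proj q), coord e q)) p _ :=
    HasMFDerivAt.comp p dF.hasMFDerivAt
      ((dσ.hasMFDerivAt.comp p dπ.hasMFDerivAt).prodMk dγ.hasMFDerivAt)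
  have h2 := h1.congr_of_eventuallyEq (f₁ := id) (by
    filter_upwards [e.open_source.mem_nhds hp] with q hq
    exact (he.coord_smul_sec hq).symm)
  let a : V × AfLie n := mfderiv 𝓘(ℝ, V) (totalModel V n) (sec e) (A.proj p)
    (mfderiv (totalModel V n) 𝓘(ℝ, V) A.proj p w)
  let b : AfLie n := mfderiv (totalModel V n) 𝓘(ℝ, AfLie n) (coord e) p w
  have h3 : (w : V × AfLie n) = mfderiv ((totalModel V n).prod 𝓘(ℝ, AfLie n)) (totalModel V n)
      (fun q : A.carrier × Af n => MulOpposite.op q.2 • q.1) (s, g) (a, b) :=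
    congrArg (fun B : V × AfLie n →L[ℝ] V × AfLie n => B w)
      (hasMFDerivAt_unique (hasMFDerivAt_id p) h2)
  have h4 : (w : V × AfLie n) = _ := h3.trans (mfderiv_prod_eq_add_apply dF (v := (a, b)))
  have h5 : C.opForm p w = Af.rep g⁻¹ * C.opForm s a * Af.rep g + Af.rep g⁻¹ * AfLie.op b := by
    refine (C.opForm_congr hgs.symm w).trans ?_
    refine (congrArg (fun u : V × AfLie n => C.opForm (MulOpposite.op g • s) u) h4).trans ?_
    refine (map_add (C.opForm (MulOpposite.op g • s)) _ _).trans ?_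
    exact congrArg₂ (· + ·) (C.opForm_smul g s a) (C.opForm_orbit g s b)
  rw [h5, mvfderiv_rep_comp dγ w, mul_add, ← mul_assoc, ← mul_assoc, ← mul_assoc, Af.rep_mul_inv,
    one_mul, one_mul]
  rfl

end PrincipalConnection

end FlatAffine

namespace FlatAffine

variable {V : Type v} [NormedAddCommGroup V] [NormedSpace ℝ V]
  {X : Type u} [TopologicalSpace X] [ChartedSpace V X] {r : ℕ}

/-! ### Gauges of vector bundles -/

namespace ComplexVectorBundle

variable {F : ComplexVectorBundle.{u, v} V X r}

section

variable {E' H' N : Type*} [NormedAddCommGroup E'] [NormedSpace ℝ E'] [TopologicalSpace H']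
  {J : ModelWithCorners ℝ E' H'} [TopologicalSpace N] [ChartedSpace H' N]
  {W : Type*} [NormedAddCommGroup W] [NormedSpace ℝ W] [FiniteDimensional ℝ W]

theorem contMDiffAt_mk_symm {e : Trivialization (Fin r → ℂ) (TotalSpace.proj : F.Total → X)}
    [MemTrivializationAtlas e] {f : N → X} {h : N → Fin r → ℂ} {m₀ : N}
    (hf : ContMDiffAt J 𝓘(ℝ, V) ∞ f m₀) (hm : f m₀ ∈ e.baseSet)
    (hh : ContMDiffAt J 𝓘(ℝ, Fin r → ℂ) ∞ h m₀) :
    ContMDiffAt J (bundleModel V r) ∞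
      (fun m => (⟨f m, e.symmₗ ℂ (f m) (h m)⟩ : F.Total)) m₀ := by
  have hev : ∀ᶠ m in 𝓝 m₀, f m ∈ e.baseSet :=
    hf.continuousAt.eventually (e.open_baseSet.mem_nhds hm)
  have h1 := (e.contMDiffOn_symm (n := ∞) (IB := 𝓘(ℝ, V))).contMDiffAt
    (x := (f m₀, h m₀)) (e.open_target.mem_nhds (e.mem_target.2 hm))
  refine (ContMDiffAt.comp m₀ h1 (hf.prodMk hh)).congr_of_eventuallyEq ?_
  filter_upwards [hev] with m hm
  simp only [Function.comp_apply]
  rw [← e.mk_symm hm, e.symmₗ_apply hm]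

/-- A map to the total space is smooth if its image under a smooth, fibrewise linear and injective
map is smooth. -/
theorem contMDiffAt_of_injective {ψ : ∀ y, F.fib y →ₗ[ℝ] W} {U : Set X} (hU : IsOpen U)
    (hψ : ContMDiffOn (bundleModel V r) 𝓘(ℝ, W) ∞ (fun v : F.Total => ψ v.proj v.snd)
      (TotalSpace.proj ⁻¹' U)) {h : N → F.Total} {m₀ : N} (hm : (h m₀).proj ∈ U)
    (hinj : Function.Injective (ψ (h m₀).proj))
    (h1 : ContMDiffAt J 𝓘(ℝ, V) ∞ (fun m => (h m).proj) m₀)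
    (h2 : ContMDiffAt J 𝓘(ℝ, W) ∞ (fun m => ψ (h m).proj (h m).snd) m₀) :
    ContMDiffAt J (bundleModel V r) ∞ h m₀ := by
  refine contMDiffAt_totalSpace.2 ⟨h1, ?_⟩
  set e := trivializationAt (Fin r → ℂ) F.fib (h m₀).proj
  have he : (h m₀).proj ∈ e.baseSet := mem_baseSet_trivializationAt _ _ _
  have hev : ∀ᶠ m in 𝓝 m₀, (h m).proj ∈ e.baseSet :=
    h1.continuousAt.eventually (e.open_baseSet.mem_nhds he)
  have key : ∀ m, (h m).proj ∈ e.baseSet → e.symmₗ ℂ (h m).proj (e (h m)).2 = (h m).snd := by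
    intro m hm
    have h3 := e.symmₗ_linearMapAt (R := ℂ) hm (h m).snd
    rwa [e.coe_linearMapAt_of_mem hm] at h3
  -- In the trivialization `e`, `ψ` becomes a smooth family of operators, injective at `m₀`, whose
  -- values on the fibre coordinates of `h` are smooth by `h2`.
  let T : N → (Fin r → ℂ) →L[ℝ] W := fun m => LinearMap.toContinuousLinearMap
    ((ψ (h m).proj) ∘ₗ (e.symmₗ ℂ (h m).proj).restrictScalars ℝ)
  refine contMDiffAt_of_injective_apply (T := T) ?_ ?_ ?_
  · refine contMDiffAt_clm_of_apply fun w => ?_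
    have h3 := hψ.contMDiffAt (x := ⟨(h m₀).proj, e.symmₗ ℂ (h m₀).proj w⟩)
      ((hU.preimage (FiberBundle.continuous_proj (Fin r → ℂ) F.fib)).mem_nhds hm)
    have h4 := contMDiffAt_mk_symm (h := fun _ => w) h1 he contMDiffAt_const
    exact ContMDiffAt.comp (f := fun m => (⟨(h m).proj, e.symmₗ ℂ (h m).proj w⟩ : F.Total))
      m₀ h3 h4
  · refine hinj.comp ?_
    have : Function.LeftInverse (e.linearMapAt ℂ (h m₀).proj) (e.symmₗ ℂ (h m₀).proj) :=
      fun w => e.linearMapAt_symmₗ he w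
    exact this.injective
  · refine h2.congr_of_eventuallyEq ?_
    filter_upwards [hev] with m hm
    exact congrArg (ψ (h m).proj) (key m hm)

end

variable (F) in
/-- A local trivialization of a vector bundle, given fibre by fibre and with arbitrary values away
from its base. -/
structure Gauge where
  base : Set X
  isOpen_base : IsOpen base
  map : ∀ y, F.fib y ≃ₗ[ℂ] (Fin r → ℂ)
  contMDiffOn_map : ContMDiffOn (bundleModel V r) 𝓘(ℝ, Fin r → ℂ) ∞
    (fun v : F.Total => map v.proj v.snd) (TotalSpace.proj ⁻¹' base)

namespace Gauge

variable (c : F.Gauge)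

/-- A gauge on a fibre as a real linear map. -/
def mapR (y : X) : F.fib y →ₗ[ℝ] (Fin r → ℂ) := (c.map y).toLinearMap.restrictScalars ℝ

theorem contMDiffAt_map {v : F.Total} (hv : v.proj ∈ c.base) :
    ContMDiffAt (bundleModel V r) 𝓘(ℝ, Fin r → ℂ) ∞ (fun v : F.Total => c.map v.proj v.snd) v :=
  c.contMDiffOn_map.contMDiffAt
    ((c.isOpen_base.preimage (FiberBundle.continuous_proj (Fin r → ℂ) F.fib)).mem_nhds hv)

section

variable {E' H' N : Type*} [NormedAddCommGroup E'] [NormedSpace ℝ E'] [TopologicalSpace H']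
  {J : ModelWithCorners ℝ E' H'} [TopologicalSpace N] [ChartedSpace H' N]

/-- A gauge is only assumed smooth in one direction. Fibrewise injectivity supplies the other
direction, so smoothness of maps to `F` may be tested in a gauge as in a trivialization. -/
theorem contMDiffAt_iff {h : N → F.Total} {m₀ : N} (hm : (h m₀).proj ∈ c.base) :
    ContMDiffAt J (bundleModel V r) ∞ h m₀ ↔
      ContMDiffAt J 𝓘(ℝ, V) ∞ (fun m => (h m).proj) m₀ ∧
      ContMDiffAt J 𝓘(ℝ, Fin r → ℂ) ∞ (fun m => c.map (h m).proj (h m).snd) m₀ := by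
  refine ⟨fun h0 => ⟨(contMDiffAt_totalSpace.1 h0).1, (c.contMDiffAt_map hm).comp m₀ h0⟩,
    fun ⟨h1, h2⟩ => ?_⟩
  exact contMDiffAt_of_injective (ψ := c.mapR) c.isOpen_base c.contMDiffOn_map hm
    (c.map _).injective h1 h2

theorem contMDiffAt_symm {f : N → X} {h : N → Fin r → ℂ} {m₀ : N} (hm : f m₀ ∈ c.base)
    (hf : ContMDiffAt J 𝓘(ℝ, V) ∞ f m₀) (hh : ContMDiffAt J 𝓘(ℝ, Fin r → ℂ) ∞ h m₀) :
    ContMDiffAt J (bundleModel V r) ∞ (fun m => (⟨f m, (c.map (f m)).symm (h m)⟩ : F.Total)) m₀ := by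
  refine (c.contMDiffAt_iff hm).2 ⟨hf, ?_⟩
  simpa using hh

end

theorem diffAt_iff {s : ∀ y, F.fib y} {y : X} (hy : y ∈ c.base) :
    F.DiffAt s y ↔ MDifferentiableAt 𝓘(ℝ, V) 𝓘(ℝ, Fin r → ℂ) (fun z => c.map z (s z)) y := by
  constructor
  · intro h
    exact ((c.contMDiffAt_map (v := ⟨y, s y⟩) hy).mdifferentiableAt (by simp)).comp y h
  · intro h
    have h1 : ContMDiffAt (𝓘(ℝ, V).prod 𝓘(ℝ, Fin r → ℂ)) (bundleModel V r) ∞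
        (fun q : X × (Fin r → ℂ) => (⟨q.1, (c.map q.1).symm q.2⟩ : F.Total))
        (y, c.map y (s y)) :=
      c.contMDiffAt_symm hy contMDiffAt_fst contMDiffAt_snd
    have h2 := MDifferentiableAt.comp y (h1.mdifferentiableAt (by simp))
      ((mdifferentiableAt_id (I := 𝓘(ℝ, V))).prodMk h)
    refine h2.congr_of_eventuallyEq (Filter.Eventually.of_forall fun z => ?_)
    simp

theorem contMDiffAt_section_iff {s : ∀ y, F.fib y} {y : X} (hy : y ∈ c.base) :
    ContMDiffAt 𝓘(ℝ, V) (bundleModel V r) ∞ (fun z => (⟨z, s z⟩ : F.Total)) y ↔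
      ContMDiffAt 𝓘(ℝ, V) 𝓘(ℝ, Fin r → ℂ) ∞ (fun z => c.map z (s z)) y := by
  rw [c.contMDiffAt_iff (h := fun z => (⟨z, s z⟩ : F.Total)) hy]
  exact and_iff_right contMDiffAt_id

theorem diffAt_symm_const {y : X} (hy : y ∈ c.base) (w : Fin r → ℂ) :
    F.DiffAt (fun z => (c.map z).symm w) y :=
  (c.diffAt_iff hy).2 (by simpa using mdifferentiableAt_const)

end Gauge

end ComplexVectorBundle

end FlatAffine

namespace FlatAffine

/-! ### Connection forms of a connection on a vector bundle -/

/-- For `D = d + a` on a vector space, the second derivatives of `g` cancel by symmetry and the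
terms with derivatives of `Y` and `Z` cancel against the bracket; what remains is of order zero in
`g`. -/
theorem covariant_curvature {E W : Type*} [NormedAddCommGroup E] [NormedSpace ℝ E]
    [NormedAddCommGroup W] [NormedSpace ℝ W] {a : E → E →L[ℝ] (W →L[ℝ] W)} {g : E → W}
    {Y Z : E → E} {u : E} (ha : DifferentiableAt ℝ a u) (hg : ContDiffAt ℝ 2 g u)
    (hY : DifferentiableAt ℝ Y u) (hZ : DifferentiableAt ℝ Z u) :
    fderiv ℝ (fun x => fderiv ℝ g x (Z x) + a x (Z x) (g x)) u (Y u) +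
        a u (Y u) (fderiv ℝ g u (Z u) + a u (Z u) (g u)) -
      (fderiv ℝ (fun x => fderiv ℝ g x (Y x) + a x (Y x) (g x)) u (Z u) +
        a u (Z u) (fderiv ℝ g u (Y u) + a u (Y u) (g u))) -
      (fderiv ℝ g u (VectorField.lieBracket ℝ Y Z u) + a u (VectorField.lieBracket ℝ Y Z u) (g u)) =
    vcurv a u (Y u) (Z u) (g u) := by
  have hg1 : DifferentiableAt ℝ g u := hg.differentiableAt (by simp)
  have hg2 : DifferentiableAt ℝ (fderiv ℝ g) u :=
    (hg.fderiv_right (m := 1) (by norm_num)).differentiableAt (by simp)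
  have hsymm := (hg.isSymmSndFDerivAt (by simp)) (Y u) (Z u)
  have key : ∀ {Z : E → E} (_ : DifferentiableAt ℝ Z u) (y : E),
      fderiv ℝ (fun x => fderiv ℝ g x (Z x) + a x (Z x) (g x)) u y =
        fderiv ℝ (fderiv ℝ g) u y (Z u) + fderiv ℝ g u (fderiv ℝ Z u y) +
        (fderiv ℝ a u y (Z u) (g u) + a u (fderiv ℝ Z u y) (g u) + a u (Z u) (fderiv ℝ g u y)) := by
    intro Z hZ y
    have h1 := hg2.clm_apply hZ
    have h2 := ha.clm_apply hZ
    rw [fderiv_fun_add h1 (h2.clm_apply hg1), fderiv_clm_apply hg2 hZ, fderiv_clm_apply h2 hg1,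
      fderiv_clm_apply ha hZ]
    simp
    abel
  rw [key hZ, key hY, VectorField.lieBracket_eq, hsymm]
  simp [vcurv]
  abel

variable {V : Type v} [NormedAddCommGroup V] [NormedSpace ℝ V] [FiniteDimensional ℝ V]
  {X : Type u} [TopologicalSpace X] [ChartedSpace V X] [IsManifold 𝓘(ℝ, V) ∞ X] {r : ℕ}
  {F : ComplexVectorBundle.{u, v} V X r}

namespace Connection

open ComplexVectorBundle

variable (D : Connection F)

omit [FiniteDimensional ℝ V] in
theorem cov_congr {s t : ∀ y, F.fib y} {y : X} (hs : F.DiffAt s y) (h : ∀ᶠ z in 𝓝 y, s z = t z) :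
    D.cov s y = D.cov t y := by
  refine D.cov.isCovariantDerivativeOn.congr_of_eventuallyEq hs ?_ Filter.univ_mem h
  exact MDifferentiableAt.congr_of_eventuallyEq hs (h.mono fun z hz => by simp [hz])

omit [FiniteDimensional ℝ V] in
-- The Leibniz rule by induction; differentiability of the partial sums is part of the conclusion
-- because each step of the induction uses it.
theorem cov_sum {ι : Type*} (S : Finset ι) {σ : ι → ∀ y, F.fib y} {g : ι → X → ℝ} {y : X}
    (hσ : ∀ i, F.DiffAt (σ i) y) (hg : ∀ i, MDifferentiableAt 𝓘(ℝ, V) 𝓘(ℝ, ℝ) (g i) y)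
    (w : TangentSpace 𝓘(ℝ, V) y) :
    F.DiffAt (fun z => ∑ i ∈ S, g i z • σ i z) y ∧
    D.cov (fun z => ∑ i ∈ S, g i z • σ i z) y w =
      ∑ i ∈ S, (g i y • D.cov (σ i) y w + mvfderiv 𝓘(ℝ, V) (g i) y w • σ i y) := by
  classical
  induction S using Finset.induction_on with
  | empty =>
    simp only [Finset.sum_empty]
    refine ⟨mdifferentiableAt_zeroSection (𝕜 := ℝ) .., ?_⟩
    exact DFunLike.congr_fun (D.cov.isCovariantDerivativeOn.zero (x := y)) w
  | insert i S hi ih =>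
    have h1 : F.DiffAt (g i • σ i) y := MDifferentiableAt.smul_section (hg i) (hσ i)
    have e : (fun z => ∑ j ∈ insert i S, g j z • σ j z) =
        g i • σ i + fun z => ∑ j ∈ S, g j z • σ j z := by
      funext z; simp [Finset.sum_insert hi]
    rw [e]
    refine ⟨mdifferentiableAt_add_section h1 ih.1, ?_⟩
    rw [D.cov.isCovariantDerivativeOn.add h1 ih.1, Finset.sum_insert hi, ← ih.2,
      D.cov.isCovariantDerivativeOn.leibniz (hσ i) (hg i)]
    simp

/-- The covariant derivative of a section, read in a gauge. -/
def gaugeCov (c : F.Gauge) (s : ∀ y, F.fib y) (y : X) : V →L[ℝ] (Fin r → ℂ) :=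
  LinearMap.toContinuousLinearMap
    { toFun := fun v : V => c.map y (D.cov s y v)
      map_add' := fun v w => by
        refine (congrArg (c.map y) (map_add (D.cov s y) v w)).trans (map_add (c.map y) _ _)
      map_smul' := fun a v =>
        (congrArg (c.map y) (map_smul (D.cov s y) a v)).trans (map_smul (c.mapR y) _ _) }

/-- The matrix of one-forms of a connection in a gauge. -/
def gaugeForm (c : F.Gauge) (y : X) :
    TangentSpace 𝓘(ℝ, V) y →L[ℝ] ((Fin r → ℂ) →L[ℝ] (Fin r → ℂ)) :=
  -- Linearity in the fibre vector is imposed through a real basis: outside `c.base` the constant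
  -- sections need not be differentiable, and their covariant derivatives are then unconstrained.
  (∑ i, (ContinuousLinearMap.smulRightL ℝ (Fin r → ℂ) (Fin r → ℂ)
      (LinearMap.toContinuousLinearMap ((Module.finBasis ℝ (Fin r → ℂ)).coord i))).comp
    (D.gaugeCov c (fun z => (c.map z).symm (Module.finBasis ℝ (Fin r → ℂ) i)) y) :
      V →L[ℝ] ((Fin r → ℂ) →L[ℝ] (Fin r → ℂ)))

theorem gaugeForm_apply (c : F.Gauge) (y : X) (v : TangentSpace 𝓘(ℝ, V) y) (w : Fin r → ℂ) :
    D.gaugeForm c y v w = ∑ i, (Module.finBasis ℝ (Fin r → ℂ)).coord i w •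
      c.map y (D.cov (fun z => (c.map z).symm (Module.finBasis ℝ (Fin r → ℂ) i)) y v) := by
  have h : ∀ v : V, (∑ i, (ContinuousLinearMap.smulRightL ℝ (Fin r → ℂ) (Fin r → ℂ)
      (LinearMap.toContinuousLinearMap ((Module.finBasis ℝ (Fin r → ℂ)).coord i))).comp
      (D.gaugeCov c (fun z => (c.map z).symm (Module.finBasis ℝ (Fin r → ℂ) i)) y) :
        V →L[ℝ] ((Fin r → ℂ) →L[ℝ] (Fin r → ℂ))) v w =
      ∑ i, (Module.finBasis ℝ (Fin r → ℂ)).coord i w •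
        D.gaugeCov c (fun z => (c.map z).symm (Module.finBasis ℝ (Fin r → ℂ) i)) y v := by
    intro v
    rw [_root_.sum_apply, _root_.sum_apply]
    rfl
  exact h v

/-- A connection in a gauge. -/
theorem map_cov (c : F.Gauge) {y : X} (hy : y ∈ c.base) {s : ∀ z, F.fib z} (hs : F.DiffAt s y)
    (v : TangentSpace 𝓘(ℝ, V) y) :
    c.map y (D.cov s y v) = mvfderiv 𝓘(ℝ, V) (fun z => c.map z (s z)) y v +
      D.gaugeForm c y v (c.map y (s y)) := by
  set b := Module.finBasis ℝ (Fin r → ℂ)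
  have hsd := (c.diffAt_iff hy).1 hs
  let L : ∀ i, (Fin r → ℂ) →L[ℝ] ℝ := fun i => LinearMap.toContinuousLinearMap (b.coord i)
  have hg : ∀ i, MDifferentiableAt 𝓘(ℝ, V) 𝓘(ℝ, ℝ) (fun z => L i (c.map z (s z))) y := fun i =>
    (L i).differentiableAt.comp_mdifferentiableAt hsd
  have hd : ∀ i, mvfderiv 𝓘(ℝ, V) (fun z => L i (c.map z (s z))) y v =
      L i (mvfderiv 𝓘(ℝ, V) (fun z => c.map z (s z)) y v) := by
    intro i
    have h1 := ((L i).hasMFDerivAt.comp y hsd.hasMFDerivAt).mfderiv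
    exact congrArg (fun B : V →L[ℝ] ℝ => B v) h1
  -- Expansion of `s` in the constant sections of the gauge, with real functions as coefficients, to
  -- which the Leibniz rule applies.
  have e : s = fun z => ∑ i, L i (c.map z (s z)) • (c.map z).symm (b i) := by
    funext z
    apply (c.map z).injective
    have h1 : c.map z (∑ i, L i (c.map z (s z)) • (c.map z).symm (b i)) =
        ∑ i, L i (c.map z (s z)) • b i := by
      rw [map_sum]
      refine Finset.sum_congr rfl fun i _ => ?_
      exact (map_smul (c.mapR z) _ _).trans (congrArg _ ((c.map z).apply_symm_apply (b i)))
    rw [h1]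
    exact (b.sum_repr (c.map z (s z))).symm
  have h2 := (D.cov_sum Finset.univ (fun i => c.diffAt_symm_const hy (b i)) hg v).2
  rw [← e] at h2
  rw [h2, gaugeForm_apply, map_sum, add_comm]
  rw [← b.sum_repr (mvfderiv 𝓘(ℝ, V) (fun z => c.map z (s z)) y v), ← Finset.sum_add_distrib]
  refine Finset.sum_congr rfl fun i _ => ?_
  refine (map_add (c.map y) _ _).trans ?_
  congr 1
  · exact map_smul (c.mapR y) _ _
  · refine (map_smul (c.mapR y) _ _).trans ?_
    rw [hd]
    exact congrArg _ ((c.map y).apply_symm_apply (b i))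

theorem gaugeForm_eq (c : F.Gauge) {y : X} (hy : y ∈ c.base) (v : TangentSpace 𝓘(ℝ, V) y)
    (w : Fin r → ℂ) :
    D.gaugeForm c y v w = c.map y (D.cov (fun z => (c.map z).symm w) y v) := by
  rw [D.map_cov c hy (c.diffAt_symm_const hy w)]
  simp only [LinearEquiv.apply_symm_apply]
  have : mvfderiv 𝓘(ℝ, V) (fun _ : X => w) y v = 0 := by simp [mvfderiv]
  rw [this, zero_add]

theorem gaugeForm_smul (c : F.Gauge) {y : X} (hy : y ∈ c.base) (v : TangentSpace 𝓘(ℝ, V) y)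
    (a : ℂ) (w : Fin r → ℂ) : D.gaugeForm c y v (a • w) = a • D.gaugeForm c y v w := by
  rw [D.gaugeForm_eq c hy, D.gaugeForm_eq c hy]
  simp only [map_smul]
  rw [D.smul a _ y (c.diffAt_symm_const hy w), map_smul]

/-- Smoothness of a covariant derivative is expressed by global sections, while the constant
sections of a gauge are smooth only over its base. A bump function extends them without changing
their covariant derivatives near the given point. -/
theorem contMDiffOn_gaugeForm [T2Space X] (c : F.Gauge) :
    ContMDiffOn 𝓘(ℝ, V).tangent 𝓘(ℝ, (Fin r → ℂ) →L[ℝ] (Fin r → ℂ)) ∞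
      (fun v : TangentBundle 𝓘(ℝ, V) X => D.gaugeForm c v.proj v.snd)
      (TotalSpace.proj ⁻¹' c.base) := by
  intro v₀ hv₀
  refine ContMDiffAt.contMDiffWithinAt (contMDiffAt_clm_of_apply fun w => ?_)
  have hopen : IsOpen (TotalSpace.proj ⁻¹' c.base : Set (TangentBundle 𝓘(ℝ, V) X)) :=
    c.isOpen_base.preimage (FiberBundle.continuous_proj V (TangentSpace 𝓘(ℝ, V) : X → Type _))
  obtain ⟨ρ, -, hρ⟩ := (SmoothBumpFunction.nhds_basis_tsupport (I := 𝓘(ℝ, V)) v₀.proj).mem_iff.1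
    (c.isOpen_base.mem_nhds hv₀)
  have hs : ContMDiffOn 𝓘(ℝ, V) (bundleModel V r) ∞
      (fun z => (⟨z, (c.map z).symm w⟩ : F.Total)) c.base := fun z hz =>
    (c.contMDiffAt_symm hz contMDiffAt_id contMDiffAt_const).contMDiffWithinAt
  have hs' : ContMDiff 𝓘(ℝ, V) (bundleModel V r) ∞
      (fun z => (⟨z, ((ρ : X → ℝ) • fun z => (c.map z).symm w : ∀ z, F.fib z) z⟩ : F.Total)) :=
    ContMDiffOn.smul_section_of_tsupport ρ.contMDiff.contMDiffOn c.isOpen_base hρ hs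
  have h1 := D.contMDiff_cov.contMDiff.contMDiff (contMDiffOn_univ.2 (by simpa using hs'))
  rw [contMDiffOn_univ] at h1
  have h2 : ContMDiffAt 𝓘(ℝ, V).tangent (bundleModel V r) ∞
      (fun v : TangentBundle 𝓘(ℝ, V) X => (⟨v.proj, D.cov ((ρ : X → ℝ) • fun z => (c.map z).symm w) v.proj
        v.snd⟩ : F.Total)) v₀ := by
    have h3 := (h1 v₀.proj).comp v₀ (contMDiffAt_proj (n := ∞) (IB := 𝓘(ℝ, V))
      (TangentSpace 𝓘(ℝ, V) : X → Type _) (p := v₀))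
    exact ContMDiffAt.clm_bundle_apply h3 contMDiffAt_id
  have h4 := ((c.contMDiffAt_iff (h := fun v : TangentBundle 𝓘(ℝ, V) X => (⟨v.proj, D.cov ((ρ : X → ℝ) •
    fun z => (c.map z).symm w) v.proj v.snd⟩ : F.Total)) (m₀ := v₀) hv₀).1 h2).2
  refine h4.congr_of_eventuallyEq ?_
  -- Locality of `D` at `z` requires `ρ = 1` on a neighbourhood of `z`, and not only at `z` itself.
  have hnear : ∀ᶠ z in 𝓝 v₀.proj, z ∈ c.base ∧ ∀ᶠ z' in 𝓝 z, ρ z' = 1 :=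
    (c.isOpen_base.eventually_mem hv₀).and ρ.eventuallyEq_one.eventually_nhds
  filter_upwards [(FiberBundle.continuous_proj V
    (TangentSpace 𝓘(ℝ, V) : X → Type _)).continuousAt.eventually hnear] with v hv
  rw [D.gaugeForm_eq c hv.1]
  rw [D.cov_congr (c.diffAt_symm_const hv.1 w) (t := (ρ : X → ℝ) • fun z => (c.map z).symm w)]
  filter_upwards [hv.2] with z hz
  simp [hz]

theorem differentiableAt_chartForm_gaugeForm [T2Space X] (c : F.Gauge) {y : X} (hy : y ∈ c.base) :
    DifferentiableAt ℝ (chartForm (D.gaugeForm c) y) (extChartAt 𝓘(ℝ, V) y y) :=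
  differentiableAt_chartForm c.isOpen_base (D.contMDiffOn_gaugeForm c) hy

end Connection

end FlatAffine

/-! ### Curvature of a connection on a vector bundle in a gauge -/

namespace FlatAffine

/-- In contrast to `mvfderiv_eq_chart`, the derivative is taken away from the centre of the chart: a
second covariant derivative at `p` needs the first one at all nearby `q` in one chart. -/
theorem mvfderiv_eq_chart_of_mem {E H M : Type*} [NormedAddCommGroup E] [NormedSpace ℝ E]
    [TopologicalSpace H] {I : ModelWithCorners ℝ E H} [TopologicalSpace M] [ChartedSpace H M]
    [IsManifold I ∞ M]
    {F : Type*} [NormedAddCommGroup F] [NormedSpace ℝ F] {f : M → F}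
    {g : E → F} {p q : M} (hq : q ∈ (chartAt H p).source)
    (hg : DifferentiableAt ℝ g (extChartAt I p q))
    (h : f =ᶠ[𝓝 q] fun q => g (extChartAt I p q)) (w : TangentSpace I q) :
    mvfderiv I f q w = fderiv ℝ g (extChartAt I p q) (mfderiv I 𝓘(ℝ, E) (extChartAt I p) q w) := by
  have h1 : HasMFDerivAt I 𝓘(ℝ, F) (fun q => g (extChartAt I p q)) q _ :=
    hg.mdifferentiableAt.hasMFDerivAt.comp q
      ((mdifferentiableAt_extChartAt hq).hasMFDerivAt)
  have h2 := (h1.congr_of_eventuallyEq h).mfderiv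
  rw [mfderiv_eq_fderiv] at h2
  exact congrArg (fun B : E →L[ℝ] F => B w) h2

variable {V : Type v} [NormedAddCommGroup V] [NormedSpace ℝ V] [FiniteDimensional ℝ V]
  {X : Type u} [TopologicalSpace X] [ChartedSpace V X] [IsManifold 𝓘(ℝ, V) ∞ X] {r : ℕ}
  {F : ComplexVectorBundle.{u, v} V X r}

namespace Connection

open ComplexVectorBundle

variable (D : Connection F) [T2Space X]

/-- The curvature of a connection on a vector bundle, in a gauge. -/
theorem map_curvature (c : F.Gauge) {x : X} (hx : x ∈ c.base)
    {Y Z : ∀ x : X, TangentSpace 𝓘(ℝ, V) x} {s : ∀ x, F.fib x}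
    (hY : MDifferentiableAt 𝓘(ℝ, V) 𝓘(ℝ, V).tangent
      (fun x => (⟨x, Y x⟩ : TangentBundle 𝓘(ℝ, V) X)) x)
    (hZ : MDifferentiableAt 𝓘(ℝ, V) 𝓘(ℝ, V).tangent
      (fun x => (⟨x, Z x⟩ : TangentBundle 𝓘(ℝ, V) X)) x)
    (hs : ∀ᶠ y in 𝓝 x, ContMDiffAt 𝓘(ℝ, V) (bundleModel V r) ∞ (fun x => (⟨x, s x⟩ : F.Total)) y) :
    c.map x (D.cov (fun y => D.cov s y (Z y)) x (Y x) - D.cov (fun y => D.cov s y (Y y)) x (Z x) -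
      D.cov s x (VectorField.mlieBracket 𝓘(ℝ, V) Y Z x)) =
    vcurv (chartForm (D.gaugeForm c) x) (extChartAt 𝓘(ℝ, V) x x)
      (mfderiv 𝓘(ℝ, V) 𝓘(ℝ, V) (extChartAt 𝓘(ℝ, V) x) x (Y x))
      (mfderiv 𝓘(ℝ, V) 𝓘(ℝ, V) (extChartAt 𝓘(ℝ, V) x) x (Z x)) (c.map x (s x)) := by
  set φ := extChartAt 𝓘(ℝ, V) x with hφ
  set a := chartForm (D.gaugeForm c) x with ha'
  have ha : DifferentiableAt ℝ a (φ x) := D.differentiableAt_chartForm_gaugeForm c hx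
  let g : V → Fin r → ℂ := fun u => c.map (φ.symm u) (s (φ.symm u))
  have hsrc : ∀ᶠ y in 𝓝 x, y ∈ (chartAt V x).source :=
    (chartAt V x).open_source.eventually_mem (mem_chart_source V x)
  have hsymm : ∀ {y : X}, y ∈ (chartAt V x).source → φ.symm (φ y) = y := fun hy =>
    φ.left_inv (by rwa [hφ, extChartAt_source])
  have hcg : ∀ {y : X}, y ∈ (chartAt V x).source → c.map y (s y) = g (φ y) := by
    intro y hy
    simp only [g]
    rw [hsymm hy]
  have hg : ∀ {y : X}, y ∈ (chartAt V x).source → y ∈ c.base →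
      ContMDiffAt 𝓘(ℝ, V) (bundleModel V r) ∞ (fun x => (⟨x, s x⟩ : F.Total)) y →
      ContDiffAt ℝ 2 g (φ y) := by
    intro y hy hyc hys
    rw [← contMDiffAt_iff_contDiffAt]
    have h1 : ContMDiffAt 𝓘(ℝ, V) 𝓘(ℝ, V) ∞ φ.symm (φ y) := by
      have := contMDiffWithinAt_extChartAt_symm_range (I := 𝓘(ℝ, V)) (n := ∞) x
        ((extChartAt 𝓘(ℝ, V) x).map_source (by rwa [extChartAt_source]))
      rwa [ModelWithCorners.range_eq_univ, contMDiffWithinAt_univ] at this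
    have h2 := (c.contMDiffAt_section_iff hyc).1 hys
    have h3 : ContMDiffAt 𝓘(ℝ, V) 𝓘(ℝ, Fin r → ℂ) ∞ g (φ y) := by
      refine ContMDiffAt.comp (g := fun y => c.map y (s y)) (f := φ.symm) (φ y) ?_ h1
      rw [hsymm hy]
      exact h2
    exact h3.of_le ENat.LEInfty.out
  have hdiff : ∀ {y : X}, ContMDiffAt 𝓘(ℝ, V) (bundleModel V r) ∞
      (fun x => (⟨x, s x⟩ : F.Total)) y → F.DiffAt s y :=
    fun h => h.mdifferentiableAt (by simp)
  have hnear := hsrc.and ((c.isOpen_base.eventually_mem hx).and hs)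
  have hgx := hg (mem_chart_source V x) hx hs.self_of_nhds
  have hfield : ∀ (Y : ∀ x : X, TangentSpace 𝓘(ℝ, V) x) {y : X}, y ∈ (chartAt V x).source →
      chartField Y x (φ y) = mfderiv 𝓘(ℝ, V) 𝓘(ℝ, V) φ y (Y y) := by
    intro Y y hy
    simp only [chartField]
    have : ∀ z : X, z = y → (mfderiv 𝓘(ℝ, V) 𝓘(ℝ, V) φ z (Y z) : V) =
        mfderiv 𝓘(ℝ, V) 𝓘(ℝ, V) φ y (Y y) := by rintro z rfl; rfl
    exact this _ (hsymm hy)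
  have hform : ∀ {y : X}, y ∈ (chartAt V x).source → ∀ w : TangentSpace 𝓘(ℝ, V) y,
      D.gaugeForm c y w = a (φ y) (mfderiv 𝓘(ℝ, V) 𝓘(ℝ, V) φ y w) := fun hy w =>
    form_eq_chartForm _ (by rwa [extChartAt_source]) w
  -- The covariant derivative of `s` at every `y` near `x`, in the fixed chart at `x`; `key`
  -- differentiates this expression once more.
  have hcov : ∀ {y : X}, y ∈ (chartAt V x).source → y ∈ c.base →
      (∀ᶠ y in 𝓝 y, y ∈ (chartAt V x).source) →
      ContMDiffAt 𝓘(ℝ, V) (bundleModel V r) ∞ (fun x => (⟨x, s x⟩ : F.Total)) y →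
      ∀ w : TangentSpace 𝓘(ℝ, V) y, c.map y (D.cov s y w) =
        fderiv ℝ g (φ y) (mfderiv 𝓘(ℝ, V) 𝓘(ℝ, V) φ y w) +
        a (φ y) (mfderiv 𝓘(ℝ, V) 𝓘(ℝ, V) φ y w) (g (φ y)) := by
    intro y hy hyc hy' hys w
    rw [D.map_cov c hyc (hdiff hys), hform hy, hcg hy]
    congr 1
    exact mvfderiv_eq_chart_of_mem hy ((hg hy hyc hys).differentiableAt (by simp))
      (hy'.mono fun z hz => hcg hz) w
  have key : ∀ {Z : ∀ x : X, TangentSpace 𝓘(ℝ, V) x}, DifferentiableAt ℝ (chartField Z x) (φ x) →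
      ∀ w : TangentSpace 𝓘(ℝ, V) x, c.map x (D.cov (fun y => D.cov s y (Z y)) x w) =
        fderiv ℝ (fun u => fderiv ℝ g u (chartField Z x u) + a u (chartField Z x u) (g u)) (φ x)
          (mfderiv 𝓘(ℝ, V) 𝓘(ℝ, V) φ x w) +
        a (φ x) (mfderiv 𝓘(ℝ, V) 𝓘(ℝ, V) φ x w)
          (fderiv ℝ g (φ x) (chartField Z x (φ x)) + a (φ x) (chartField Z x (φ x)) (g (φ x))) := by
    intro Z hZ w
    have hev : (fun y => c.map y (D.cov s y (Z y))) =ᶠ[𝓝 x] fun y =>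
        (fun u => fderiv ℝ g u (chartField Z x u) + a u (chartField Z x u) (g u)) (φ y) := by
      filter_upwards [hnear, hsrc.eventually_nhds] with y hy hy'
      rw [hcov hy.1 hy.2.1 hy' hy.2.2, hfield Z hy.1]
    have hG : DifferentiableAt ℝ (fun u => fderiv ℝ g u (chartField Z x u) +
        a u (chartField Z x u) (g u)) (φ x) := by
      have hg2 : DifferentiableAt ℝ (fderiv ℝ g) (φ x) :=
        (hgx.fderiv_right (m := 1) (by norm_num)).differentiableAt (by simp)
      exact (hg2.clm_apply hZ).add ((ha.clm_apply hZ).clm_apply (hgx.differentiableAt (by simp)))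
    have hd : F.DiffAt (fun y => D.cov s y (Z y)) x := by
      rw [c.diffAt_iff hx]
      refine MDifferentiableAt.congr_of_eventuallyEq ?_ hev
      exact hG.comp_mdifferentiableAt (mdifferentiableAt_extChartAt (mem_chart_source V x))
    rw [D.map_cov c hx hd, mvfderiv_eq_chart hG hev, hform (mem_chart_source V x)]
    congr 2
    exact hev.self_of_nhds
  rw [map_sub, map_sub, key (differentiableAt_chartField hZ), key (differentiableAt_chartField hY),
    hcov (mem_chart_source V x) hx hsrc hs.self_of_nhds, mfderiv_extChartAt_mlieBracket,
    hcg (mem_chart_source V x), ← hfield Y (mem_chart_source V x),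
    ← hfield Z (mem_chart_source V x)]
  exact covariant_curvature ha hgx (differentiableAt_chartField hY) (differentiableAt_chartField hZ)

/-- Coordinate fields and constant sections of the gauge take every value at `x`, so testing `D² =
0` on them gives the vanishing of the curvature operator. -/
theorem isFlatAt_gaugeForm (hD : D.IsFlat) (c : F.Gauge) {x : X} (hx : x ∈ c.base) :
    IsFlatAt (D.gaugeForm c) x := by
  intro y z
  ext1 w
  have hopen : IsOpen (c.base ∩ (chartAt V x).source) :=
    c.isOpen_base.inter (chartAt V x).open_source
  have hmem : x ∈ c.base ∩ (chartAt V x).source := ⟨hx, mem_chart_source V x⟩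
  have hs : ∀ y ∈ c.base, ContMDiffAt 𝓘(ℝ, V) (bundleModel V r) ∞
      (fun z => (⟨z, (c.map z).symm w⟩ : F.Total)) y := fun y hy =>
    c.contMDiffAt_symm hy contMDiffAt_id contMDiffAt_const
  have h := D.map_curvature c hx (mdifferentiableAt_coordField x y)
    (mdifferentiableAt_coordField x z) ((c.isOpen_base.eventually_mem hx).mono hs)
  rw [hD _ hopen _ _ _ ((contMDiffOn_coordField x y).mono Set.inter_subset_right)
    ((contMDiffOn_coordField x z).mono Set.inter_subset_right)
    (fun y hy => (hs y hy.1).contMDiffWithinAt) x hmem, map_zero,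
    mfderiv_extChartAt_coordField, mfderiv_extChartAt_coordField,
    LinearEquiv.apply_symm_apply] at h
  exact h.symm

/-- By `map_curvature` the curvature depends only on the values of `Y`, `Z` and `s` at the point, so
a single gauge around each point suffices. -/
theorem isFlat_of_isFlatAt (h : ∀ x, ∃ c : F.Gauge, x ∈ c.base ∧ IsFlatAt (D.gaugeForm c) x) :
    D.IsFlat := by
  intro U hU Y Z s hY hZ hs x hx
  obtain ⟨c, hc, hflat⟩ := h x
  apply (c.map x).injective
  rw [map_zero, D.map_curvature c hc ((hY.contMDiffAt (hU.mem_nhds hx)).mdifferentiableAt (by simp))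
    ((hZ.contMDiffAt (hU.mem_nhds hx)).mdifferentiableAt (by simp))
    (hU.eventually_mem hx |>.mono fun y hy => hs.contMDiffAt (hU.mem_nhds hy))]
  exact congrArg (fun B : (Fin r → ℂ) →L[ℝ] (Fin r → ℂ) => B (c.map x (s x))) (hflat _ _)

end Connection

end FlatAffine

namespace FlatAffine

/-! ### Derivatives on manifolds -/

section Derivatives

variable {E H M : Type*} [NormedAddCommGroup E] [NormedSpace ℝ E] [TopologicalSpace H]
  {I : ModelWithCorners ℝ E H} [TopologicalSpace M] [ChartedSpace H M]
  {E' H' M' : Type*} [NormedAddCommGroup E'] [NormedSpace ℝ E'] [TopologicalSpace H']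
  {I' : ModelWithCorners ℝ E' H'} [TopologicalSpace M'] [ChartedSpace H' M']
  {W W' : Type*} [NormedAddCommGroup W] [NormedSpace ℝ W] [NormedAddCommGroup W']
  [NormedSpace ℝ W']

theorem contMDiffOn_tangentMap [IsManifold I ∞ M] [IsManifold I' ∞ M'] {f : M → M'} {U : Set M}
    (hU : IsOpen U) (hf : ContMDiffOn I I' ∞ f U) :
    ContMDiffOn I.tangent I'.tangent ∞ (tangentMap I I' f)
      (TotalSpace.proj ⁻¹' U : Set (TangentBundle I M)) := by
  refine (hf.contMDiffOn_tangentMapWithin (by simp) hU.uniqueMDiffOn).congr fun v hv => ?_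
  simp only [tangentMap, tangentMapWithin]
  rw [mfderivWithin_of_isOpen hU hv]

theorem contMDiffOn_mvfderiv [IsManifold I ∞ M] {f : M → W} {U : Set M} (hU : IsOpen U)
    (hf : ContMDiffOn I 𝓘(ℝ, W) ∞ f U) :
    ContMDiffOn I.tangent 𝓘(ℝ, W) ∞ (fun v : TangentBundle I M => mvfderiv I f v.proj v.snd)
      (TotalSpace.proj ⁻¹' U : Set (TangentBundle I M)) :=
  (contMDiff_snd_tangentBundle_modelSpace W 𝓘(ℝ, W)).comp_contMDiffOn (contMDiffOn_tangentMap hU hf)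

theorem mvfderiv_comp_vec {f : M → M'} {g : M' → W} {x : M}
    (hg : MDifferentiableAt I' 𝓘(ℝ, W) g (f x)) (hf : MDifferentiableAt I I' f x)
    (v : TangentSpace I x) :
    mvfderiv I (fun y => g (f y)) x v = mvfderiv I' g (f x) (mfderiv I I' f x v) :=
  mfderiv_comp_apply x hg hf v

theorem mvfderiv_clm_comp (L : W →L[ℝ] W') {f : M → W} {x : M}
    (hf : MDifferentiableAt I 𝓘(ℝ, W) f x) (v : TangentSpace I x) :
    mvfderiv I (fun y => L (f y)) x v = L (mvfderiv I f x v) :=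
  congrArg (fun B : E →L[ℝ] W' => B v) (L.hasMFDerivAt.comp x hf.hasMFDerivAt).mfderiv

theorem mvfderiv_congr {f g : M → W} {x : M} (h : f =ᶠ[𝓝 x] g) (v : TangentSpace I x) :
    mvfderiv I f x v = mvfderiv I g x v :=
  congrArg (fun B : E →L[ℝ] W => B v) h.mfderiv_eq

theorem mdifferentiableAt_clm_apply {T : M → W →L[ℝ] W'} {h : M → W} {x : M}
    (hT : MDifferentiableAt I 𝓘(ℝ, W →L[ℝ] W') T x) (hh : MDifferentiableAt I 𝓘(ℝ, W) h x) :
    MDifferentiableAt I 𝓘(ℝ, W') (fun y => T y (h y)) x :=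
  DifferentiableAt.comp_mdifferentiableAt (f := fun y => (T y, h y))
    ((isBoundedBilinearMap_apply (𝕜 := ℝ) (E := W) (F := W')).differentiableAt (T x, h x))
    (hT.prodMk_space hh)

theorem mvfderiv_clm_apply {T : M → W →L[ℝ] W'} {h : M → W} {x : M}
    (hT : MDifferentiableAt I 𝓘(ℝ, W →L[ℝ] W') T x) (hh : MDifferentiableAt I 𝓘(ℝ, W) h x)
    (v : TangentSpace I x) :
    mvfderiv I (fun y => T y (h y)) x v = mvfderiv I T x v (h x) + T x (mvfderiv I h x v) := by
  have h1 : HasMFDerivAt 𝓘(ℝ, (W →L[ℝ] W') × W) 𝓘(ℝ, W') (fun q : (W →L[ℝ] W') × W => q.1 q.2)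
      (T x, h x) _ :=
    ((isBoundedBilinearMap_apply (𝕜 := ℝ) (E := W) (F := W')).hasFDerivAt (T x, h x)).hasMFDerivAt
  have h2 : HasMFDerivAt I 𝓘(ℝ, (W →L[ℝ] W') × W) (fun y => (T y, h y)) x _ :=
    ⟨hT.hasMFDerivAt.1.prodMk hh.hasMFDerivAt.1, hT.hasMFDerivAt.2.prodMk hh.hasMFDerivAt.2⟩
  have h3 := (h1.comp x h2).mfderiv
  refine (congrArg (fun B : E →L[ℝ] W' => B v) h3).trans ?_
  exact add_comm _ _

end Derivatives

variable {V : Type v} [NormedAddCommGroup V] [NormedSpace ℝ V]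
  {X : Type u} [TopologicalSpace X] [ChartedSpace V X] {n r : ℕ}

namespace ComplexVectorBundle

/-- The inverse of a smooth frame is smooth. -/
theorem contMDiffOn_frame_symm {F : ComplexVectorBundle.{u, v} V X r}
    {ι : ∀ y, (Fin r → ℂ) ≃ₗ[ℂ] F.fib y} {U : Set X} (hU : IsOpen U)
    (h : ∀ w, ContMDiffOn 𝓘(ℝ, V) (bundleModel V r) ∞ (fun y => (⟨y, ι y w⟩ : F.Total)) U) :
    ContMDiffOn (bundleModel V r) 𝓘(ℝ, Fin r → ℂ) ∞
      (fun v : F.Total => (ι v.proj).symm v.snd) (TotalSpace.proj ⁻¹' U) := by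
  intro v₀ hv₀
  refine ContMDiffAt.contMDiffWithinAt ?_
  set e := trivializationAt (Fin r → ℂ) F.fib v₀.proj
  have he : v₀.proj ∈ e.baseSet := mem_baseSet_trivializationAt _ _ _
  have hproj : ContMDiffAt (bundleModel V r) 𝓘(ℝ, V) ∞ (TotalSpace.proj : F.Total → X) v₀ :=
    contMDiffAt_proj F.fib
  -- `T v` is the frame read in the trivialization `e`. It sends the coordinates of `v` in the frame
  -- to those in `e`, which are smooth.
  let T : F.Total → (Fin r → ℂ) →L[ℝ] (Fin r → ℂ) := fun v => LinearMap.toContinuousLinearMap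
    (((e.linearMapAt ℂ v.proj) ∘ₗ (ι v.proj).toLinearMap).restrictScalars ℝ)
  have hev : ∀ᶠ v : F.Total in 𝓝 v₀, v.proj ∈ e.baseSet :=
    hproj.continuousAt.eventually (e.open_baseSet.mem_nhds he)
  have hT : ∀ v : F.Total, v.proj ∈ e.baseSet → ∀ w, T v w = (e ⟨v.proj, ι v.proj w⟩).2 := by
    intro v hv w
    exact congrFun (e.coe_linearMapAt_of_mem (R := ℂ) hv) _
  refine contMDiffAt_of_injective_apply (T := T) ?_ ?_ ?_
  · refine contMDiffAt_clm_of_apply fun w => ?_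
    have h1 := (contMDiffAt_totalSpace.1 ((h w).contMDiffAt (hU.mem_nhds hv₀))).2
    have h2 : ContMDiffAt (bundleModel V r) 𝓘(ℝ, Fin r → ℂ) ∞
        ((fun y => (e ⟨y, ι y w⟩).2) ∘ (TotalSpace.proj : F.Total → X)) v₀ :=
      ContMDiffAt.comp (g := fun y => (e ⟨y, ι y w⟩).2) v₀ h1 hproj
    exact h2.congr_of_eventuallyEq (hev.mono fun v hv => hT v hv w)
  · intro w w' hw
    have h3 : e.linearMapAt ℂ v₀.proj (ι v₀.proj w) = e.linearMapAt ℂ v₀.proj (ι v₀.proj w') := hw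
    have h4 := congrArg (e.symmₗ ℂ v₀.proj) h3
    rw [e.symmₗ_linearMapAt he, e.symmₗ_linearMapAt he] at h4
    exact (ι v₀.proj).injective h4
  · have h1 : ContMDiffAt (bundleModel V r) 𝓘(ℝ, Fin r → ℂ) ∞ (fun v : F.Total => (e v).2) v₀ :=
      (contMDiffAt_totalSpace.1 (contMDiffAt_id (x := v₀))).2
    refine h1.congr_of_eventuallyEq (hev.mono fun v hv => ?_)
    simp only
    rw [hT v hv, LinearEquiv.apply_symm_apply]

end ComplexVectorBundle

/-! ### Frames of an extension parametrized by a principal bundle -/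

open AffineBundle

/-- The data exhibiting an extension as associated with an affine bundle, without connections. -/
structure FrameData (A : AffineBundle.{u, v} V X n) (B : Extn.{u, v} V X n) where
  frame : ∀ (x : X) (p : A.carrier), A.proj p = x → (Vec n ≃ₗ[ℂ] B.F.fib x)
  contMDiff_frame : ContMDiff ((totalModel V n).prod 𝓘(ℝ, Vec n)) (bundleModel V (n + 1)) ∞
    (fun q : A.carrier × Vec n =>
      (⟨A.proj q.1, frame (A.proj q.1) q.1 rfl q.2⟩ : B.F.Total))
  frame_action : ∀ (x : X) (p : A.carrier) (hp : A.proj p = x) (g : Af n) (w : Vec n),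
    frame x (MulOpposite.op g • p) ((A.proj_action g p).trans hp) w = frame x p hp (Af.mulVec g w)
  quot_frame : ∀ (x : X) (p : A.carrier) (hp : A.proj p = x) (w : Vec n),
    B.quot x (frame x p hp w) = w (Fin.last n)

namespace AffineBundle

variable {A : AffineBundle.{u, v} V X n} (e : Trivialization (Af n) A.proj)

/-- The local section of a trivialization, continued arbitrarily. -/
def secExt (y : X) : A.carrier :=
  open scoped Classical in
  if A.proj (sec e y) = y then sec e y else (A.proj_surjective y).choose

/-- The value lies over `y` even outside the base of the trivialization, so its frame is an
isomorphism onto the fibre at `y` for every `y`, as a `Gauge` demands. -/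
theorem proj_secExt (y : X) : A.proj (secExt e y) = y := by
  unfold secExt
  split_ifs with h
  · exact h
  · exact (A.proj_surjective y).choose_spec

variable {e} in
theorem secExt_eq {y : X} (hy : y ∈ e.baseSet) : secExt e y = sec e y := if_pos (proj_sec hy)

end AffineBundle

namespace FrameData

variable {A : AffineBundle.{u, v} V X n} {B : Extn.{u, v} V X n} (Φ : FrameData A B)

theorem frame_congr {x : X} {p q : A.carrier} (h : p = q) (hp : A.proj p = x) :
    Φ.frame x p hp = Φ.frame x q (h ▸ hp) := by subst h; rfl

theorem mk_frame {x : X} {p : A.carrier} (hp : A.proj p = x) (w : Vec n) :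
    (⟨x, Φ.frame x p hp w⟩ : B.F.Total) = ⟨A.proj p, Φ.frame (A.proj p) p rfl w⟩ := by
  subst hp; rfl

variable {e : Trivialization (Af n) A.proj}

/-- The gauge of the associated bundle defined by a trivialization of the principal bundle. -/
def gauge (he : A.IsSmoothTriv e) : B.F.Gauge where
  base := e.baseSet
  isOpen_base := e.open_baseSet
  map y := (Φ.frame y (secExt e y) (proj_secExt e y)).symm
  contMDiffOn_map := by
    refine ComplexVectorBundle.contMDiffOn_frame_symm (F := B.F)
      (ι := fun y => Φ.frame y (secExt e y) (proj_secExt e y)) e.open_baseSet fun w => ?_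
    have h1 : ContMDiffOn 𝓘(ℝ, V) ((totalModel V n).prod 𝓘(ℝ, Vec n)) ∞
        (fun y => (sec e y, w)) e.baseSet := he.contMDiffOn_sec.prodMk contMDiffOn_const
    refine (Φ.contMDiff_frame.comp_contMDiffOn h1).congr fun y hy => ?_
    refine (Φ.mk_frame (proj_secExt e y) w).trans ?_
    rw [secExt_eq hy]
    rfl

variable (he : A.IsSmoothTriv e)

/-- The point `p` is the translate by `coord e p` of the local section that defines the gauge, so
equivariance of the frames turns its frame into the representation of `coord e p`. -/
theorem gauge_map_frame {p : A.carrier} (hp : p ∈ e.source) (w : Vec n) :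
    (Φ.gauge he).map (A.proj p) (Φ.frame (A.proj p) p rfl w) = Af.rep (coord e p) w := by
  have hy := e.mem_source.1 hp
  change (Φ.frame _ (secExt e (A.proj p)) _).symm _ = _
  rw [LinearEquiv.symm_apply_eq]
  have h1 := Φ.frame_action (A.proj p) (secExt e (A.proj p)) (proj_secExt e _) (coord e p) w
  refine Eq.trans ?_ h1
  have h2 : p = MulOpposite.op (coord e p) • secExt e (A.proj p) := by
    rw [secExt_eq hy, he.coord_smul_sec hp]
  exact congrArg (fun B => B w) (Φ.frame_congr h2 rfl)

theorem frame_symm {p : A.carrier} (hp : p ∈ e.source) (u : B.F.fib (A.proj p)) :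
    (Φ.frame (A.proj p) p rfl).symm u =
      Af.rep (coord e p)⁻¹ ((Φ.gauge he).map (A.proj p) u) := by
  rw [LinearEquiv.symm_apply_eq]
  apply ((Φ.gauge he).map (A.proj p)).injective
  rw [Φ.gauge_map_frame he hp, Af.rep_apply_rep_inv]

theorem quot_gauge_symm {y : X} (w : Vec n) :
    B.quot y (((Φ.gauge he).map y).symm w) = w (Fin.last n) := Φ.quot_frame _ _ _ _

theorem mdifferentiableAt_frame_symm {s : ∀ y, B.F.fib y} {p : A.carrier}
    (hs : B.F.DiffAt s (A.proj p)) : MDifferentiableAt (totalModel V n) 𝓘(ℝ, Vec n)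
      (fun q => (Φ.frame (A.proj q) q rfl).symm (s (A.proj q))) p := by
  have he := A.isSmoothTriv_trivAt (A.proj p)
  have hp := mem_source_trivAt p
  have h1 := ((Φ.gauge he).diffAt_iff (A.mem_trivAt _)).1 hs
  have h2 : MDifferentiableAt (totalModel V n) 𝓘(ℝ, Vec n →L[ℝ] Vec n)
      (fun q => Af.rep (coord (A.trivAt (A.proj p)) q)⁻¹) p := by
    have h3 := ContMDiffAt.af_inv (he.contMDiffAt_coord hp)
    exact ((contMDiff_rep.contMDiffAt).comp p h3).mdifferentiableAt (by simp)
  refine MDifferentiableAt.congr_of_eventuallyEq (mdifferentiableAt_clm_apply h2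
    (h1.comp p (A.contMDiff_proj.mdifferentiable (by simp) p))) ?_
  filter_upwards [(A.trivAt (A.proj p)).open_source.mem_nhds hp] with q hq
  exact Φ.frame_symm he hq _

/-- The derivative of the equivariant function of a section, in a gauge. -/
theorem gauge_map_deriv {s : ∀ y, B.F.fib y} {p : A.carrier} (hp : p ∈ e.source)
    (hs : B.F.DiffAt s (A.proj p)) {w : TangentSpace (totalModel V n) p}
    {Ω θ : Vec n →L[ℝ] Vec n} (h : Af.rep (coord e p) * Ω = θ * Af.rep (coord e p) +
      mvfderiv (totalModel V n) (fun q => Af.rep (coord e q)) p w) :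
    (Φ.gauge he).map (A.proj p) (Φ.frame (A.proj p) p rfl
      (mvfderiv (totalModel V n) (fun q => (Φ.frame (A.proj q) q rfl).symm (s (A.proj q))) p w +
        Ω ((Φ.frame (A.proj p) p rfl).symm (s (A.proj p))))) =
    mvfderiv 𝓘(ℝ, V) (fun y => (Φ.gauge he).map y (s y)) (A.proj p)
        (mfderiv (totalModel V n) 𝓘(ℝ, V) A.proj p w) +
      θ ((Φ.gauge he).map (A.proj p) (s (A.proj p))) := by
  have dS := Φ.mdifferentiableAt_frame_symm hs
  have dγ : MDifferentiableAt (totalModel V n) 𝓘(ℝ, Vec n →L[ℝ] Vec n)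
      (fun q => Af.rep (coord e q)) p :=
    ((contMDiff_rep.contMDiffAt).comp p (he.contMDiffAt_coord hp)).mdifferentiableAt (by simp)
  have hy := e.mem_source.1 hp
  have h1 := ((Φ.gauge he).diffAt_iff hy).1 hs
  -- With `γ` the group coordinate and `S` the equivariant function of `s`, the product `γ S` is `s`
  -- in the gauge. The product rule and `h` then turn `γ (dS + Ω S)` into `d(γ S) + θ γ S`.
  have h2 := mvfderiv_clm_apply dγ dS w
  have h3 := mvfderiv_comp_vec (f := A.proj) (g := fun y => (Φ.gauge he).map y (s y)) h1
    (A.contMDiff_proj.mdifferentiable (by simp) p) w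
  have h4 : ∀ q ∈ e.source, Af.rep (coord e q) ((Φ.frame (A.proj q) q rfl).symm (s (A.proj q))) =
      (Φ.gauge he).map (A.proj q) (s (A.proj q)) := fun q hq => by
    rw [← Φ.gauge_map_frame he hq, LinearEquiv.apply_symm_apply]
  have h5 := mvfderiv_congr (I := totalModel V n) (Filter.eventuallyEq_of_mem
    (e.open_source.mem_nhds hp) h4) w
  rw [← h3, ← h5, h2, Φ.gauge_map_frame he hp, map_add, ← h4 p hp]
  have h6 := congrArg (fun B => B ((Φ.frame (A.proj p) p rfl).symm (s (A.proj p)))) h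
  have h7 : Af.rep (coord e p) (Ω ((Φ.frame (A.proj p) p rfl).symm (s (A.proj p)))) =
    θ (Af.rep (coord e p) ((Φ.frame (A.proj p) p rfl).symm (s (A.proj p)))) +
      mvfderiv (totalModel V n) (fun q => Af.rep (coord e q)) p w
        ((Φ.frame (A.proj p) p rfl).symm (s (A.proj p))) := h6
  rw [h7]
  abel

end FrameData

end FlatAffine

namespace FlatAffine

open AffineBundle

/-! ### Smoothness of local connection forms -/

section FormAlong

variable {V : Type v} [NormedAddCommGroup V] [NormedSpace ℝ V]
  {X : Type u} [TopologicalSpace X] [ChartedSpace V X] {n r : ℕ}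
  {A : AffineBundle.{u, v} V X n}

theorem PrincipalConnection.contMDiff_opForm (C : PrincipalConnection A) :
    ContMDiff (totalModel V n).tangent 𝓘(ℝ, Vec n →L[ℝ] Vec n) ∞
      (fun w : TangentBundle (totalModel V n) A.carrier => C.opForm w.proj w.snd) :=
  (AfLie.op (n := n)).contMDiff.comp C.contMDiff_form

theorem PrincipalConnection.contMDiffOn_localForm [IsManifold 𝓘(ℝ, V) ∞ X]
    (C : PrincipalConnection A)
    {e : Trivialization (Af n) A.proj} (he : A.IsSmoothTriv e) :
    ContMDiffOn 𝓘(ℝ, V).tangent 𝓘(ℝ, Vec n →L[ℝ] Vec n) ∞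
      (fun v : TangentBundle 𝓘(ℝ, V) X => C.localForm e v.proj v.snd)
      (TotalSpace.proj ⁻¹' e.baseSet) := by
  have h := contMDiffOn_tangentMap e.open_baseSet he.contMDiffOn_sec
  have h' := ContMDiff.comp_contMDiffOn C.contMDiff_opForm h
  exact h'

theorem PrincipalConnection.localForm_smul (C : PrincipalConnection A)
    (e : Trivialization (Af n) A.proj) (y : X) (v : TangentSpace 𝓘(ℝ, V) y) (c : ℂ) (w : Vec n) :
    C.localForm e y v (c • w) = c • C.localForm e y v w := AfLie.op_smul _ _ _

/-- A section of the bundle of homomorphisms from the tangent bundle is smooth if it is smooth on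
the coordinate vector fields. -/
theorem ComplexVectorBundle.contMDiffAt_hom [IsManifold 𝓘(ℝ, V) ∞ X] [FiniteDimensional ℝ V]
    {F : ComplexVectorBundle.{u, v} V X r} {τ : ∀ x, TangentSpace 𝓘(ℝ, V) x →L[ℝ] F.fib x} {x : X}
    (h : ∀ v : V, ContMDiffAt 𝓘(ℝ, V) (bundleModel V r) ∞
      (fun y => (⟨y, τ y (coordField (I := 𝓘(ℝ, V)) x v y)⟩ : F.Total)) x) :
    ContMDiffAt 𝓘(ℝ, V) (𝓘(ℝ, V).prod 𝓘(ℝ, V →L[ℝ] (Fin r → ℂ))) ∞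
      (fun y => (⟨y, τ y⟩ : TotalSpace (V →L[ℝ] (Fin r → ℂ))
        fun x => TangentSpace 𝓘(ℝ, V) x →L[ℝ] F.fib x)) x := by
  rw [contMDiffAt_hom_bundle]
  refine ⟨contMDiffAt_id, contMDiffAt_clm_of_apply fun v => ?_⟩
  have h1 := (contMDiffAt_totalSpace.1 (h v)).2
  refine h1.congr_of_eventuallyEq ?_
  have hT := (trivializationAt V (TangentSpace 𝓘(ℝ, V) : X → Type _) x).open_baseSet.mem_nhds
    (mem_baseSet_trivializationAt V (TangentSpace 𝓘(ℝ, V) : X → Type _) x)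
  have hF := (trivializationAt (Fin r → ℂ) F.fib x).open_baseSet.mem_nhds
    (mem_baseSet_trivializationAt (Fin r → ℂ) F.fib x)
  filter_upwards [hT, hF] with y hyT hyF
  rw [ContinuousLinearMap.inCoordinates_eq hyT hyF]
  rfl

end FormAlong

variable {V : Type v} [NormedAddCommGroup V] [NormedSpace ℝ V] [FiniteDimensional ℝ V]
  {X : Type u} [TopologicalSpace X] [ChartedSpace V X] [IsManifold 𝓘(ℝ, V) ∞ X] {n : ℕ}
  {A : AffineBundle.{u, v} V X n} {B : Extn.{u, v} V X n}

/-! ### The connection on an associated bundle induced by a connection form -/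

namespace FrameData

variable (Φ : FrameData A B)

/-- The connection on the associated bundle is the one induced by the connection form. -/
def Compatible (C : PrincipalConnection A) (D : Connection B.F) : Prop :=
  ∀ (s : ∀ x, B.F.fib x) (p : A.carrier), B.F.DiffAt s (A.proj p) →
    ∀ w : TangentSpace (totalModel V n) p,
      D.cov s (A.proj p) (mfderiv (totalModel V n) 𝓘(ℝ, V) A.proj p w) =
      Φ.frame (A.proj p) p rfl
        (mvfderiv (totalModel V n) (fun q => (Φ.frame (A.proj q) q rfl).symm (s (A.proj q))) p w +
          C.opForm p w ((Φ.frame (A.proj p) p rfl).symm (s (A.proj p))))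

section Induced

variable (C : PrincipalConnection A)

/-- The covariant derivative on the associated bundle induced by a connection form. -/
def inducedCov (s : ∀ x, B.F.fib x) (x : X) : TangentSpace 𝓘(ℝ, V) x →L[ℝ] B.F.fib x :=
  -- Every point uses its own chosen trivialization, so smoothness in `x` is not visible here;
  -- `gauge_inducedCov` allows a fixed trivialization instead.
  (LinearMap.toContinuousLinearMap
    { toFun := fun v : V => ((Φ.gauge (A.isSmoothTriv_trivAt x)).map x).symm
        (mvfderiv 𝓘(ℝ, V) (fun z => (Φ.gauge (A.isSmoothTriv_trivAt x)).map z (s z)) x v +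
          C.localForm (A.trivAt x) x v ((Φ.gauge (A.isSmoothTriv_trivAt x)).map x (s x)))
      map_add' := fun v w => by
        rw [← map_add]
        congr 1
        refine Eq.trans (congrArg₂ (· + ·) (map_add (mvfderiv 𝓘(ℝ, V) _ x) v w)
          (congrArg (fun B : Vec n →L[ℝ] Vec n => B _) (map_add (C.localForm (A.trivAt x) x) v w)))
          ?_
        exact add_add_add_comm _ _ _ _
      map_smul' := fun a v => by
        have h1 : ∀ u, ((Φ.gauge (A.isSmoothTriv_trivAt x)).map x).symm (a • u) =
            a • ((Φ.gauge (A.isSmoothTriv_trivAt x)).map x).symm u := fun u =>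
          map_smul (((Φ.gauge (A.isSmoothTriv_trivAt x)).map x).symm.toLinearMap.restrictScalars ℝ)
            a u
        refine Eq.trans ?_ (h1 _)
        congr 1
        refine Eq.trans (congrArg₂ (· + ·) (map_smul (mvfderiv 𝓘(ℝ, V) _ x) a v)
          (congrArg (fun B : Vec n →L[ℝ] Vec n => B _) (map_smul (C.localForm (A.trivAt x) x) a v)))
          ?_
        exact (smul_add a _ _).symm } : V →L[ℝ] B.F.fib x)

omit [IsManifold 𝓘(ℝ, V) ∞ X] in
theorem gauge_trivAt_inducedCov (s : ∀ x, B.F.fib x) (x : X) (v : TangentSpace 𝓘(ℝ, V) x) :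
    (Φ.gauge (A.isSmoothTriv_trivAt x)).map x (Φ.inducedCov C s x v) =
      mvfderiv 𝓘(ℝ, V) (fun z => (Φ.gauge (A.isSmoothTriv_trivAt x)).map z (s z)) x v +
        C.localForm (A.trivAt x) x v ((Φ.gauge (A.isSmoothTriv_trivAt x)).map x (s x)) :=
  LinearEquiv.apply_symm_apply _ _

-- `coord_mul_opForm` is precisely the relation between `Ω` and `θ` that `gauge_map_deriv` asks for.
-- The resulting description of the connection mentions no trivialization.
omit [IsManifold 𝓘(ℝ, V) ∞ X] in
theorem inducedCov_frame {s : ∀ x, B.F.fib x} {p : A.carrier} (hs : B.F.DiffAt s (A.proj p))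
    (w : TangentSpace (totalModel V n) p) :
    Φ.inducedCov C s (A.proj p) (mfderiv (totalModel V n) 𝓘(ℝ, V) A.proj p w) =
      Φ.frame (A.proj p) p rfl
        (mvfderiv (totalModel V n) (fun q => (Φ.frame (A.proj q) q rfl).symm (s (A.proj q))) p w +
          C.opForm p w ((Φ.frame (A.proj p) p rfl).symm (s (A.proj p)))) := by
  have he := A.isSmoothTriv_trivAt (A.proj p)
  apply ((Φ.gauge he).map (A.proj p)).injective
  rw [gauge_trivAt_inducedCov]
  exact (Φ.gauge_map_deriv he (mem_source_trivAt p) hs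
    (C.coord_mul_opForm he (mem_source_trivAt p) w)).symm

/-- Lifting `y` and `v` to the principal bundle leads to the description in frames, from which one
may return to the base in any trivialization. -/
theorem gauge_inducedCov {e : Trivialization (Af n) A.proj} (he : A.IsSmoothTriv e) {y : X}
    (hy : y ∈ e.baseSet) {s : ∀ x, B.F.fib x} (hs : B.F.DiffAt s y) (v : TangentSpace 𝓘(ℝ, V) y) :
    (Φ.gauge he).map y (Φ.inducedCov C s y v) =
      mvfderiv 𝓘(ℝ, V) (fun z => (Φ.gauge he).map z (s z)) y v +
        C.localForm e y v ((Φ.gauge he).map y (s y)) := by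
  obtain ⟨p, rfl⟩ := A.proj_surjective y
  obtain ⟨w, rfl⟩ := mfderiv_proj_surjective p v
  rw [inducedCov_frame Φ C hs]
  exact Φ.gauge_map_deriv he (e.mem_source.2 hy) hs (C.coord_mul_opForm he (e.mem_source.2 hy) w)

theorem contMDiffAt_inducedCov {s : ∀ x, B.F.fib x}
    (hs : ContMDiff 𝓘(ℝ, V) (bundleModel V (n + 1)) ∞ (fun x => (⟨x, s x⟩ : B.F.Total))) (x : X) :
    ContMDiffAt 𝓘(ℝ, V) (𝓘(ℝ, V).prod 𝓘(ℝ, V →L[ℝ] Vec n)) ∞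
      (fun y => (⟨y, Φ.inducedCov C s y⟩ : TotalSpace (V →L[ℝ] Vec n)
        fun x => TangentSpace 𝓘(ℝ, V) x →L[ℝ] B.F.fib x)) x := by
  refine ComplexVectorBundle.contMDiffAt_hom fun v => ?_
  have he := A.isSmoothTriv_trivAt x
  set e := A.trivAt x
  have hx : x ∈ e.baseSet := A.mem_trivAt x
  refine ((Φ.gauge he).contMDiffAt_section_iff hx).2 ?_
  have hfield : ContMDiffAt 𝓘(ℝ, V) 𝓘(ℝ, V).tangent ∞
      (fun y => (⟨y, coordField (I := 𝓘(ℝ, V)) x v y⟩ : TangentBundle 𝓘(ℝ, V) X)) x :=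
    (contMDiffOn_coordField x v).contMDiffAt
      ((chartAt V x).open_source.mem_nhds (mem_chart_source V x))
  have hŝ : ContMDiffOn 𝓘(ℝ, V) 𝓘(ℝ, Vec n) ∞ (fun z => (Φ.gauge he).map z (s z)) e.baseSet :=
    fun y hy => (((Φ.gauge he).contMDiffAt_section_iff hy).1 (hs y)).contMDiffWithinAt
  have hopen : IsOpen (TotalSpace.proj ⁻¹' e.baseSet : Set (TangentBundle 𝓘(ℝ, V) X)) :=
    e.open_baseSet.preimage (FiberBundle.continuous_proj V (TangentSpace 𝓘(ℝ, V) : X → Type _))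
  have h1 := ((contMDiffOn_mvfderiv e.open_baseSet hŝ).contMDiffAt (hopen.mem_nhds
    (x := ⟨x, coordField (I := 𝓘(ℝ, V)) x v x⟩) hx)).comp x hfield
  have h2 := ((C.contMDiffOn_localForm he).contMDiffAt (hopen.mem_nhds
    (x := ⟨x, coordField (I := 𝓘(ℝ, V)) x v x⟩) hx)).comp x hfield
  have h3 := h2.clm_apply (hŝ.contMDiffAt (e.open_baseSet.mem_nhds hx))
  refine (h1.add h3).congr_of_eventuallyEq ?_
  filter_upwards [e.open_baseSet.mem_nhds hx] with y hy
  exact Φ.gauge_inducedCov C he hy ((hs y).mdifferentiableAt (by simp)) _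

/-- The connection on the associated bundle induced by a connection form. -/
def inducedConnection : Connection B.F where
  cov :=
    { toFun := Φ.inducedCov C
      isCovariantDerivativeOnUniv :=
        { add := by
            intro σ τ x hσ hτ _
            ext1 v
            set c := Φ.gauge (A.isSmoothTriv_trivAt x)
            apply (c.map x).injective
            have hσ' := (c.diffAt_iff (A.mem_trivAt x)).1 hσ
            have hτ' := (c.diffAt_iff (A.mem_trivAt x)).1 hτ
            have hc : ∀ (s : ∀ y, B.F.fib y), c.map x (Φ.inducedCov C s x v) =
                mvfderiv 𝓘(ℝ, V) (fun z => c.map z (s z)) x v +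
                C.localForm (A.trivAt x) x v (c.map x (s x)) := fun s =>
              Φ.gauge_trivAt_inducedCov C s x v
            refine (hc _).trans (Eq.trans ?_ ((map_add (c.map x) _ _).trans
              (congrArg₂ (· + ·) (hc _) (hc _))).symm)
            have h1 : (fun z => c.map z ((σ + τ) z)) =
                (fun z => c.map z (σ z)) + fun z => c.map z (τ z) := by
              funext z; exact map_add _ _ _
            have h2 : c.map x ((σ + τ) x) = c.map x (σ x) + c.map x (τ x) := map_add _ _ _
            rw [h1, h2, mvfderiv_add hσ' hτ', map_add]
            exact add_add_add_comm _ _ _ _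
          leibniz := by
            intro σ g x hσ hg _
            ext1 v
            set c := Φ.gauge (A.isSmoothTriv_trivAt x)
            apply (c.map x).injective
            have hσ' := (c.diffAt_iff (A.mem_trivAt x)).1 hσ
            have hsm : ∀ (z : X) (a : ℝ) (u : B.F.fib z), c.map z (a • u) = a • c.map z u :=
              fun z a u => map_smul (c.mapR z) a u
            have hc : ∀ (s : ∀ y, B.F.fib y), c.map x (Φ.inducedCov C s x v) =
                mvfderiv 𝓘(ℝ, V) (fun z => c.map z (s z)) x v +
                C.localForm (A.trivAt x) x v (c.map x (s x)) := fun s =>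
              Φ.gauge_trivAt_inducedCov C s x v
            refine (hc _).trans (Eq.trans ?_ ((map_add (c.map x) _ _).trans
              (congrArg₂ (· + ·) ((hsm x _ _).trans (congrArg (g x • ·) (hc _)))
                (hsm x _ _))).symm)
            have h1 : (fun z => c.map z ((g • σ) z)) = g • (fun z => c.map z (σ z)) := by
              funext z; exact hsm _ _ _
            have h2 : c.map x ((g • σ) x) = g x • c.map x (σ x) := hsm _ _ _
            rw [h1, h2, mvfderiv_smul hg hσ', map_smul, smul_add]
            exact add_right_comm _ _ _ } }
  contMDiff_cov := ⟨⟨fun {σ} hσ x _ => (Φ.contMDiffAt_inducedCov C (by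
    rw [← contMDiffOn_univ]; simpa using hσ) x).contMDiffWithinAt⟩⟩
  smul := by
    intro a s x hs v
    set c := Φ.gauge (A.isSmoothTriv_trivAt x)
    have hs' := (c.diffAt_iff (A.mem_trivAt x)).1 hs
    apply (c.map x).injective
    rw [map_smul]
    refine (Φ.gauge_trivAt_inducedCov C _ x v).trans ?_
    refine Eq.trans ?_ (congrArg (a • ·) (Φ.gauge_trivAt_inducedCov C _ x v)).symm
    simp only [map_smul]
    rw [PrincipalConnection.localForm_smul]
    refine Eq.trans ?_ (smul_add a _ _).symm
    congr 1
    exact mvfderiv_clm_comp (a • ContinuousLinearMap.id ℝ (Vec n)) hs' v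

theorem compatible_inducedConnection : Φ.Compatible C (Φ.inducedConnection C) :=
  fun _ _ hs w => Φ.inducedCov_frame C hs w

end Induced

/-- Both sides are the zeroth-order term of `D` in the gauge; it is isolated by testing on constant
sections, whose derivative in the gauge is zero. -/
theorem Compatible.gaugeForm_eq {Φ : FrameData A B} {C : PrincipalConnection A}
    {D : Connection B.F} (h : Φ.Compatible C D) {e : Trivialization (Af n) A.proj}
    (he : A.IsSmoothTriv e) {y : X} (hy : y ∈ e.baseSet) :
    D.gaugeForm (Φ.gauge he) y = C.localForm e y := by
  obtain ⟨p, rfl⟩ := A.proj_surjective y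
  ext v u : 2
  obtain ⟨w, rfl⟩ := mfderiv_proj_surjective p v
  have hs := (Φ.gauge he).diffAt_symm_const hy u
  have h1 := D.map_cov (Φ.gauge he) hy hs (mfderiv (totalModel V n) 𝓘(ℝ, V) A.proj p w)
  rw [h _ _ hs] at h1
  have h2 := h1.symm.trans (Φ.gauge_map_deriv he (e.mem_source.2 hy) hs
    (C.coord_mul_opForm he (e.mem_source.2 hy) w))
  simpa using h2

end FrameData

end FlatAffine

/-! ### The connection form induced by a connection on the associated bundle -/

namespace FlatAffine

open AffineBundle

theorem matrix_eq_of_mulVec {n : ℕ} {M N : Matrix (Fin (n + 1)) (Fin (n + 1)) ℂ}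
    (h : ∀ w : Vec n, M *ᵥ w = N *ᵥ w) : M = N :=
  Matrix.mulVec_injective (funext h)

variable {V : Type v} [NormedAddCommGroup V] [NormedSpace ℝ V] [FiniteDimensional ℝ V]
  {X : Type u} [TopologicalSpace X] [ChartedSpace V X] [IsManifold 𝓘(ℝ, V) ∞ X] {n : ℕ}
  {A : AffineBundle.{u, v} V X n} {B : Extn.{u, v} V X n}

namespace FrameData

variable (Φ : FrameData A B)

omit [FiniteDimensional ℝ V] [IsManifold 𝓘(ℝ, V) ∞ X] in
theorem quot_eq_gauge {e : Trivialization (Af n) A.proj} (he : A.IsSmoothTriv e) {y : X}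
    (u : B.F.fib y) : B.quot y u = (Φ.gauge he).map y u (Fin.last n) := by
  rw [← Φ.quot_gauge_symm he ((Φ.gauge he).map y u), LinearEquiv.symm_apply_apply]

omit [FiniteDimensional ℝ V] [IsManifold 𝓘(ℝ, V) ∞ X] in
/-- An endomorphism-valued connection form is determined by the connection it induces. -/
theorem eq_of_frame_eq {p : A.carrier} {w : TangentSpace (totalModel V n) p}
    {Ω Ω' : Vec n →L[ℝ] Vec n}
    (h : ∀ s : ∀ x, B.F.fib x, B.F.DiffAt s (A.proj p) →
      mvfderiv (totalModel V n) (fun q => (Φ.frame (A.proj q) q rfl).symm (s (A.proj q))) p w +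
        Ω ((Φ.frame (A.proj p) p rfl).symm (s (A.proj p))) =
      mvfderiv (totalModel V n) (fun q => (Φ.frame (A.proj q) q rfl).symm (s (A.proj q))) p w +
        Ω' ((Φ.frame (A.proj p) p rfl).symm (s (A.proj p)))) : Ω = Ω' := by
  have he := A.isSmoothTriv_trivAt (A.proj p)
  have hp := mem_source_trivAt p
  ext1 u
  -- The section constant in the gauge whose equivariant function takes the value `u` at `p`.
  have h1 := add_left_cancel (h _ ((Φ.gauge he).diffAt_symm_const (A.mem_trivAt (A.proj p))
    (Af.rep (coord (A.trivAt (A.proj p)) p) u)))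
  rw [Φ.frame_symm he hp, LinearEquiv.apply_symm_apply, Af.rep_inv_apply_rep] at h1
  exact h1

section Induced

variable (D : Connection B.F)

section

variable (e : Trivialization (Af n) A.proj) (he : A.IsSmoothTriv e)

/-- The connection form defined by a connection on the associated bundle, in a trivialization. -/
def trivForm (p : A.carrier) : TangentSpace (totalModel V n) p →L[ℝ] AfLie n :=
  -- The relation of `coord_mul_opForm`, solved for the connection form. `AfLie.ofOp` keeps only the
  -- first `n` rows; `rep_mul_op_trivForm` shows that nothing is lost.
  AfLie.ofOp.comp ((ContinuousLinearMap.compL ℝ (Vec n) (Vec n) (Vec n)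
    (Af.rep (coord e p)⁻¹)).comp
    (((ContinuousLinearMap.compL ℝ (Vec n) (Vec n) (Vec n)).flip (Af.rep (coord e p))).comp
      ((D.gaugeForm (Φ.gauge he) (A.proj p)).comp
        (mfderiv (totalModel V n) 𝓘(ℝ, V) A.proj p)) +
      mvfderiv (totalModel V n) (fun q => Af.rep (coord e q)) p))

theorem trivForm_apply (p : A.carrier) (w : TangentSpace (totalModel V n) p) :
    Φ.trivForm D e he p w = AfLie.ofOp (Af.rep (coord e p)⁻¹ * (D.gaugeForm (Φ.gauge he) (A.proj p)
      (mfderiv (totalModel V n) 𝓘(ℝ, V) A.proj p w) * Af.rep (coord e p) +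
      mvfderiv (totalModel V n) (fun q => Af.rep (coord e q)) p w)) := rfl

theorem contMDiffOn_trivForm [T2Space X] : ContMDiffOn (totalModel V n).tangent 𝓘(ℝ, AfLie n) ∞
    (fun w : TangentBundle (totalModel V n) A.carrier => Φ.trivForm D e he w.proj w.snd)
    (TotalSpace.proj ⁻¹' e.source) := by
  have hπ : ContMDiff (totalModel V n).tangent 𝓘(ℝ, V).tangent ∞
      (tangentMap (totalModel V n) 𝓘(ℝ, V) A.proj) := A.contMDiff_proj.contMDiff_tangentMap (by simp)
  have hγ : ContMDiffOn (totalModel V n) 𝓘(ℝ, Vec n →L[ℝ] Vec n) ∞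
      (fun q => Af.rep (coord e q)) e.source := contMDiff_rep.comp_contMDiffOn he.contMDiffOn_coord
  have hγi : ContMDiffOn (totalModel V n) 𝓘(ℝ, Vec n →L[ℝ] Vec n) ∞
      (fun q => Af.rep (coord e q)⁻¹) e.source :=
    contMDiff_rep.comp_contMDiffOn (fun q hq => (he.contMDiffOn_coord q hq).af_inv)
  have hp : ContMDiffOn (totalModel V n).tangent (totalModel V n) ∞
      (TotalSpace.proj : TangentBundle (totalModel V n) A.carrier → A.carrier)
      (TotalSpace.proj ⁻¹' e.source) := contMDiffOn_proj (n := ∞) (IB := totalModel V n)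
      (TangentSpace (totalModel V n) : A.carrier → Type _)
  have h1 := hγ.comp hp (fun _ h => h)
  have h2 := hγi.comp hp (fun _ h => h)
  have h3 : ContMDiffOn (totalModel V n).tangent 𝓘(ℝ, Vec n →L[ℝ] Vec n) ∞
      (fun w : TangentBundle (totalModel V n) A.carrier => D.gaugeForm (Φ.gauge he) (A.proj w.proj)
        (mfderiv (totalModel V n) 𝓘(ℝ, V) A.proj w.proj w.snd)) (TotalSpace.proj ⁻¹' e.source) := by
    have h := (D.contMDiffOn_gaugeForm (Φ.gauge he)).comp hπ.contMDiffOn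
      (s := (TotalSpace.proj ⁻¹' e.source : Set (TangentBundle (totalModel V n) A.carrier)))
      (fun w hw => e.mem_source.1 hw)
    exact h
  have h4 := contMDiffOn_mvfderiv e.open_source hγ
  have h5 := h2.clm_comp ((h3.clm_comp h1).add h4)
  have h6 := (AfLie.ofOp (n := n)).contMDiff.comp_contMDiffOn h5
  exact h6

variable {e}

/-- The operator inside `trivForm` belongs to the Lie algebra. It is complex-linear, and its last
row vanishes: `hD`, applied to constant sections of the gauge, kills the last row of the gauge form,
and the derivative of `Af.rep` has zero last row. It is therefore recovered from its first `n` rows.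
-/
theorem rep_mul_op_trivForm {D : Connection B.F}
    (hD : ∀ (s : ∀ x, B.F.fib x) (x : X), B.F.DiffAt s x → ∀ w : TangentSpace 𝓘(ℝ, V) x,
      B.quot x (D.cov s x w) = mvfderiv 𝓘(ℝ, V) (fun y => B.quot y (s y)) x w)
    {p : A.carrier} (hp : p ∈ e.source) (w : TangentSpace (totalModel V n) p) :
    Af.rep (coord e p) * AfLie.op (Φ.trivForm D e he p w) =
      D.gaugeForm (Φ.gauge he) (A.proj p) (mfderiv (totalModel V n) 𝓘(ℝ, V) A.proj p w) *
        Af.rep (coord e p) + mvfderiv (totalModel V n) (fun q => Af.rep (coord e q)) p w := by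
  have hy : A.proj p ∈ (Φ.gauge he).base := e.mem_source.1 hp
  have hlast : ∀ (v : TangentSpace 𝓘(ℝ, V) (A.proj p)) (u : Vec n),
      D.gaugeForm (Φ.gauge he) (A.proj p) v u (Fin.last n) = 0 := by
    intro v u
    rw [D.gaugeForm_eq _ hy, ← Φ.quot_eq_gauge he, hD _ _ ((Φ.gauge he).diffAt_symm_const hy u)]
    have hconst : (fun y => B.quot y (((Φ.gauge he).map y).symm u)) = fun _ => u (Fin.last n) :=
      funext fun y => Φ.quot_gauge_symm he u
    rw [hconst, mvfderiv_const]
    rfl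
  obtain ⟨ξ, hdγ⟩ : ∃ ξ : AfLie n, mvfderiv (totalModel V n) (fun q => Af.rep (coord e q)) p w =
      AfLie.op ξ :=
    ⟨_, mvfderiv_rep_comp ((he.contMDiffAt_coord hp).mdifferentiableAt (by simp)) w⟩
  rw [trivForm_apply, AfLie.op_ofOp, ← mul_assoc, Af.rep_mul_inv, one_mul]
  · intro c u
    rw [hdγ]
    simp only [mul_apply_eq_comp, _root_.add_apply, Af.rep_smul,
      D.gaugeForm_smul _ hy, AfLie.op_smul, ← smul_add]
  · intro u
    rw [hdγ]
    simp only [mul_apply_eq_comp, _root_.add_apply, Af.rep_last,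
      Pi.add_apply, hlast, AfLie.op_last, add_zero]

theorem cov_eq_frame_trivForm {D : Connection B.F}
    (hD : ∀ (s : ∀ x, B.F.fib x) (x : X), B.F.DiffAt s x → ∀ w : TangentSpace 𝓘(ℝ, V) x,
      B.quot x (D.cov s x w) = mvfderiv 𝓘(ℝ, V) (fun y => B.quot y (s y)) x w)
    {s : ∀ x, B.F.fib x} {p : A.carrier} (hp : p ∈ e.source) (hs : B.F.DiffAt s (A.proj p))
    (w : TangentSpace (totalModel V n) p) :
    D.cov s (A.proj p) (mfderiv (totalModel V n) 𝓘(ℝ, V) A.proj p w) =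
      Φ.frame (A.proj p) p rfl
        (mvfderiv (totalModel V n) (fun q => (Φ.frame (A.proj q) q rfl).symm (s (A.proj q))) p w +
          AfLie.op (Φ.trivForm D e he p w) ((Φ.frame (A.proj p) p rfl).symm (s (A.proj p)))) := by
  apply ((Φ.gauge he).map (A.proj p)).injective
  rw [Φ.gauge_map_deriv he hp hs (Φ.rep_mul_op_trivForm he hD hp w)]
  exact D.map_cov (Φ.gauge he) (e.mem_source.1 hp) hs _

/-- Each of the two forms induces `D`, and a form is determined by the connection it induces. The
local forms therefore glue. -/
theorem trivForm_eq {D : Connection B.F}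
    (hD : ∀ (s : ∀ x, B.F.fib x) (x : X), B.F.DiffAt s x → ∀ w : TangentSpace 𝓘(ℝ, V) x,
      B.quot x (D.cov s x w) = mvfderiv 𝓘(ℝ, V) (fun y => B.quot y (s y)) x w)
    {e' : Trivialization (Af n) A.proj} (he' : A.IsSmoothTriv e')
    {p : A.carrier} (hp : p ∈ e.source) (hp' : p ∈ e'.source) :
    Φ.trivForm D e he p = Φ.trivForm D e' he' p := by
  ext1 w
  apply AfLie.op_injective
  refine Φ.eq_of_frame_eq (w := w) fun s hs => (Φ.frame (A.proj p) p rfl).injective ?_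
  rw [← Φ.cov_eq_frame_trivForm he hD hp hs, ← Φ.cov_eq_frame_trivForm he' hD hp' hs]

/-- The projection is constant on an orbit, so only the `dγ` term survives; it is `γ(p)` times the
Lie algebra element since `γ(p · g) = γ(p) g`. -/
theorem trivForm_orbit {D : Connection B.F}
    (hD : ∀ (s : ∀ x, B.F.fib x) (x : X), B.F.DiffAt s x → ∀ w : TangentSpace 𝓘(ℝ, V) x,
      B.quot x (D.cov s x w) = mvfderiv 𝓘(ℝ, V) (fun y => B.quot y (s y)) x w)
    {p : A.carrier} (hp : p ∈ e.source) (ξ : TangentSpace 𝓘(ℝ, AfLie n) (1 : Af n)) :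
    Φ.trivForm D e he (MulOpposite.op (1 : Af n) • p)
      (mfderiv 𝓘(ℝ, AfLie n) (totalModel V n) (fun g : Af n => MulOpposite.op g • p) 1 ξ) =
      (ξ : AfLie n) := by
  have hp1 : MulOpposite.op (1 : Af n) • p ∈ e.source := smul_mem_source hp 1
  have dorb : MDifferentiableAt 𝓘(ℝ, AfLie n) (totalModel V n)
      (fun g : Af n => MulOpposite.op g • p) 1 := (contMDiff_orbit p).mdifferentiable (by simp) 1
  have h := Φ.rep_mul_op_trivForm he hD hp1 (mfderiv 𝓘(ℝ, AfLie n) (totalModel V n)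
    (fun g : Af n => MulOpposite.op g • p) 1 ξ)
  have h1 : mfderiv (totalModel V n) 𝓘(ℝ, V) A.proj (MulOpposite.op (1 : Af n) • p)
      (mfderiv 𝓘(ℝ, AfLie n) (totalModel V n) (fun g : Af n => MulOpposite.op g • p) 1 ξ) =
      (0 : V) := by
    have h2 := mfderiv_comp_apply (1 : Af n) (A.contMDiff_proj.mdifferentiable (by simp)
      (MulOpposite.op (1 : Af n) • p)) dorb ξ
    refine h2.symm.trans ?_
    have h3 : A.proj ∘ (fun g : Af n => MulOpposite.op g • p) = fun _ => A.proj p :=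
      funext fun g => A.proj_action g p
    rw [h3, mfderiv_const]
    rfl
  have h4 : mvfderiv (totalModel V n) (fun q => Af.rep (coord e q)) (MulOpposite.op (1 : Af n) • p)
      (mfderiv 𝓘(ℝ, AfLie n) (totalModel V n) (fun g : Af n => MulOpposite.op g • p) 1 ξ) =
      Af.rep (coord e p) * AfLie.op (ξ : AfLie n) := by
    have dγ : MDifferentiableAt (totalModel V n) 𝓘(ℝ, Vec n →L[ℝ] Vec n)
        (fun q => Af.rep (coord e q)) (MulOpposite.op (1 : Af n) • p) :=
      ((contMDiff_rep.contMDiffAt).comp _ (he.contMDiffAt_coord hp1)).mdifferentiableAt (by simp)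
    refine (mvfderiv_comp_vec (f := fun g : Af n => MulOpposite.op g • p) dγ dorb ξ).symm.trans ?_
    have h5 : (fun g : Af n => Af.rep (coord e (MulOpposite.op g • p))) =
        fun g => ContinuousLinearMap.compL ℝ (Vec n) (Vec n) (Vec n) (Af.rep (coord e p))
          (Af.rep g) := by
      funext g
      rw [he.coord_smul hp, map_mul]
      rfl
    rw [h5, mvfderiv_clm_comp _ ((contMDiff_rep (n := n)).mdifferentiable (by simp) 1),
      mvfderiv_rep]
    rfl
  have h6 := h.trans (congrArg₂ (· + ·) (congrArg (· * _)
    (congrArg (D.gaugeForm (Φ.gauge he) (A.proj (MulOpposite.op (1 : Af n) • p)) :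
      V → (Vec n →L[ℝ] Vec n)) h1)) h4)
  have h7 : D.gaugeForm (Φ.gauge he) (A.proj (MulOpposite.op (1 : Af n) • p)) (0 : V) = 0 :=
    map_zero _
  rw [he.coord_smul hp, mul_one] at h6
  rw [h7, zero_mul, zero_add] at h6
  exact AfLie.op_injective ((Af.isUnit_rep _).mul_left_cancel h6)

/-- Translation by `g` preserves the projection and multiplies the group coordinate by `g` on the
right. Comparing the defining relations at `p` and `p · g` and cancelling `γ(p)` gives the adjoint
action. -/
theorem op_trivForm_smul {D : Connection B.F}
    (hD : ∀ (s : ∀ x, B.F.fib x) (x : X), B.F.DiffAt s x → ∀ w : TangentSpace 𝓘(ℝ, V) x,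
      B.quot x (D.cov s x w) = mvfderiv 𝓘(ℝ, V) (fun y => B.quot y (s y)) x w)
    {p : A.carrier} (hp : p ∈ e.source) (g : Af n) (w : TangentSpace (totalModel V n) p) :
    AfLie.op (Φ.trivForm D e he (MulOpposite.op g • p) (mfderiv (totalModel V n) (totalModel V n)
      (fun q : A.carrier => MulOpposite.op g • q) p w)) =
      Af.rep g⁻¹ * AfLie.op (Φ.trivForm D e he p w) * Af.rep g := by
  have hpg := smul_mem_source hp g
  have dR : MDifferentiableAt (totalModel V n) (totalModel V n)
      (fun q : A.carrier => MulOpposite.op g • q) p := (AffineBundle.contMDiff_smul g).mdifferentiable (by simp) p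
  set w' := mfderiv (totalModel V n) (totalModel V n)
      (fun q : A.carrier => MulOpposite.op g • q) p w with hw'
  have h := Φ.rep_mul_op_trivForm he hD hpg w'
  have h1 : (mfderiv (totalModel V n) 𝓘(ℝ, V) A.proj (MulOpposite.op g • p) w' : V) =
      mfderiv (totalModel V n) 𝓘(ℝ, V) A.proj p w := by
    have h2 := mfderiv_comp_apply p (A.contMDiff_proj.mdifferentiable (by simp)
      (MulOpposite.op g • p)) dR w
    refine h2.symm.trans ?_
    have h3 : A.proj ∘ (fun q : A.carrier => MulOpposite.op g • q) = A.proj :=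
      funext fun q => A.proj_action g q
    rw [h3]
  have h4 : mvfderiv (totalModel V n) (fun q => Af.rep (coord e q)) (MulOpposite.op g • p) w' =
      mvfderiv (totalModel V n) (fun q => Af.rep (coord e q)) p w * Af.rep g := by
    have dγ : ∀ {q : A.carrier}, q ∈ e.source → MDifferentiableAt (totalModel V n)
        𝓘(ℝ, Vec n →L[ℝ] Vec n) (fun q => Af.rep (coord e q)) q := fun hq =>
      ((contMDiff_rep.contMDiffAt).comp _ (he.contMDiffAt_coord hq)).mdifferentiableAt (by simp)
    refine (mvfderiv_comp_vec (f := fun q : A.carrier => MulOpposite.op g • q) (dγ hpg) dR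
      w).symm.trans ?_
    have h5 : (fun q : A.carrier => Af.rep (coord e (MulOpposite.op g • q))) =ᶠ[𝓝 p]
        fun q => (ContinuousLinearMap.compL ℝ (Vec n) (Vec n) (Vec n)).flip (Af.rep g)
          (Af.rep (coord e q)) := by
      filter_upwards [e.open_source.mem_nhds hp] with q hq
      rw [he.coord_smul hq, map_mul]
      rfl
    rw [mvfderiv_congr h5, mvfderiv_clm_comp _ (dγ hp)]
    rfl
  have hθ : ∀ (y y' : X) (v : V), y = y' → D.gaugeForm (Φ.gauge he) y v =
      D.gaugeForm (Φ.gauge he) y' v := by rintro y y' v rfl; rfl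
  have h6 := h.trans (congrArg₂ (· + ·) (congrArg (· * Af.rep (coord e (MulOpposite.op g • p)))
    ((congrArg (D.gaugeForm (Φ.gauge he) (A.proj (MulOpposite.op g • p)) :
      V → (Vec n →L[ℝ] Vec n)) h1).trans (hθ _ _ _ (A.proj_action g p)))) h4)
  have h8 := Φ.rep_mul_op_trivForm he hD hp w
  rw [he.coord_smul hp, map_mul] at h6
  have h9 := h6.trans ((congrArg₂ (· + ·) (mul_assoc _ _ _).symm rfl).trans (add_mul _ _ _).symm)
  have h10 := h9.trans (congrArg (· * Af.rep g) h8.symm)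
  have h11 : Af.rep (coord e p) * (Af.rep g *
      AfLie.op (Φ.trivForm D e he (MulOpposite.op g • p) w')) =
      Af.rep (coord e p) * (AfLie.op (Φ.trivForm D e he p w) * Af.rep g) :=
    ((mul_assoc _ _ _).symm.trans h10).trans (mul_assoc _ _ _)
  have h12 := (Af.isUnit_rep _).mul_left_cancel h11
  have h13 := congrArg (Af.rep g⁻¹ * ·) h12
  simp only [← mul_assoc, Af.rep_inv_mul, one_mul] at h13
  exact h13

end

/-- The connection form defined by a connection on the associated bundle. -/
def inducedForm [T2Space X] {D : Connection B.F}
    (hD : ∀ (s : ∀ x, B.F.fib x) (x : X), B.F.DiffAt s x → ∀ w : TangentSpace 𝓘(ℝ, V) x,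
      B.quot x (D.cov s x w) = mvfderiv 𝓘(ℝ, V) (fun y => B.quot y (s y)) x w) :
    PrincipalConnection A where
  form p := Φ.trivForm D (A.trivAt (A.proj p)) (A.isSmoothTriv_trivAt _) p
  contMDiff_form := by
    intro w₀
    set e := A.trivAt (A.proj w₀.proj)
    have he : A.IsSmoothTriv e := A.isSmoothTriv_trivAt _
    have hopen : IsOpen (TotalSpace.proj ⁻¹' e.source :
        Set (TangentBundle (totalModel V n) A.carrier)) :=
      e.open_source.preimage (FiberBundle.continuous_proj (V × AfLie n)
        (TangentSpace (totalModel V n) : A.carrier → Type _))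
    have hmem : w₀ ∈ (TotalSpace.proj ⁻¹' e.source :
        Set (TangentBundle (totalModel V n) A.carrier)) := mem_source_trivAt w₀.proj
    refine ((Φ.contMDiffOn_trivForm D e he).contMDiffAt (hopen.mem_nhds hmem)).congr_of_eventuallyEq
      ?_
    filter_upwards [hopen.mem_nhds hmem] with w hw
    rw [Φ.trivForm_eq (A.isSmoothTriv_trivAt (A.proj w.proj)) hD he (mem_source_trivAt w.proj) hw]
  vertical := by
    intro p₀ ξ
    have hq : MulOpposite.op (1 : Af n) • p₀ ∈ (A.trivAt (A.proj p₀)).source :=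
      smul_mem_source (mem_source_trivAt p₀) 1
    rw [Φ.trivForm_eq (A.isSmoothTriv_trivAt _) hD (A.isSmoothTriv_trivAt (A.proj p₀))
      (mem_source_trivAt _) hq]
    exact Φ.trivForm_orbit (A.isSmoothTriv_trivAt (A.proj p₀)) hD (mem_source_trivAt p₀) ξ
  equivariant := by
    intro g p w
    have hq : MulOpposite.op g • p ∈ (A.trivAt (A.proj p)).source :=
      smul_mem_source (mem_source_trivAt p) g
    rw [Φ.trivForm_eq (A.isSmoothTriv_trivAt _) hD (A.isSmoothTriv_trivAt (A.proj p))
      (mem_source_trivAt _) hq]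
    refine matrix_eq_of_mulVec fun u => ?_
    rw [← Matrix.mulVec_mulVec, ← Matrix.mulVec_mulVec]
    exact congrArg (fun T : Vec n →L[ℝ] Vec n => T u)
      (Φ.op_trivForm_smul (A.isSmoothTriv_trivAt (A.proj p)) hD (mem_source_trivAt p) g w)

theorem compatible_inducedForm [T2Space X] {D : Connection B.F}
    (hD : ∀ (s : ∀ x, B.F.fib x) (x : X), B.F.DiffAt s x → ∀ w : TangentSpace 𝓘(ℝ, V) x,
      B.quot x (D.cov s x w) = mvfderiv 𝓘(ℝ, V) (fun y => B.quot y (s y)) x w) :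
    Φ.Compatible (Φ.inducedForm hD) D := fun _ p hs w =>
  Φ.cov_eq_frame_trivForm (A.isSmoothTriv_trivAt (A.proj p)) hD (mem_source_trivAt p) hs w

end Induced

end FrameData

end FlatAffine

/-! ### Flatness of compatible connections -/

namespace FlatAffine

open AffineBundle

namespace PrincipalConnection

section

variable {V : Type v} [NormedAddCommGroup V] [NormedSpace ℝ V]
  {X : Type u} [TopologicalSpace X] [ChartedSpace V X] {n : ℕ}
  {A : AffineBundle.{u, v} V X n} (C : PrincipalConnection A)

theorem curvature_mulVec {Y Z : ∀ p : A.carrier, TangentSpace (totalModel V n) p} {p : A.carrier}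
    (hY : ContMDiffAt (totalModel V n) (totalModel V n).tangent ∞
      (fun p => (⟨p, Y p⟩ : TangentBundle (totalModel V n) A.carrier)) p)
    (hZ : ContMDiffAt (totalModel V n) (totalModel V n).tangent ∞
      (fun p => (⟨p, Z p⟩ : TangentBundle (totalModel V n) A.carrier)) p) (u : Vec n) :
    C.curvature Y Z p *ᵥ u = formCurvature C.opForm Y Z p u := by
  have hd : ∀ {Y : ∀ p : A.carrier, TangentSpace (totalModel V n) p},
      ContMDiffAt (totalModel V n) (totalModel V n).tangent ∞
        (fun p => (⟨p, Y p⟩ : TangentBundle (totalModel V n) A.carrier)) p →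
      ∀ w : TangentSpace (totalModel V n) p,
      mvfderiv (totalModel V n) (fun q => C.opForm q (Y q)) p w =
        AfLie.op (mvfderiv (totalModel V n) (fun q => C.form q (Y q)) p w) := by
    intro Y hY w
    have h1 := (C.contMDiff_form.contMDiffAt.comp p hY).mdifferentiableAt (by simp)
    exact mvfderiv_clm_comp (AfLie.op (n := n)) h1 w
  unfold curvature formCurvature
  rw [hd hZ, hd hY]
  simp only [Matrix.add_mulVec, Matrix.sub_mulVec, ← Matrix.mulVec_mulVec]
  rfl

end

variable {V : Type v} [NormedAddCommGroup V] [NormedSpace ℝ V] [FiniteDimensional ℝ V]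
  {X : Type u} [TopologicalSpace X] [ChartedSpace V X] {n : ℕ}
  {A : AffineBundle.{u, v} V X n} (C : PrincipalConnection A)

theorem differentiableAt_chartForm_opForm (p : A.carrier) :
    DifferentiableAt ℝ (chartForm C.opForm p) (extChartAt (totalModel V n) p p) :=
  differentiableAt_chartForm isOpen_univ C.contMDiff_opForm.contMDiffOn (Set.mem_univ p)

/-- By tensoriality, vanishing on all smooth vector fields is the same as vanishing of the curvature
in a chart at each point, the form in which gauge transformations can be applied. -/
theorem isFlat_iff : C.IsFlat ↔ ∀ p, IsFlatAt C.opForm p := by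
  constructor
  · intro h p
    refine isFlatAt_of_formCurvature (C.differentiableAt_chartForm_opForm p) fun Y Z hY hZ => ?_
    have hp := mem_chart_source (ModelProd V (AfLie n)) p
    have hnhds := (chartAt (ModelProd V (AfLie n)) p).open_source.mem_nhds hp
    ext1 u
    rw [← C.curvature_mulVec (hY.contMDiffAt hnhds) (hZ.contMDiffAt hnhds),
      h _ (chartAt (ModelProd V (AfLie n)) p).open_source Y Z hY hZ p hp, Matrix.zero_mulVec]
    rfl
  · intro h U hU Y Z hY hZ p hp
    have hY' := hY.contMDiffAt (hU.mem_nhds hp)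
    have hZ' := hZ.contMDiffAt (hU.mem_nhds hp)
    refine matrix_eq_of_mulVec fun u => ?_
    rw [C.curvature_mulVec hY' hZ', Matrix.zero_mulVec,
      formCurvature_eq (C.differentiableAt_chartForm_opForm p) (hY'.mdifferentiableAt (by simp))
        (hZ'.mdifferentiableAt (by simp))]
    exact congrArg (fun T : Vec n →L[ℝ] Vec n => T u) (h p _ _)

end PrincipalConnection

namespace FrameData

variable {V : Type v} [NormedAddCommGroup V] [NormedSpace ℝ V] [FiniteDimensional ℝ V]
  {X : Type u} [TopologicalSpace X] [T2Space X] [ChartedSpace V X] [IsManifold 𝓘(ℝ, V) ∞ X] {n : ℕ}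
  {A : AffineBundle.{u, v} V X n} {B : Extn.{u, v} V X n} {Φ : FrameData A B}
  {C : PrincipalConnection A} {D : Connection B.F}

/-- Compatible connections on a principal bundle and on its associated bundle are simultaneously
flat. -/
theorem Compatible.isFlat_iff (h : Φ.Compatible C D) : C.IsFlat ↔ D.IsFlat := by
  rw [C.isFlat_iff]
  constructor
  · intro hC
    refine D.isFlat_of_isFlatAt fun x => ?_
    have he := A.isSmoothTriv_trivAt x
    set e := A.trivAt x
    have hx : x ∈ e.baseSet := A.mem_trivAt x
    refine ⟨Φ.gauge he, hx, ?_⟩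
    -- The gauge form of `D` is the pullback of the connection form along the section, so the gauge
    -- factor is trivial.
    refine isFlatAt_of_gauge (α := C.opForm) (f := sec e) (γ := fun _ => 1)
      ?_ (Filter.Eventually.of_forall fun _ => contMDiffAt_const) isUnit_one
      (C.differentiableAt_chartForm_opForm _) (D.differentiableAt_chartForm_gaugeForm _ hx) ?_
      (hC _)
    · filter_upwards [e.open_baseSet.mem_nhds hx] with y hy
      exact (he.contMDiffAt_sec hy).of_le ENat.LEInfty.out
    · filter_upwards [e.open_baseSet.mem_nhds hx] with y hy w
      rw [h.gaugeForm_eq he hy, mvfderiv_const, one_mul, mul_one]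
      exact (add_zero _).symm
  · intro hD p
    have he := A.isSmoothTriv_trivAt (A.proj p)
    have hp := mem_source_trivAt p
    set e := A.trivAt (A.proj p)
    have hγ : ∀ᶠ q in 𝓝 p, ContMDiffAt (totalModel V n) 𝓘(ℝ, Vec n →L[ℝ] Vec n) 2
        (fun q => Af.rep (coord e q)) q := by
      filter_upwards [e.open_source.mem_nhds hp] with q hq
      exact (contMDiff_rep.contMDiffAt.comp q (he.contMDiffAt_coord hq)).of_le ENat.LEInfty.out
    -- Upstairs the gauge factor is the group coordinate, and `coord_mul_opForm` is the required
    -- relation.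
    refine isFlatAt_of_gauge (α := D.gaugeForm (Φ.gauge he)) (f := A.proj)
      (γ := fun q => Af.rep (coord e q))
      (Filter.Eventually.of_forall fun q => (A.contMDiff_proj q).of_le ENat.LEInfty.out) hγ
      (Af.isUnit_rep _) (D.differentiableAt_chartForm_gaugeForm _ (e.mem_source.1 hp))
      (C.differentiableAt_chartForm_opForm p) ?_ (D.isFlatAt_gaugeForm hD _ (e.mem_source.1 hp))
    filter_upwards [e.open_source.mem_nhds hp] with q hq w
    rw [h.gaugeForm_eq he (e.mem_source.1 hq)]
    exact C.coord_mul_opForm he hq w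

end FrameData

end FlatAffine

namespace FlatAffine

open AffineBundle

variable {V : Type v} [NormedAddCommGroup V] [NormedSpace ℝ V]
  {X : Type u} [TopologicalSpace X] [ChartedSpace V X] {n : ℕ}

/-! ### Morphisms of extensions -/

namespace Extn

/-- A map to the kernel of an extension is smooth if it is smooth as a map to the middle term. -/
theorem contMDiffAt_of_incl (B : Extn.{u, v} V X n) {E' H' N : Type*} [NormedAddCommGroup E']
    [NormedSpace ℝ E'] [TopologicalSpace H'] {J : ModelWithCorners ℝ E' H'} [TopologicalSpace N]
    [ChartedSpace H' N] {h : N → B.E.Total} {m₀ : N}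
    (hh : ContMDiffAt J (bundleModel V (n + 1)) ∞
      (fun m => (⟨(h m).proj, B.incl _ (h m).snd⟩ : B.F.Total)) m₀) :
    ContMDiffAt J (bundleModel V n) ∞ h m₀ := by
  set e := trivializationAt (Vec n) B.F.fib (h m₀).proj
  have he : (h m₀).proj ∈ e.baseSet := mem_baseSet_trivializationAt _ _ _
  obtain ⟨h1, h2⟩ := contMDiffAt_totalSpace.1 hh
  have hlin : ∀ y ∈ e.baseSet, ∀ u : B.F.fib y, e.linearMapAt ℂ y u = (e ⟨y, u⟩).2 := fun y hy u =>
    congrFun (e.coe_linearMapAt_of_mem (R := ℂ) hy) u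
  refine ComplexVectorBundle.contMDiffAt_of_injective (F := B.E)
    (ψ := fun y => ((e.linearMapAt ℂ y) ∘ₗ (B.incl y)).restrictScalars ℝ) e.open_baseSet ?_ he ?_
    h1 ?_
  · have h3 : ContMDiffOn (bundleModel V (n + 1)) 𝓘(ℝ, Vec n) ∞ (fun v : B.F.Total => (e v).2)
        e.source := contMDiff_snd.comp_contMDiffOn e.contMDiffOn
    have h4 := h3.comp (s := (TotalSpace.proj ⁻¹' e.baseSet : Set B.E.Total))
      B.contMDiff_incl.contMDiffOn (fun v hv => e.mem_source.2 hv)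
    exact h4.congr fun v hv => hlin _ hv _
  · intro u u' huu
    have h3 : e.linearMapAt ℂ (h m₀).proj (B.incl _ u) = e.linearMapAt ℂ (h m₀).proj (B.incl _ u') :=
      huu
    have h4 := congrArg (e.symmₗ ℂ (h m₀).proj) h3
    rw [e.symmₗ_linearMapAt he, e.symmₗ_linearMapAt he] at h4
    exact B.incl_injective _ h4
  · refine h2.congr_of_eventuallyEq ?_
    filter_upwards [h1.continuousAt.eventually (e.open_baseSet.mem_nhds he)] with m hm
    exact hlin _ hm _

variable {B B' : Extn.{u, v} V X n}

theorem range_incl (B : Extn.{u, v} V X n) (x : X) :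
    LinearMap.range (B.incl x) = LinearMap.ker (B.quot x) := (B.exact x).linearMap_ker_eq.symm

theorem map_range_incl {x : X} (ψ : B.F.fib x ≃ₗ[ℂ] B'.F.fib x)
    (h : ∀ u, B'.quot x (ψ u) = B.quot x u) :
    (LinearMap.range (B.incl x)).map ψ.toLinearMap = LinearMap.range (B'.incl x) := by
  rw [range_incl, range_incl]
  ext u
  constructor
  · rintro ⟨w, hw, rfl⟩
    exact (h w).trans hw
  · intro hu
    refine ⟨ψ.symm u, ?_, ψ.apply_symm_apply u⟩
    have := h (ψ.symm u)
    rw [ψ.apply_symm_apply] at this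
    exact this.symm.trans hu

/-- The isomorphism of kernels induced by an isomorphism of middle terms. -/
def kerEquiv {x : X} (ψ : B.F.fib x ≃ₗ[ℂ] B'.F.fib x) (h : ∀ u, B'.quot x (ψ u) = B.quot x u) :
    B.E.fib x ≃ₗ[ℂ] B'.E.fib x :=
  (LinearEquiv.ofInjective (B.incl x) (B.incl_injective x)).trans
    ((ψ.submoduleMap (LinearMap.range (B.incl x))).trans
      ((LinearEquiv.ofEq _ _ (map_range_incl ψ h)).trans
        (LinearEquiv.ofInjective (B'.incl x) (B'.incl_injective x)).symm))

theorem incl_kerEquiv {x : X} (ψ : B.F.fib x ≃ₗ[ℂ] B'.F.fib x)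
    (h : ∀ u, B'.quot x (ψ u) = B.quot x u) (u : B.E.fib x) :
    B'.incl x (kerEquiv ψ h u) = ψ (B.incl x u) := by
  have h1 := congrArg Subtype.val ((LinearEquiv.ofInjective (B'.incl x)
    (B'.incl_injective x)).apply_symm_apply ((LinearEquiv.ofEq _ _ (map_range_incl ψ h))
      (ψ.submoduleMap (LinearMap.range (B.incl x))
        (LinearEquiv.ofInjective (B.incl x) (B.incl_injective x) u))))
  exact h1

theorem contMDiff_kerEquiv {ψ : ∀ x, B.F.fib x ≃ₗ[ℂ] B'.F.fib x}
    (hψ : ContMDiff (bundleModel V (n + 1)) (bundleModel V (n + 1)) ∞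
      (fun e : B.F.Total => (⟨e.proj, ψ e.proj e.snd⟩ : B'.F.Total)))
    (h : ∀ x u, B'.quot x (ψ x u) = B.quot x u) :
    ContMDiff (bundleModel V n) (bundleModel V n) ∞
      (fun e : B.E.Total => (⟨e.proj, kerEquiv (ψ e.proj) (h e.proj) e.snd⟩ : B'.E.Total)) := by
  intro v
  refine B'.contMDiffAt_of_incl ?_
  have h1 := hψ.comp B.contMDiff_incl
  simp only [incl_kerEquiv]
  exact h1 v

end Extn

/-! ### Morphisms of bundles and of their associated extensions -/

namespace FrameData

variable {A A' : AffineBundle.{u, v} V X n} {B B' : Extn.{u, v} V X n} (Φ : FrameData A B)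
  (Φ' : FrameData A' B')

theorem frame_smul {x : X} {p : A.carrier} (hp : A.proj p = x) (g : Af n)
    (hpg : A.proj (MulOpposite.op g • p) = x) (w : Vec n) :
    Φ.frame x (MulOpposite.op g • p) hpg w = Φ.frame x p hp (Af.rep g w) :=
  Φ.frame_action x p hp g w

/-- Points of one fibre differ by a group element, and the representation is faithful: a point of
the principal bundle is determined by its frame. -/
theorem frame_injective {x : X} {p q : A.carrier} (hp : A.proj p = x) (hq : A.proj q = x)
    (h : ∀ w, Φ.frame x p hp w = Φ.frame x q hq w) : p = q := by
  obtain ⟨g, rfl⟩ := exists_smul_eq (hp.trans hq.symm)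
  have hg : g = 1 := by
    apply Af.rep_injective
    ext1 w
    have h1 := h w
    rw [Φ.frame_smul hp] at h1
    rw [← (Φ.frame x p hp).injective h1, map_one]
    rfl
  rw [hg, MulOpposite.op_one, one_smul]

section MapOfBundle

variable {f : A.carrier → A'.carrier} (hproj : ∀ p, A'.proj (f p) = A.proj p)

/-- The isomorphism of associated bundles induced by a morphism of principal bundles. -/
def mapEquiv (x : X) : B.F.fib x ≃ₗ[ℂ] B'.F.fib x :=
  (Φ.frame x (A.proj_surjective x).choose (A.proj_surjective x).choose_spec).symm.trans
    (Φ'.frame x (f (A.proj_surjective x).choose)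
      ((hproj _).trans (A.proj_surjective x).choose_spec))

/-- Equivariance of `f` makes the result independent of the point over `x` chosen in the definition
of `mapEquiv`. -/
theorem mapEquiv_frame
    (hact : ∀ (g : Af n) (p : A.carrier), f (MulOpposite.op g • p) = MulOpposite.op g • f p)
    {x : X} {p : A.carrier} (hp : A.proj p = x) (w : Vec n) :
    mapEquiv Φ Φ' hproj x (Φ.frame x p hp w) = Φ'.frame x (f p) ((hproj p).trans hp) w := by
  have hq := (A.proj_surjective x).choose_spec
  have key : ∀ {q : A.carrier} (hq : A.proj q = x), Φ'.frame x (f q) ((hproj q).trans hq)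
      ((Φ.frame x q hq).symm (Φ.frame x p hp w)) =
      Φ'.frame x (f p) ((hproj p).trans hp) w := by
    intro q hq
    obtain ⟨g, rfl⟩ := exists_smul_eq (hq.trans hp.symm)
    rw [Φ.frame_smul hq, LinearEquiv.symm_apply_apply,
      ← Φ'.frame_smul _ _ ((A'.proj_action _ _).trans ((hproj q).trans hq)), Φ'.frame_congr (hact g q)]
  exact key hq

theorem contMDiff_mapEquiv (hf : ContMDiff (totalModel V n) (totalModel V n) ∞ f)
    (hact : ∀ (g : Af n) (p : A.carrier), f (MulOpposite.op g • p) = MulOpposite.op g • f p) :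
    ContMDiff (bundleModel V (n + 1)) (bundleModel V (n + 1)) ∞
      (fun e : B.F.Total => (⟨e.proj, mapEquiv Φ Φ' hproj e.proj e.snd⟩ : B'.F.Total)) := by
  intro v₀
  have he := A.isSmoothTriv_trivAt v₀.proj
  set e := A.trivAt v₀.proj
  have hv₀ : v₀.proj ∈ e.baseSet := A.mem_trivAt _
  have hπ : ContMDiffAt (bundleModel V (n + 1)) 𝓘(ℝ, V) ∞ (TotalSpace.proj : B.F.Total → X) v₀ :=
    contMDiffAt_proj B.F.fib
  have h1 : ContMDiffAt (bundleModel V (n + 1)) (totalModel V n) ∞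
      (fun v : B.F.Total => f (sec e v.proj)) v₀ :=
    (hf _).comp v₀ ((he.contMDiffAt_sec hv₀).comp v₀ hπ)
  have h2 := (Φ.gauge he).contMDiffAt_map hv₀
  have h3 := (Φ'.contMDiff_frame _).comp v₀ (h1.prodMk h2)
  refine h3.congr_of_eventuallyEq ?_
  filter_upwards [hπ.continuousAt.eventually (e.open_baseSet.mem_nhds hv₀)] with v hv
  have hs : A.proj (sec e v.proj) = v.proj := proj_sec hv
  refine Eq.trans ?_ (Φ'.mk_frame ((hproj _).trans hs) _)
  refine congrArg _ ?_
  rw [← mapEquiv_frame Φ Φ' hproj hact hs]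
  congr 1
  change v.snd = Φ.frame v.proj (sec e v.proj) hs
    ((Φ.frame v.proj (secExt e v.proj) (proj_secExt e v.proj)).symm v.snd)
  rw [← Φ.frame_congr (secExt_eq hv) (proj_secExt e v.proj), LinearEquiv.apply_symm_apply]

theorem quot_mapEquiv (x : X) (u : B.F.fib x) : B'.quot x (mapEquiv Φ Φ' hproj x u) = B.quot x u := by
  have h1 := Φ.quot_frame x _ (A.proj_surjective x).choose_spec ((Φ.frame x _
    (A.proj_surjective x).choose_spec).symm u)
  rw [LinearEquiv.apply_symm_apply] at h1
  rw [h1]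
  exact Φ'.quot_frame _ _ _ _

end MapOfBundle

section BundleOfMap

variable {ψ : ∀ x, B.F.fib x ≃ₗ[ℂ] B'.F.fib x} (hquot : ∀ x u, B'.quot x (ψ x u) = B.quot x u)
include hquot

/-- Compare `ψ` applied to the frame at `p` with the frame at any point `q` of the target over the
same base point. They differ by a complex automorphism preserving the last coordinate, which is the
action of some `g` in the affine group, and `q · g` is the required point. -/
theorem exists_frame_eq (p : A.carrier) : ∃ p' : A'.carrier, ∃ hp' : A'.proj p' = A.proj p,
    ∀ w, Φ'.frame (A.proj p) p' hp' w = ψ (A.proj p) (Φ.frame (A.proj p) p rfl w) := by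
  obtain ⟨q, hq⟩ := A'.proj_surjective (A.proj p)
  obtain ⟨g, hg⟩ := Af.exists_rep_eq ((Φ.frame (A.proj p) p rfl).trans
    ((ψ (A.proj p)).trans (Φ'.frame (A.proj p) q hq).symm)) (fun w => by
      refine (Φ'.quot_frame _ q hq _).symm.trans ?_
      simp [hquot, Φ.quot_frame])
  refine ⟨MulOpposite.op g • q, (A'.proj_action g q).trans hq, fun w => ?_⟩
  rw [Φ'.frame_smul hq, hg]
  simp

/-- The morphism of principal bundles induced by an isomorphism of associated bundles. -/
def bundleMap (p : A.carrier) : A'.carrier := (exists_frame_eq Φ Φ' hquot p).choose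

theorem proj_bundleMap (p : A.carrier) : A'.proj (bundleMap Φ Φ' hquot p) = A.proj p :=
  (exists_frame_eq Φ Φ' hquot p).choose_spec.choose

theorem frame_bundleMap {x : X} {p : A.carrier} (hp : A.proj p = x)
    (hp' : A'.proj (bundleMap Φ Φ' hquot p) = x) (w : Vec n) :
    Φ'.frame x (bundleMap Φ Φ' hquot p) hp' w = ψ x (Φ.frame x p hp w) := by
  subst hp
  exact (exists_frame_eq Φ Φ' hquot p).choose_spec.choose_spec w

theorem bundleMap_action (g : Af n) (p : A.carrier) :
    bundleMap Φ Φ' hquot (MulOpposite.op g • p) = MulOpposite.op g • bundleMap Φ Φ' hquot p := by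
  have h1 : A.proj (MulOpposite.op g • p) = A.proj p := A.proj_action g p
  have h2 := proj_bundleMap Φ Φ' hquot p
  have h3 := (proj_bundleMap Φ Φ' hquot (MulOpposite.op g • p)).trans h1
  refine Φ'.frame_injective h3 ((A'.proj_action _ _).trans h2) fun w => ?_
  rw [frame_bundleMap Φ Φ' hquot h1, Φ'.frame_smul h2, frame_bundleMap Φ Φ' hquot rfl, Φ.frame_smul rfl]

/-- In a trivialization of the target, the group coordinate of the image acts on `w` as `ψ` of the
frame at `p`, read in a gauge, and this is smooth in `p`. The image is then the translate of the
local section by this coordinate. -/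
theorem contMDiff_bundleMap (hψ : ContMDiff (bundleModel V (n + 1)) (bundleModel V (n + 1)) ∞
      (fun e : B.F.Total => (⟨e.proj, ψ e.proj e.snd⟩ : B'.F.Total))) :
    ContMDiff (totalModel V n) (totalModel V n) ∞ (bundleMap Φ Φ' hquot) := by
  intro p₀
  have he := A'.isSmoothTriv_trivAt (A.proj p₀)
  set e := A'.trivAt (A.proj p₀)
  have hx : A.proj p₀ ∈ e.baseSet := A'.mem_trivAt _
  have hev : ∀ᶠ p in 𝓝 p₀, A.proj p ∈ e.baseSet :=
    A.contMDiff_proj.continuous.continuousAt.eventually (e.open_baseSet.mem_nhds hx)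
  have hcoord : ContMDiffAt (totalModel V n) 𝓘(ℝ, AfLie n) ∞
      (fun p => coord e (bundleMap Φ Φ' hquot p)) p₀ := by
    refine contMDiffAt_Af_iff.2 (contMDiffAt_clm_of_apply fun w => ?_)
    have h1 : ContMDiffAt (totalModel V n) (bundleModel V (n + 1)) ∞
        (fun p => (⟨A.proj p, ψ (A.proj p) (Φ.frame (A.proj p) p rfl w)⟩ : B'.F.Total)) p₀ :=
      (hψ _).comp p₀ ((Φ.contMDiff_frame (p₀, w)).comp p₀ (contMDiffAt_id.prodMk contMDiffAt_const))
    have h2 := (((Φ'.gauge he).contMDiffAt_iff (m₀ := p₀) (h := fun p => (⟨A.proj p,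
      ψ (A.proj p) (Φ.frame (A.proj p) p rfl w)⟩ : B'.F.Total)) hx).1 h1).2
    refine h2.congr_of_eventuallyEq ?_
    filter_upwards [hev] with p hp
    have h3 := proj_bundleMap Φ Φ' hquot p
    have hsrc : bundleMap Φ Φ' hquot p ∈ e.source := e.mem_source.2 (h3 ▸ hp)
    have h4 := Φ'.gauge_map_frame he hsrc w
    refine h4.symm.trans ?_
    have h5 : ∀ (x : X) (hx : A'.proj (bundleMap Φ Φ' hquot p) = x),
        (Φ'.gauge he).map (A'.proj (bundleMap Φ Φ' hquot p)) (Φ'.frame _ _ rfl w) =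
        (Φ'.gauge he).map x (Φ'.frame x (bundleMap Φ Φ' hquot p) hx w) := by rintro x rfl; rfl
    rw [h5 _ h3, frame_bundleMap Φ Φ' hquot rfl]
  have h6 := (A'.contMDiff_action (sec e (A.proj p₀), coord e (bundleMap Φ Φ' hquot p₀))).comp p₀
    (((he.contMDiffAt_sec hx).comp p₀ (A.contMDiff_proj p₀)).prodMk hcoord)
  refine h6.congr_of_eventuallyEq ?_
  filter_upwards [hev] with p hp
  have h3 := proj_bundleMap Φ Φ' hquot p
  have hsrc : bundleMap Φ Φ' hquot p ∈ e.source := e.mem_source.2 (h3 ▸ hp)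
  refine (he.coord_smul_sec hsrc).symm.trans ?_
  rw [h3]
  rfl

end BundleOfMap

end FrameData

end FlatAffine

/-! ### Covariant derivatives under morphisms -/

namespace FlatAffine

open AffineBundle

namespace FrameData

variable {V : Type v} [NormedAddCommGroup V] [NormedSpace ℝ V] [FiniteDimensional ℝ V]
  {X : Type u} [TopologicalSpace X] [ChartedSpace V X] [IsManifold 𝓘(ℝ, V) ∞ X] {n : ℕ}
  {A A' : AffineBundle.{u, v} V X n} {B B' : Extn.{u, v} V X n} {Φ : FrameData A B}
  {Φ' : FrameData A' B'} {C : PrincipalConnection A} {C' : PrincipalConnection A'}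
  {D : Connection B.F} {D' : Connection B'.F}

-- The base point and the tangent vector are made independent variables, so that compatibility can
-- be used at `f p`, whose projection equals that of `p` only propositionally.
omit [FiniteDimensional ℝ V] in
theorem Compatible.cov_eq (h : Φ.Compatible C D) {x : X} {p : A.carrier} (hp : A.proj p = x)
    {s : ∀ x, B.F.fib x} (hs : B.F.DiffAt s x) (w : V × AfLie n) {v : V}
    (hv : (mfderiv (totalModel V n) 𝓘(ℝ, V) A.proj p w : V) = v) :
    D.cov s x v = Φ.frame x p hp
        (mvfderiv (totalModel V n) (fun q => (Φ.frame (A.proj q) q rfl).symm (s (A.proj q))) p w +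
          C.opForm p w ((Φ.frame x p hp).symm (s x))) := by
  subst hp hv
  exact h s p hs w

omit [FiniteDimensional ℝ V] [IsManifold 𝓘(ℝ, V) ∞ X] in
/-- The equivariant function of the image of a section. -/
theorem frame_symm_map {f : A.carrier → A'.carrier} (hproj : ∀ p, A'.proj (f p) = A.proj p)
    {ψ : ∀ x, B.F.fib x ≃ₗ[ℂ] B'.F.fib x}
    (hψ : ∀ (x : X) (p : A.carrier) (hp : A.proj p = x) (w : Vec n),
      ψ x (Φ.frame x p hp w) = Φ'.frame x (f p) ((hproj p).trans hp) w)
    (s : ∀ x, B.F.fib x) (p : A.carrier) :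
    (Φ'.frame (A'.proj (f p)) (f p) rfl).symm (ψ (A'.proj (f p)) (s (A'.proj (f p)))) =
      (Φ.frame (A.proj p) p rfl).symm (s (A.proj p)) := by
  have key : ∀ (x : X) (h : A'.proj (f p) = x),
      (Φ'.frame (A'.proj (f p)) (f p) rfl).symm (ψ (A'.proj (f p)) (s (A'.proj (f p)))) =
      (Φ'.frame x (f p) h).symm (ψ x (s x)) := by rintro x rfl; rfl
  rw [key _ (hproj p), LinearEquiv.symm_apply_eq, ← hψ _ _ rfl, LinearEquiv.apply_symm_apply]

omit [FiniteDimensional ℝ V] [IsManifold 𝓘(ℝ, V) ∞ X] in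
theorem diffAt_map {ψ : ∀ x, B.F.fib x ≃ₗ[ℂ] B'.F.fib x}
    (hψs : ContMDiff (bundleModel V (n + 1)) (bundleModel V (n + 1)) ∞
      (fun e : B.F.Total => (⟨e.proj, ψ e.proj e.snd⟩ : B'.F.Total)))
    {s : ∀ x, B.F.fib x} {x : X} (hs : B.F.DiffAt s x) : B'.F.DiffAt (fun y => ψ y (s y)) x :=
  (hψs.mdifferentiable (by simp) _).comp x hs

omit [FiniteDimensional ℝ V] in
/-- The covariant derivative of the image of a section. -/
theorem cov_map (h' : Φ'.Compatible C' D') {f : A.carrier → A'.carrier}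
    (hproj : ∀ p, A'.proj (f p) = A.proj p)
    (hf : ContMDiff (totalModel V n) (totalModel V n) ∞ f)
    {ψ : ∀ x, B.F.fib x ≃ₗ[ℂ] B'.F.fib x}
    (hψs : ContMDiff (bundleModel V (n + 1)) (bundleModel V (n + 1)) ∞
      (fun e : B.F.Total => (⟨e.proj, ψ e.proj e.snd⟩ : B'.F.Total)))
    (hψ : ∀ (x : X) (p : A.carrier) (hp : A.proj p = x) (w : Vec n),
      ψ x (Φ.frame x p hp w) = Φ'.frame x (f p) ((hproj p).trans hp) w)
    {s : ∀ x, B.F.fib x} {p : A.carrier} (hs : B.F.DiffAt s (A.proj p))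
    (w : TangentSpace (totalModel V n) p) :
    D'.cov (fun y => ψ y (s y)) (A.proj p) (mfderiv (totalModel V n) 𝓘(ℝ, V) A.proj p w) =
      ψ (A.proj p) (Φ.frame (A.proj p) p rfl
        (mvfderiv (totalModel V n) (fun q => (Φ.frame (A.proj q) q rfl).symm (s (A.proj q))) p w +
          C'.opForm (f p) (mfderiv (totalModel V n) (totalModel V n) f p w)
            ((Φ.frame (A.proj p) p rfl).symm (s (A.proj p))))) := by
  have df : MDifferentiableAt (totalModel V n) (totalModel V n) f p :=
    hf.mdifferentiable (by simp) p
  have hs' := diffAt_map hψs hs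
  have hv : (mfderiv (totalModel V n) 𝓘(ℝ, V) A'.proj (f p)
      (mfderiv (totalModel V n) (totalModel V n) f p w) : V) =
      mfderiv (totalModel V n) 𝓘(ℝ, V) A.proj p w := by
    have h1 := mfderiv_comp_apply p (A'.contMDiff_proj.mdifferentiable (by simp) (f p)) df w
    refine h1.symm.trans ?_
    have h2 : A'.proj ∘ f = A.proj := funext hproj
    rw [h2]
  have h3 := h'.cov_eq (hproj p) hs' _ hv
  have hs'' : B'.F.DiffAt (fun y => ψ y (s y)) (A'.proj (f p)) := by rw [hproj p]; exact hs'
  have h4 := mvfderiv_comp_vec (f := f) (Φ'.mdifferentiableAt_frame_symm hs'') df w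
  -- The equivariant function of `ψ s`, composed with `f`, is that of `s`; hence the two formulas
  -- for the derivative differ only in the connection form.
  have h5 : (fun q => (Φ'.frame (A'.proj (f q)) (f q) rfl).symm
      (ψ (A'.proj (f q)) (s (A'.proj (f q))))) =
      fun q => (Φ.frame (A.proj q) q rfl).symm (s (A.proj q)) :=
    funext fun q => frame_symm_map hproj hψ s q
  rw [h5] at h4
  have h6 : (Φ'.frame (A.proj p) (f p) (hproj p)).symm (ψ (A.proj p) (s (A.proj p))) =
      (Φ.frame (A.proj p) p rfl).symm (s (A.proj p)) := by
    rw [LinearEquiv.symm_apply_eq, ← hψ _ _ rfl, LinearEquiv.apply_symm_apply]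
  refine h3.trans ?_
  rw [hψ, h6]
  exact congrArg (fun z => Φ'.frame (A.proj p) (f p) (hproj p)
    (z + C'.opForm (f p) (mfderiv (totalModel V n) (totalModel V n) f p w)
      ((Φ.frame (A.proj p) p rfl).symm (s (A.proj p))))) h4.symm

end FrameData

variable {V : Type v} [NormedAddCommGroup V] [NormedSpace ℝ V]
  {X : Type u} [TopologicalSpace X] [ChartedSpace V X] [IsManifold 𝓘(ℝ, V) ∞ X] {n : ℕ}

/-! ### Morphisms between bundles and morphisms between their associated extensions -/

namespace AssociatedExtn

variable {A : FlatAffineBundle.{u, v} V X n} {B : FlatExtn.{u, v} V X n}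

/-- The frames of an associated extension. -/
def frameData (a : AssociatedExtn A B) : FrameData A.toAffineBundle B.toExtn where
  frame := a.frame
  contMDiff_frame := a.contMDiff_frame
  frame_action := a.frame_action
  quot_frame := a.quot_frame

theorem compatible (a : AssociatedExtn A B) : a.frameData.Compatible A.conn B.conn :=
  a.conn_frame

/-- Frames compatible with flat connections define an associated extension. -/
def ofFrameData (Φ : FrameData A.toAffineBundle B.toExtn) (h : Φ.Compatible A.conn B.conn) :
    AssociatedExtn A B where
  frame := Φ.frame
  contMDiff_frame := Φ.contMDiff_frame
  frame_action := Φ.frame_action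
  quot_frame := Φ.quot_frame
  conn_frame := h

variable {A' : FlatAffineBundle.{u, v} V X n} {B' : FlatExtn.{u, v} V X n}
  (a : AssociatedExtn A B) (a' : AssociatedExtn A' B')

section

variable [FiniteDimensional ℝ V]

/-- The morphism of extensions induced by a morphism of bundles. -/
def mapHom (f : A ⟶ A') : B ⟶ B' :=
  let hψ := FrameData.contMDiff_mapEquiv a.frameData a'.frameData f.proj_toFun f.contMDiff_toFun
    f.map_action
  let hq := FrameData.quot_mapEquiv a.frameData a'.frameData f.proj_toFun
  { φ := fun x => Extn.kerEquiv (B := B.toExtn) (B' := B'.toExtn) _ (hq x)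
    ψ := FrameData.mapEquiv a.frameData a'.frameData f.proj_toFun
    contMDiff_φ := Extn.contMDiff_kerEquiv hψ hq
    contMDiff_ψ := hψ
    comm_incl := fun x u => (Extn.incl_kerEquiv _ (hq x) u).symm
    comm_quot := hq
    pullback_conn := by
      intro s x hs v
      obtain ⟨p, rfl⟩ := A.proj_surjective x
      obtain ⟨w, rfl⟩ := mfderiv_proj_surjective p v
      refine (FrameData.cov_map a'.compatible f.proj_toFun f.contMDiff_toFun hψ
        (fun x p hp w => FrameData.mapEquiv_frame a.frameData a'.frameData f.proj_toFun f.map_action hp w)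
        hs w).trans (congrArg _ ?_)
      refine Eq.trans ?_ (a.compatible s p hs w).symm
      refine congrArg _ (congrArg (_ + ·) (congrArg (fun T : Vec n →L[ℝ] Vec n => T _) ?_))
      exact congrArg AfLie.op (f.pullback_form p w) }

theorem mapHom_frame (f : A ⟶ A') (x : X) (p : A.carrier) (hp : A.proj p = x) (w : Vec n) :
    (mapHom a a' f).ψ x (a.frame x p hp w) = a'.frame x (f.toFun p) ((f.proj_toFun p).trans hp) w :=
  FrameData.mapEquiv_frame a.frameData a'.frameData f.proj_toFun f.map_action hp w

/-- The morphism of bundles induced by a morphism of extensions. -/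
def bundleHom (g : B ⟶ B') : A ⟶ A' where
  toFun := FrameData.bundleMap a.frameData a'.frameData g.comm_quot
  contMDiff_toFun := FrameData.contMDiff_bundleMap a.frameData a'.frameData g.comm_quot g.contMDiff_ψ
  proj_toFun := FrameData.proj_bundleMap a.frameData a'.frameData g.comm_quot
  map_action := FrameData.bundleMap_action a.frameData a'.frameData g.comm_quot
  pullback_form := by
    intro p w
    apply AfLie.op_injective
    -- Since `ψ` intertwines the connections, the pullback of the target form and the source form
    -- induce the same connection, which determines the form.
    refine FrameData.eq_of_frame_eq a.frameData (w := w) fun s hs => ?_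
    have hproj := FrameData.proj_bundleMap a.frameData a'.frameData g.comm_quot
    have h1 := FrameData.cov_map (Φ := a.frameData) a'.compatible hproj
      (FrameData.contMDiff_bundleMap a.frameData a'.frameData g.comm_quot g.contMDiff_ψ)
      g.contMDiff_ψ (fun x p hp w => (FrameData.frame_bundleMap a.frameData a'.frameData
        g.comm_quot hp ((hproj p).trans hp) w).symm) hs w
    have h2 := (h1.symm.trans (g.pullback_conn s _ hs _)).trans
      (congrArg (g.ψ (A.proj p)) (a.compatible s p hs w))
    exact (a.frame _ p rfl).injective ((g.ψ (A.proj p)).injective h2)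

theorem frame_bundleHom (g : B ⟶ B') (x : X) (p : A.carrier) (hp : A.proj p = x) (w : Vec n) :
    a'.frame x ((bundleHom a a' g).toFun p) (((bundleHom a a' g).proj_toFun p).trans hp) w =
      g.ψ x (a.frame x p hp w) :=
  FrameData.frame_bundleMap a.frameData a'.frameData g.comm_quot hp _ w

end

/-- The frames exhaust every fibre of `F`, and `φ` is determined by `ψ` because the inclusion of the
target is injective. -/
theorem hom_ext (a : AssociatedExtn A B) {g g' : B ⟶ B'} (h : ∀ (x : X) (p : A.carrier) (hp : A.proj p = x) (w : Vec n),
    g.ψ x (a.frame x p hp w) = g'.ψ x (a.frame x p hp w)) : g = g' := by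
  have hψ : ∀ x u, g.ψ x u = g'.ψ x u := by
    intro x u
    obtain ⟨p, hp⟩ := A.proj_surjective x
    have := h x p hp ((a.frame x p hp).symm u)
    rwa [LinearEquiv.apply_symm_apply] at this
  refine FlatExtn.Hom.ext ?_ ?_
  · funext x
    ext1 u
    apply B'.incl_injective x
    rw [← g.comm_incl, ← g'.comm_incl, hψ]
  · funext x
    ext1 u
    exact hψ x u

end AssociatedExtn

end FlatAffine

namespace FlatAffine

open AffineBundle

/-! ### Complex vector bundles from cocycles -/

section RealStructure

variable {B F : Type*} [NormedAddCommGroup F] [NormedSpace ℂ F] [TopologicalSpace B]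
  {E : B → Type*} [∀ x, AddCommGroup (E x)] [∀ x, Module ℂ (E x)] [∀ x, TopologicalSpace (E x)]
  [TopologicalSpace (TotalSpace F E)] [FiberBundle F E]

omit [(x : B) → TopologicalSpace (E x)] [FiberBundle F E] in
theorem isLinear_real_of_complex (e : Trivialization F (TotalSpace.proj : TotalSpace F E → B))
    [e.IsLinear ℂ] : e.IsLinear ℝ where
  linear b hb :=
    { map_add := (e.linear ℂ hb).map_add
      map_smul := fun c v => by
        have h := (e.linear ℂ hb).map_smul (c : ℂ) v
        rwa [Complex.coe_smul, Complex.coe_smul] at h }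

omit [(x : B) → TopologicalSpace (E x)] [FiberBundle F E] in
theorem coordChangeL_real_apply (e e' : Trivialization F (TotalSpace.proj : TotalSpace F E → B))
    [e.IsLinear ℂ] [e'.IsLinear ℂ] [e.IsLinear ℝ] [e'.IsLinear ℝ] {b : B}
    (hb : b ∈ e.baseSet ∩ e'.baseSet) (w : F) :
    e.coordChangeL ℝ e' b w = e.coordChangeL ℂ e' b w := by
  rw [e.coordChangeL_apply e' hb, e.coordChangeL_apply e' hb]

/-- The trivializations are unchanged, and the real coordinate changes are the complex ones with
scalars restricted. The cocycles below are complex, whereas smoothness is a notion over `ℝ`. -/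
theorem vectorBundle_real_of_complex [VectorBundle ℂ F E] : VectorBundle ℝ F E where
  trivialization_linear' e _ := isLinear_real_of_complex e
  continuousOn_coordChange' e e' _ _ := by
    have : e.IsLinear ℝ := isLinear_real_of_complex e
    have : e'.IsLinear ℝ := isLinear_real_of_complex e'
    refine ((ContinuousLinearMap.restrictScalarsL ℂ F F ℝ ℝ).continuous.comp_continuousOn
      (continuousOn_coordChange ℂ e e')).congr fun b hb => ?_
    ext w
    exact coordChangeL_real_apply e e' hb w

end RealStructure

variable {V : Type v} [NormedAddCommGroup V] [NormedSpace ℝ V]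
  {X : Type u} [TopologicalSpace X] [ChartedSpace V X] {n r : ℕ}

section Core

variable {ι : Type*} (Z : VectorBundleCore ℂ X (Fin r → ℂ) ι)

/-- The complex vector bundle defined by a smooth cocycle. -/
def ComplexVectorBundle.ofCore (hZ : ∀ i j w, ContMDiffOn 𝓘(ℝ, V) 𝓘(ℝ, Fin r → ℂ) ∞
    (fun y => Z.coordChange i j y w) (Z.baseSet i ∩ Z.baseSet j)) :
    ComplexVectorBundle.{u, v} V X r :=
  letI : ∀ x, TopologicalSpace (Z.Fiber x) := Z.topologicalSpaceFiber
  haveI : VectorBundle ℝ (Fin r → ℂ) Z.Fiber := vectorBundle_real_of_complex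
  { fib := Z.Fiber
    topAddGroup := fun x => inferInstanceAs (IsTopologicalAddGroup (Fin r → ℂ))
    contSMul := fun x => inferInstanceAs (ContinuousSMul ℝ (Fin r → ℂ))
    contMDiff :=
      { contMDiffOn_coordChangeL := by
          rintro _ _ ⟨i, rfl⟩ ⟨j, rfl⟩
          intro y hy
          refine contMDiffWithinAt_clm_of_apply fun w => ?_
          refine (hZ i j w y hy).congr_of_mem (fun y hy => ?_) hy
          have := VectorBundleCore.localTriv.isLinear Z i
          have := VectorBundleCore.localTriv.isLinear Z j
          have := isLinear_real_of_complex (Z.localTriv i)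
          have := isLinear_real_of_complex (Z.localTriv j)
          refine (coordChangeL_real_apply (Z.localTriv i) (Z.localTriv j) hy w).trans ?_
          exact Z.localTriv_coordChange_eq i j hy w } }

end Core

/-! ### The bundles associated with a principal bundle -/

section Representations

/-- The affine group acting on `ℂ^{n+1}` by complex-linear operators. -/
def Af.crep : Af n →* (Vec n →L[ℂ] Vec n) where
  toFun g := LinearMap.toContinuousLinearMap
    (Matrix.mulVecLin (g.1 : Matrix (Fin (n + 1)) (Fin (n + 1)) ℂ))
  map_one' := by ext1 w; simp
  map_mul' g h := by ext1 w; simp [Matrix.mulVec_mulVec]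

theorem Af.crep_apply (g : Af n) (w : Vec n) : Af.crep g w = Af.rep g w := rfl

/-- The inclusion of `ℂ^n` into `ℂ^{n+1}`. -/
def snocZero (n : ℕ) : (Fin n → ℂ) →L[ℂ] Vec n :=
  LinearMap.toContinuousLinearMap
    { toFun := fun w => Fin.snoc (α := fun _ => ℂ) w 0
      map_add' := fun a b => by
        ext i
        refine Fin.lastCases ?_ (fun i => ?_) i <;> simp
      map_smul' := fun c a => by
        ext i
        refine Fin.lastCases ?_ (fun i => ?_) i <;> simp }

/-- The first `n` coordinates on `ℂ^{n+1}`. -/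
def initProj (n : ℕ) : Vec n →L[ℂ] (Fin n → ℂ) :=
  LinearMap.toContinuousLinearMap
    { toFun := fun w i => w i.castSucc
      map_add' := fun _ _ => rfl
      map_smul' := fun _ _ => rfl }

theorem snocZero_castSucc (w : Fin n → ℂ) (i : Fin n) : snocZero n w i.castSucc = w i := by
  simp [snocZero]

theorem snocZero_last (w : Fin n → ℂ) : snocZero n w (Fin.last n) = 0 := by
  simp [snocZero]

theorem initProj_snocZero (w : Fin n → ℂ) : initProj n (snocZero n w) = w :=
  funext fun i => snocZero_castSucc w i

theorem snocZero_initProj {w : Vec n} (hw : w (Fin.last n) = 0) :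
    snocZero n (initProj n w) = w := by
  ext i
  refine Fin.lastCases ?_ (fun i => ?_) i
  · rw [snocZero_last, hw]
  · rw [snocZero_castSucc]; rfl

/-- The linear part of the action of the affine group. -/
def Af.linRep : Af n →* ((Fin n → ℂ) →L[ℂ] (Fin n → ℂ)) where
  toFun g := initProj n ∘L Af.crep g ∘L snocZero n
  map_one' := by
    ext1 w
    simp [initProj_snocZero]
  map_mul' g h := by
    ext1 w
    have : snocZero n (initProj n (Af.crep h (snocZero n w))) = Af.crep h (snocZero n w) :=
      snocZero_initProj (by rw [Af.crep_apply, Af.rep_last, snocZero_last])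
    simp [this]

/-- The hyperplane `ℂ^n × {0}` is invariant under the affine group. This equivariance makes the
inclusion of the associated bundles look the same in all trivializations. -/
theorem Af.snocZero_linRep (g : Af n) (w : Fin n → ℂ) :
    snocZero n (Af.linRep g w) = Af.rep g (snocZero n w) :=
  snocZero_initProj (w := Af.crep g (snocZero n w))
    (by rw [Af.crep_apply, Af.rep_last, snocZero_last])

theorem Af.contMDiff_crep (w : Vec n) :
    ContMDiff 𝓘(ℝ, AfLie n) 𝓘(ℝ, Vec n) ∞ (fun g : Af n => Af.crep g w) :=
  contMDiff_rep.clm_apply contMDiff_const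

theorem Af.contMDiff_linRep (w : Fin n → ℂ) :
    ContMDiff 𝓘(ℝ, AfLie n) 𝓘(ℝ, Fin n → ℂ) ∞ (fun g : Af n => Af.linRep g w) :=
  ((initProj n).restrictScalars ℝ).contMDiff.comp (Af.contMDiff_crep (snocZero n w))

end Representations

namespace AffineBundle

variable (A : AffineBundle.{u, v} V X n)

/-- The transition functions of a principal bundle. -/
def transition (i j y : X) : Af n := coord (A.trivAt j) (sec (A.trivAt i) y)

variable {A} in
-- Write `p` as the translate by its `i`-th coordinate of the `i`-th section, then take the `j`-th
-- coordinate, which is equivariant.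
theorem transition_mul_coord {i j : X} {p : A.carrier} (hi : p ∈ (A.trivAt i).source)
    (hj : p ∈ (A.trivAt j).source) :
    A.transition i j (A.proj p) * coord (A.trivAt i) p = coord (A.trivAt j) p := by
  have hy := (A.trivAt i).mem_source.1 hi
  have hs : sec (A.trivAt i) (A.proj p) ∈ (A.trivAt j).source := by
    rw [(A.trivAt j).mem_source, proj_sec hy]
    exact (A.trivAt j).mem_source.1 hj
  have h := (A.isSmoothTriv_trivAt j).coord_smul hs (coord (A.trivAt i) p)
  rw [(A.isSmoothTriv_trivAt i).coord_smul_sec hi] at h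
  exact h.symm

variable {ρ : Af n →* ((Fin r → ℂ) →L[ℂ] (Fin r → ℂ))}

theorem contMDiffOn_transition (i j : X) : ContMDiffOn 𝓘(ℝ, V) 𝓘(ℝ, AfLie n) ∞
    (A.transition i j) ((A.trivAt i).baseSet ∩ (A.trivAt j).baseSet) := by
  refine (A.isSmoothTriv_trivAt j).contMDiffOn_coord.comp
    ((A.isSmoothTriv_trivAt i).contMDiffOn_sec.mono Set.inter_subset_left) fun y hy => ?_
  rw [Set.mem_preimage, (A.trivAt j).mem_source, proj_sec hy.1]
  exact hy.2

theorem contMDiffOn_transition_apply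
    (hρ : ∀ w, ContMDiff 𝓘(ℝ, AfLie n) 𝓘(ℝ, Fin r → ℂ) ∞ (fun g => ρ g w)) (i j : X)
    (w : Fin r → ℂ) : ContMDiffOn 𝓘(ℝ, V) 𝓘(ℝ, Fin r → ℂ) ∞
      (fun y => ρ (A.transition i j y) w) ((A.trivAt i).baseSet ∩ (A.trivAt j).baseSet) :=
  (hρ w).comp_contMDiffOn (A.contMDiffOn_transition i j)

/-- The cocycle of the vector bundle associated with a representation. -/
def assocCore (ρ : Af n →* ((Fin r → ℂ) →L[ℂ] (Fin r → ℂ)))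
    (hρ : ∀ w, ContMDiff 𝓘(ℝ, AfLie n) 𝓘(ℝ, Fin r → ℂ) ∞ (fun g => ρ g w)) :
    VectorBundleCore ℂ X (Fin r → ℂ) X where
  baseSet i := (A.trivAt i).baseSet
  isOpen_baseSet i := (A.trivAt i).open_baseSet
  indexAt := id
  mem_baseSet_at := A.mem_trivAt
  coordChange i j y := ρ (A.transition i j y)
  coordChange_self i y hy w := by
    rw [transition, coord_sec hy, map_one]; rfl
  continuousOn_coordChange i j :=
    continuousOn_clm_apply.2 fun w => (A.contMDiffOn_transition_apply hρ i j w).continuousOn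
  coordChange_comp i j k y hy w := by
    obtain ⟨⟨h1, h2⟩, h3⟩ := hy
    have h := transition_mul_coord (A := A) (i := j) (j := k) (p := sec (A.trivAt i) y)
      (by rwa [Trivialization.mem_source, proj_sec h1])
      (by rwa [Trivialization.mem_source, proj_sec h1])
    rw [proj_sec h1] at h
    change (ρ (A.transition j k y) * ρ (A.transition i j y)) w = ρ (A.transition i k y) w
    rw [← map_mul]
    exact congrArg (fun g => ρ g w) h

/-- The vector bundle associated with a representation. -/
def assocBundle (ρ : Af n →* ((Fin r → ℂ) →L[ℂ] (Fin r → ℂ)))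
    (hρ : ∀ w, ContMDiff 𝓘(ℝ, AfLie n) 𝓘(ℝ, Fin r → ℂ) ∞ (fun g => ρ g w)) :
    ComplexVectorBundle.{u, v} V X r :=
  ComplexVectorBundle.ofCore (A.assocCore ρ hρ) (A.contMDiffOn_transition_apply hρ)

variable {hρ : ∀ w, ContMDiff 𝓘(ℝ, AfLie n) 𝓘(ℝ, Fin r → ℂ) ∞ (fun g => ρ g w)}

/-- Vectors in a fibre of an associated bundle. -/
def assocFib (x : X) : (A.assocBundle ρ hρ).fib x ≃ₗ[ℂ] (Fin r → ℂ) := LinearEquiv.refl ℂ _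

/-- A fibre coordinate of an associated bundle. -/
theorem contMDiffAt_assocBundle {E' H' N : Type*} [NormedAddCommGroup E'] [NormedSpace ℝ E']
    [TopologicalSpace H'] {J : ModelWithCorners ℝ E' H'} [TopologicalSpace N] [ChartedSpace H' N]
    {h : N → (A.assocBundle ρ hρ).Total} {m₀ : N} :
    ContMDiffAt J (bundleModel V r) ∞ h m₀ ↔
      ContMDiffAt J 𝓘(ℝ, V) ∞ (fun m => (h m).proj) m₀ ∧
      ContMDiffAt J 𝓘(ℝ, Fin r → ℂ) ∞
        (fun m => ρ (A.transition (h m).proj (h m₀).proj (h m).proj) (A.assocFib _ (h m).snd)) m₀ :=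
  -- The fibre over `y` is a copy of `ℂ^r` through the trivialization chosen at `y`, so the
  -- trivialization at another point acts on it by the transition from `y` to that point.
  contMDiffAt_totalSpace

/-- The extension associated with a principal bundle. -/
def assocExtn : Extn.{u, v} V X n where
  E := A.assocBundle Af.linRep Af.contMDiff_linRep
  F := A.assocBundle Af.crep Af.contMDiff_crep
  incl x := (A.assocFib x).symm.toLinearMap ∘ₗ (snocZero n).toLinearMap ∘ₗ
    (A.assocFib x).toLinearMap
  contMDiff_incl := by
    intro v
    obtain ⟨h1, h2⟩ := A.contMDiffAt_assocBundle.1 (contMDiffAt_id (x := v))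
    refine A.contMDiffAt_assocBundle.2 ⟨h1, ?_⟩
    refine (((snocZero n).restrictScalars ℝ).contMDiff.contMDiffAt.comp v h2).congr_of_eventuallyEq
      (Filter.Eventually.of_forall fun e => ?_)
    exact (Af.snocZero_linRep _ _).symm
  quot x := LinearMap.proj (Fin.last n) ∘ₗ (A.assocFib x).toLinearMap
  contMDiff_quot := by
    intro v
    obtain ⟨h1, h2⟩ := A.contMDiffAt_assocBundle.1 (contMDiffAt_id (x := v))
    refine ((ContinuousLinearMap.proj (R := ℝ) (φ := fun _ : Fin (n + 1) => ℂ)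
      (Fin.last n)).contMDiff.contMDiffAt.comp v h2).congr_of_eventuallyEq
      (Filter.Eventually.of_forall fun e => ?_)
    exact (Af.rep_last _ _).symm
  incl_injective x := by
    intro a b hab
    apply (A.assocFib x).injective
    rw [← initProj_snocZero (A.assocFib x a), ← initProj_snocZero (A.assocFib x b)]
    exact congrArg (fun z => initProj n z) ((A.assocFib x).symm.injective hab)
  exact x u := by
    constructor
    · intro hu
      refine ⟨(A.assocFib x).symm (initProj n (A.assocFib x u)), ?_⟩
      exact (A.assocFib x).injective (snocZero_initProj hu)
    · rintro ⟨a, rfl⟩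
      exact snocZero_last _
  quot_surjective x c :=
    ⟨(A.assocFib x).symm (Pi.single (Fin.last n) c), Pi.single_eq_same (M := fun _ => ℂ) _ _⟩

/-- The identification of the fibre with `ℂ^{n+1}` varies with `x` in no controlled way. The
transition to a fixed trivialization removes this dependence and leaves the smooth coordinate of
`p`. -/
theorem assocFib_frame_coord {x : X} {p : A.carrier} (hp : A.proj p = x) (x₀ : X)
    (hx : x ∈ (A.trivAt x₀).baseSet) (w : Vec n) :
    Af.crep (A.transition x x₀ x) (Af.rep (coord (A.trivAt x) p) w) =
      Af.rep (coord (A.trivAt x₀) p) w := by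
  subst hp
  have h := transition_mul_coord (mem_source_trivAt p) ((A.trivAt x₀).mem_source.2 hx)
  rw [Af.crep_apply, ← h, map_mul]
  rfl

/-- A linear automorphism of `ℂ^{n+1}` defined by an element of the affine group. -/
def _root_.FlatAffine.Af.repEquiv (g : Af n) : Vec n ≃ₗ[ℂ] Vec n :=
  LinearEquiv.ofLinearMap (Af.crep g).toLinearMap (Af.crep g⁻¹).toLinearMap
    (LinearMap.ext fun w => Af.rep_apply_rep_inv g w)
    (LinearMap.ext fun w => Af.rep_inv_apply_rep g w)

/-- The frames of the associated extension. -/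
def assocFrameData : FrameData A A.assocExtn where
  frame x p _ := (Af.repEquiv (coord (A.trivAt x) p)).trans (A.assocFib x).symm
  contMDiff_frame := by
    intro q
    refine A.contMDiffAt_assocBundle.2 ⟨A.contMDiff_proj.contMDiffAt.comp q contMDiffAt_fst, ?_⟩
    have he := A.isSmoothTriv_trivAt (A.proj q.1)
    have hq := mem_source_trivAt q.1
    have h1 : ContMDiffAt ((totalModel V n).prod 𝓘(ℝ, Vec n)) 𝓘(ℝ, Vec n →L[ℝ] Vec n) ∞
        (fun z : A.carrier × Vec n => Af.rep (coord (A.trivAt (A.proj q.1)) z.1)) q :=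
      contMDiffAt_Af_iff.1 ((he.contMDiffAt_coord hq).comp q contMDiffAt_fst)
    refine (h1.clm_apply contMDiffAt_snd).congr_of_eventuallyEq ?_
    have hev : ∀ᶠ z : A.carrier × Vec n in 𝓝 q, z.1 ∈ (A.trivAt (A.proj q.1)).source :=
      continuousAt_fst.eventually ((A.trivAt (A.proj q.1)).open_source.mem_nhds hq)
    filter_upwards [hev] with z hz
    exact A.assocFib_frame_coord rfl _ ((A.trivAt (A.proj q.1)).mem_source.1 hz) z.2
  frame_action x p hp g w := by
    subst hp
    refine (A.assocFib _).injective ?_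
    change Af.rep (coord (A.trivAt _) (MulOpposite.op g • p)) w = Af.rep _ (Af.rep g w)
    rw [(A.isSmoothTriv_trivAt _).coord_smul (mem_source_trivAt p), map_mul]
    rfl
  quot_frame x p hp w := Af.rep_last _ w

end AffineBundle

end FlatAffine

/-! ### The functor to flat extensions -/

namespace FlatAffine

open AffineBundle

variable {V : Type v} [NormedAddCommGroup V] [NormedSpace ℝ V] [FiniteDimensional ℝ V]
  {X : Type u} [TopologicalSpace X] [ChartedSpace V X] [IsManifold 𝓘(ℝ, V) ∞ X] {n : ℕ}

omit [FiniteDimensional ℝ V] [IsManifold 𝓘(ℝ, V) ∞ X] in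
theorem Extn.mdifferentiableAt_quot {B : Extn.{u, v} V X n} {s : ∀ x, B.F.fib x} {x : X}
    (hs : B.F.DiffAt s x) : MDifferentiableAt 𝓘(ℝ, V) 𝓘(ℝ, ℂ) (fun y => B.quot y (s y)) x :=
  (B.contMDiff_quot.mdifferentiable (by simp) _).comp x hs

namespace FrameData

variable {A : AffineBundle.{u, v} V X n} {B : Extn.{u, v} V X n} {Φ : FrameData A B}
  {C : PrincipalConnection A} {D : Connection B.F}

omit [FiniteDimensional ℝ V] in
/-- A connection induced by a principal connection induces the trivial connection on the trivial
line bundle. -/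
theorem Compatible.quot_cov (h : Φ.Compatible C D) {s : ∀ x, B.F.fib x} {x : X}
    (hs : B.F.DiffAt s x) (v : TangentSpace 𝓘(ℝ, V) x) :
    B.quot x (D.cov s x v) = mvfderiv 𝓘(ℝ, V) (fun y => B.quot y (s y)) x v := by
  obtain ⟨p, rfl⟩ := A.proj_surjective x
  obtain ⟨w, rfl⟩ := mfderiv_proj_surjective p v
  refine (congrArg (B.quot (A.proj p)) (h s p hs w)).trans ?_
  rw [Φ.quot_frame]
  have h1 : ∀ q, B.quot (A.proj q) (s (A.proj q)) =
      (Φ.frame (A.proj q) q rfl).symm (s (A.proj q)) (Fin.last n) := fun q => by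
    have := Φ.quot_frame (A.proj q) q rfl ((Φ.frame (A.proj q) q rfl).symm (s (A.proj q)))
    rwa [LinearEquiv.apply_symm_apply] at this
  refine Eq.trans ?_ (mvfderiv_comp_vec (g := fun y => B.quot y (s y))
    (Extn.mdifferentiableAt_quot hs) (A.contMDiff_proj.mdifferentiable (by simp) p) w)
  simp only [h1]
  refine Eq.trans ?_ (mvfderiv_clm_comp (ContinuousLinearMap.proj (R := ℝ)
    (φ := fun _ : Fin (n + 1) => ℂ) (Fin.last n)) (Φ.mdifferentiableAt_frame_symm hs) w).symm
  have h2 : C.opForm p w ((Φ.frame (A.proj p) p rfl).symm (s (A.proj p))) (Fin.last n) = 0 :=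
    AfLie.op_last _ _
  rw [Pi.add_apply, h2, add_zero]
  rfl

/-- `E` is the kernel of the projection, so a connection that induces `d` on `O_X` sends sections of
`E` to sections with zero projection. -/
theorem Compatible.cov_incl_mem (h : Φ.Compatible C D) {s : ∀ x, B.E.fib x} {x : X}
    (hs : B.E.DiffAt s x) (v : TangentSpace 𝓘(ℝ, V) x) :
    D.cov (fun y => B.incl y (s y)) x v ∈ LinearMap.range (B.incl x) := by
  refine (B.exact x _).1 ?_
  have hs' : B.F.DiffAt (fun y => B.incl y (s y)) x :=
    (B.contMDiff_incl.mdifferentiable (by simp) _).comp x hs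
  refine (h.quot_cov hs' v).trans ?_
  have : (fun y => B.quot y (B.incl y (s y))) = fun _ => 0 :=
    funext fun y => (B.exact y _).2 ⟨_, rfl⟩
  rw [this, mvfderiv_const]
  rfl

end FrameData

variable [T2Space X]

/-- The flat extension associated with a flat affine bundle. -/
def FlatAffineBundle.flatExtn (A : FlatAffineBundle.{u, v} V X n) : FlatExtn.{u, v} V X n where
  toExtn := A.assocExtn
  conn := A.assocFrameData.inducedConnection A.conn
  flat := (A.assocFrameData.compatible_inducedConnection A.conn).isFlat_iff.1 A.flat
  preserves _ _ hs w := (A.assocFrameData.compatible_inducedConnection A.conn).cov_incl_mem hs w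
  induces_trivial _ _ hs w := (A.assocFrameData.compatible_inducedConnection A.conn).quot_cov hs w

/-- The frames of the flat extension associated with a flat affine bundle. -/
def FlatAffineBundle.associatedExtn (A : FlatAffineBundle.{u, v} V X n) :
    AssociatedExtn A A.flatExtn :=
  AssociatedExtn.ofFrameData A.assocFrameData
    (A.assocFrameData.compatible_inducedConnection A.conn)

namespace FlatAffineBundle

variable (V X n) in
/-- The functor sending a flat affine bundle to the associated flat extension. -/
def flatExtnFunctor : FlatAffineBundle.{u, v} V X n ⥤ FlatExtn.{u, v} V X n where
  obj A := A.flatExtn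
  map {A B} f := A.associatedExtn.mapHom B.associatedExtn f
  map_id A := by
    refine A.associatedExtn.hom_ext fun x p hp w => ?_
    rw [AssociatedExtn.mapHom_frame]
    rfl
  map_comp {A B C} f g := by
    refine A.associatedExtn.hom_ext fun x p hp w => ?_
    rw [AssociatedExtn.mapHom_frame]
    refine Eq.trans ?_ (congrArg ((B.associatedExtn.mapHom C.associatedExtn g).ψ x)
      (AssociatedExtn.mapHom_frame A.associatedExtn B.associatedExtn f x p hp w).symm)
    rw [AssociatedExtn.mapHom_frame]
    rfl

theorem flatExtnFunctor_map_frame {A B : FlatAffineBundle.{u, v} V X n} (f : A ⟶ B) {x : X}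
    {p : A.carrier} (hp : A.proj p = x) (w : Vec n) :
    ((flatExtnFunctor V X n).map f).ψ x (A.associatedExtn.frame x p hp w) =
      B.associatedExtn.frame x (f.toFun p) ((f.proj_toFun p).trans hp) w :=
  AssociatedExtn.mapHom_frame _ _ f x p hp w

instance : (flatExtnFunctor.{u, v} V X n).Faithful where
  map_injective {A B} f g h := by
    refine FlatAffineBundle.Hom.ext (funext fun p => ?_)
    refine B.associatedExtn.frameData.frame_injective ((f.proj_toFun p).trans rfl)
      ((g.proj_toFun p).trans rfl) fun w => ?_
    refine (flatExtnFunctor_map_frame f rfl w).symm.trans ?_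
    rw [h]
    exact flatExtnFunctor_map_frame g rfl w

instance : (flatExtnFunctor.{u, v} V X n).Full where
  map_surjective {A B} g := by
    refine ⟨A.associatedExtn.bundleHom B.associatedExtn g, ?_⟩
    refine A.associatedExtn.hom_ext fun x p hp w => ?_
    exact (flatExtnFunctor_map_frame (A.associatedExtn.bundleHom B.associatedExtn g) hp w).trans
      (AssociatedExtn.frame_bundleHom _ _ g x p hp w)

end FlatAffineBundle

/-- Extensions associated with the same bundle are isomorphic. -/
def AssociatedExtn.iso {A : FlatAffineBundle.{u, v} V X n} {B B' : FlatExtn.{u, v} V X n}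
    (a : AssociatedExtn A B) (a' : AssociatedExtn A B') : B ≅ B' where
  hom := a.mapHom a' (𝟙 A)
  inv := a'.mapHom a (𝟙 A)
  hom_inv_id := by
    refine a.hom_ext fun x p hp w => ?_
    refine (congrArg ((a'.mapHom a (𝟙 A)).ψ x) (a.mapHom_frame a' (𝟙 A) x p hp w)).trans ?_
    exact a'.mapHom_frame a (𝟙 A) x p hp w
  inv_hom_id := by
    refine a'.hom_ext fun x p hp w => ?_
    refine (congrArg ((a.mapHom a' (𝟙 A)).ψ x) (a'.mapHom_frame a (𝟙 A) x p hp w)).trans ?_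
    exact a.mapHom_frame a' (𝟙 A) x p hp w

end FlatAffine

namespace FlatAffine

/-! ### Iterated charted spaces -/

section Composition

variable {E H H' M : Type*} [NormedAddCommGroup E] [NormedSpace ℝ E] [TopologicalSpace H]
  {I : ModelWithCorners ℝ E H} [TopologicalSpace H'] [ChartedSpace H H'] [IsManifold I ∞ H']
  [TopologicalSpace M] [ChartedSpace H' M]

/-- A space charted over a manifold, with smooth changes of charts, is a manifold. -/
theorem isManifold_comp (h : ∀ e ∈ atlas H' M, ∀ e' ∈ atlas H' M,
    ContMDiffOn I I ∞ (e.symm ≫ₕ e') (e.symm ≫ₕ e').source) :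
    letI := ChartedSpace.comp H H' M
    IsManifold I ∞ M := by
  let := ChartedSpace.comp H H' M
  refine isManifold_of_contDiffOn I ∞ M ?_
  rintro _ _ ⟨e, he, φ, hφ, rfl⟩ ⟨e', he', φ', hφ', rfl⟩
  refine contMDiffOn_iff_contDiffOn.1 ?_
  have h1 := contMDiffOn_symm_of_mem_maximalAtlas (I := I) (n := ∞)
    (IsManifold.subset_maximalAtlas (I := I) (n := ∞) hφ)
  have h2 := contMDiffOn_of_mem_maximalAtlas (I := I) (n := ∞)
    (IsManifold.subset_maximalAtlas (I := I) (n := ∞) hφ')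
  have h3 := h e he e' he'
  intro x hx
  obtain ⟨⟨⟨hx1, hx2⟩, hx3, hx4⟩, hx5⟩ := hx
  have g1 := I.contMDiffOn_symm (n := ∞) x hx5
  have g2 := (h1.contMDiffAt (φ.open_target.mem_nhds hx1)).comp_contMDiffWithinAt x g1
  have g3 := (h3.contMDiffAt ((e.symm ≫ₕ e').open_source.mem_nhds
    (x := φ.symm (I.symm x)) ⟨hx2, hx3⟩)).comp_contMDiffWithinAt x g2
  have g4 := (h2.contMDiffAt (φ'.open_source.mem_nhds hx4)).comp_contMDiffWithinAt x g3
  have g5 := (I.contMDiff (n := ∞)).contMDiffAt.comp_contMDiffWithinAt x g4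
  exact g5.mono Set.inter_subset_right

/-- Followed by a chart of `H'`, the map `e` is a chart of the iterated structure, hence smooth; the
chart of `H'` is then undone by its smooth inverse. -/
theorem contMDiffOn_of_mem_atlas_comp {e : OpenPartialHomeomorph M H'} (he : e ∈ atlas H' M)
    (hM : letI := ChartedSpace.comp H H' M; IsManifold I ∞ M) :
    letI := ChartedSpace.comp H H' M
    ContMDiffOn I I ∞ e e.source := by
  let := ChartedSpace.comp H H' M
  intro p hp
  have hφ := chart_mem_atlas H (e p)
  have hp' : e p ∈ (chartAt H (e p)).source := mem_chart_source H (e p)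
  have hc : e ≫ₕ chartAt H (e p) ∈ atlas H M := ⟨e, he, _, hφ, rfl⟩
  have h1 := contMDiffAt_of_mem_maximalAtlas (I := I) (n := ∞)
    (IsManifold.subset_maximalAtlas (I := I) (n := ∞) hc) (x := p) ⟨hp, hp'⟩
  have h2 := contMDiffAt_symm_of_mem_maximalAtlas (I := I) (n := ∞)
    (IsManifold.subset_maximalAtlas (I := I) (n := ∞) hφ)
    ((chartAt H (e p)).map_source hp')
  refine ContMDiffAt.contMDiffWithinAt ((h2.comp p h1).congr_of_eventuallyEq ?_)
  filter_upwards [(e ≫ₕ chartAt H (e p)).open_source.mem_nhds ⟨hp, hp'⟩] with q hq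
  exact ((chartAt H (e p)).left_inv hq.2).symm

theorem contMDiffOn_symm_of_mem_atlas_comp {e : OpenPartialHomeomorph M H'} (he : e ∈ atlas H' M)
    (hM : letI := ChartedSpace.comp H H' M; IsManifold I ∞ M) :
    letI := ChartedSpace.comp H H' M
    ContMDiffOn I I ∞ e.symm e.target := by
  let := ChartedSpace.comp H H' M
  intro x hx
  have hφ := chart_mem_atlas H x
  have hx' : x ∈ (chartAt H x).source := mem_chart_source H x
  have hc : e ≫ₕ chartAt H x ∈ atlas H M := ⟨e, he, _, hφ, rfl⟩
  have h1 := contMDiffAt_of_mem_maximalAtlas (I := I) (n := ∞)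
    (IsManifold.subset_maximalAtlas (I := I) (n := ∞) hφ) hx'
  have h2 := contMDiffAt_symm_of_mem_maximalAtlas (I := I) (n := ∞)
    (IsManifold.subset_maximalAtlas (I := I) (n := ∞) hc) (x := chartAt H x x)
    (by
      refine ⟨(chartAt H x).map_source hx', ?_⟩
      change (chartAt H x).symm (chartAt H x x) ∈ e.target
      rwa [(chartAt H x).left_inv hx'])
  refine ContMDiffAt.contMDiffWithinAt ((h2.comp x h1).congr_of_eventuallyEq ?_)
  filter_upwards [(chartAt H x).open_source.mem_nhds hx'] with y hy
  exact congrArg e.symm ((chartAt H x).left_inv hy).symm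

end Composition

/-! ### Adapted gauges -/

section Adapted

variable {V : Type v} [NormedAddCommGroup V] [NormedSpace ℝ V]
  {X : Type u} [TopologicalSpace X] [ChartedSpace V X] {n : ℕ} (B : Extn.{u, v} V X n)

/-- The inclusion of the last coordinate line into `ℂ^{n+1}`. -/
def lastIncl (n : ℕ) : ℂ →L[ℂ] Vec n :=
  ContinuousLinearMap.single ℂ (fun _ : Fin (n + 1) => ℂ) (Fin.last n)

theorem snocZero_add_lastIncl_last (a : Fin n → ℂ) (c : ℂ) :
    (snocZero n a + lastIncl n c) (Fin.last n) = c := by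
  simp [snocZero_last, lastIncl]

theorem snocZero_add_lastIncl (w : Vec n) :
    snocZero n (initProj n w) + lastIncl n (w (Fin.last n)) = w := by
  ext i
  refine Fin.lastCases ?_ (fun i => ?_) i
  · exact snocZero_add_lastIncl_last _ _
  · have : lastIncl n (w (Fin.last n)) i.castSucc = 0 := by
      simp [lastIncl, Fin.castSucc_ne_last]
    rw [Pi.add_apply, this, add_zero, snocZero_castSucc]
    rfl

namespace Extn

/-- A frame of a fibre, in which the projection is the last coordinate. -/
theorem exists_fib_equiv (x : X) : ∃ c : B.F.fib x ≃ₗ[ℂ] Vec n,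
    ∀ u, c u (Fin.last n) = B.quot x u := by
  -- A lift `u₁` of `1` splits the sequence at `x`; coordinates on the fibre of `E` supply the first
  -- `n` coordinates.
  obtain ⟨u₁, hu₁⟩ := B.quot_surjective x 1
  let ε := (trivializationAt (Fin n → ℂ) B.E.fib x).linearEquivAt ℂ x
    (mem_baseSet_trivializationAt _ _ _)
  let T : Vec n →ₗ[ℂ] B.F.fib x :=
    B.incl x ∘ₗ ε.symm.toLinearMap ∘ₗ (initProj n).toLinearMap +
      (LinearMap.proj (Fin.last n)).smulRight u₁
  have hT : ∀ w, T w = B.incl x (ε.symm (initProj n w)) + w (Fin.last n) • u₁ := fun w => rfl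
  have hq : ∀ w, B.quot x (T w) = w (Fin.last n) := fun w => by
    rw [hT, map_add, (B.exact x _).2 ⟨_, rfl⟩, map_smul, hu₁, zero_add, smul_eq_mul, mul_one]
  have hinj : Function.Injective T := by
    refine (injective_iff_map_eq_zero T).2 fun w hw => ?_
    have h1 : w (Fin.last n) = 0 := by rw [← hq w, hw, map_zero]
    rw [hT, h1, zero_smul, add_zero] at hw
    have h2 := B.incl_injective x (hw.trans (map_zero _).symm)
    rw [← snocZero_add_lastIncl w, h1, ε.symm.map_eq_zero_iff.1 h2, map_zero, map_zero, add_zero]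
  have hsurj : Function.Surjective T := by
    intro u
    obtain ⟨a, ha⟩ := (B.exact x (u - B.quot x u • u₁)).1 (by
      rw [map_sub, map_smul, hu₁, smul_eq_mul, mul_one, sub_self])
    refine ⟨snocZero n (ε a) + lastIncl n (B.quot x u), ?_⟩
    have h1 : initProj n (snocZero n (ε a) + lastIncl n (B.quot x u)) = ε a := by
      have : initProj n (lastIncl n (B.quot x u)) = 0 := by
        ext i
        simp [initProj, lastIncl, Fin.castSucc_ne_last]
      rw [map_add, this, add_zero, initProj_snocZero]
    rw [hT, h1, snocZero_add_lastIncl_last, ε.symm_apply_apply, ha, sub_add_cancel]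
  let c := LinearEquiv.ofBijective T ⟨hinj, hsurj⟩
  exact ⟨c.symm, fun u => (hq (c.symm u)).symm.trans (congrArg (B.quot x) (c.apply_symm_apply u))⟩

/-- A gauge defined near a given point, in which the projection is the last coordinate. -/
theorem exists_gauge (x : X) : ∃ c : B.F.Gauge, x ∈ c.base ∧
    ∀ y u, c.map y u (Fin.last n) = B.quot y u := by
  obtain ⟨c₀, hc₀⟩ := B.exists_fib_equiv x
  set e := trivializationAt (Vec n) B.F.fib x with he
  have hx : x ∈ e.baseSet := mem_baseSet_trivializationAt _ _ _
  -- The first `n` coordinates are transported from the fibre at `x` by the trivialization, and the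
  -- last one is the projection itself. At `x` this is `c₀`, so `T y` remains invertible near `x`.
  let T : ∀ y, B.F.fib y →ₗ[ℂ] Vec n := fun y =>
    (snocZero n).toLinearMap ∘ₗ (initProj n).toLinearMap ∘ₗ c₀.toLinearMap ∘ₗ e.symmₗ ℂ x ∘ₗ
      e.linearMapAt ℂ y + (lastIncl n).toLinearMap ∘ₗ B.quot y
  have hTl : ∀ y u, T y u (Fin.last n) = B.quot y u := fun y u => snocZero_add_lastIncl_last _ _
  have hTx : ∀ u, T x u = c₀ u := fun u => by
    have h1 : T x u = snocZero n (initProj n (c₀ (e.symmₗ ℂ x (e.linearMapAt ℂ x u)))) +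
      lastIncl n (B.quot x u) := rfl
    rw [h1, e.symmₗ_linearMapAt hx, ← hc₀, snocZero_add_lastIncl]
  have hTs : ContMDiffOn (bundleModel V (n + 1)) 𝓘(ℝ, Vec n) ∞
      (fun v : B.F.Total => T v.proj v.snd) (TotalSpace.proj ⁻¹' e.baseSet) := by
    have h1 : ContMDiffOn (bundleModel V (n + 1)) 𝓘(ℝ, Vec n) ∞
        (fun v : B.F.Total => (e v).2) (TotalSpace.proj ⁻¹' e.baseSet) := by
      have := contMDiff_snd.comp_contMDiffOn (e.contMDiffOn (n := ∞) (IB := 𝓘(ℝ, V)))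
      rwa [e.source_eq] at this
    let L : Vec n →L[ℂ] Vec n := snocZero n ∘L initProj n ∘L
      LinearMap.toContinuousLinearMap (c₀.toLinearMap ∘ₗ e.symmₗ ℂ x)
    have h2 := (L.restrictScalars ℝ).contMDiff.comp_contMDiffOn h1
    have h3 := ((lastIncl n).restrictScalars ℝ).contMDiff.comp_contMDiffOn
      (B.contMDiff_quot.contMDiffOn (s := TotalSpace.proj ⁻¹' e.baseSet))
    refine (h2.add h3).congr fun v hv => ?_
    have h4 : e.linearMapAt ℂ v.proj v.snd = (e v).2 := by rw [e.coe_linearMapAt_of_mem hv]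
    change snocZero n (initProj n (c₀ (e.symmₗ ℂ x (e.linearMapAt ℂ v.proj v.snd)))) + _ = _
    rw [h4]
    rfl
  -- `T` read in the trivialization; as `M` is continuous and units are open, this yields the open
  -- base of the gauge.
  let M : X → Vec n →L[ℝ] Vec n := fun y =>
    LinearMap.toContinuousLinearMap ((T y ∘ₗ e.symmₗ ℂ y).restrictScalars ℝ)
  have hM : ∀ y w, M y w = T y (e.symmₗ ℂ y w) := fun _ _ => rfl
  have hMs : ∀ y ∈ e.baseSet, ContMDiffAt 𝓘(ℝ, V) 𝓘(ℝ, Vec n →L[ℝ] Vec n) ∞ M y := by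
    intro y hy
    refine contMDiffAt_clm_of_apply fun w => ?_
    have h3 := hTs.contMDiffAt (x := ⟨y, e.symmₗ ℂ y w⟩)
      ((e.open_baseSet.preimage (FiberBundle.continuous_proj (Vec n) B.F.fib)).mem_nhds hy)
    exact ContMDiffAt.comp (f := fun y => (⟨y, e.symmₗ ℂ y w⟩ : B.F.Total)) y h3
      (ComplexVectorBundle.contMDiffAt_mk_symm (h := fun _ => w) contMDiffAt_id hy
        contMDiffAt_const)
  have hMc : ContinuousOn M e.baseSet := fun y hy => (hMs y hy).continuousAt.continuousWithinAt
  have hbij : ∀ y, y ∈ e.baseSet → IsUnit (M y) → Function.Bijective (T y) := by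
    intro y hy hu
    have h1 : ∀ u, T y u = M y (e.linearMapAt ℂ y u) := fun u => by
      rw [hM, e.symmₗ_linearMapAt hy]
    obtain ⟨m, hm⟩ := hu
    have hl : ∀ w, (↑m⁻¹ : Vec n →L[ℝ] Vec n) (M y w) = w := fun w => by
      rw [← hm]; exact DFunLike.congr_fun m.inv_mul w
    have hr : ∀ w, M y ((↑m⁻¹ : Vec n →L[ℝ] Vec n) w) = w := fun w => by
      rw [← hm]; exact DFunLike.congr_fun m.mul_inv w
    constructor
    · intro a b hab
      rw [h1, h1] at hab
      have h2 := congrArg (↑m⁻¹ : Vec n →L[ℝ] Vec n) hab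
      rw [hl, hl] at h2
      rw [← e.symmₗ_linearMapAt (R := ℂ) hy a, h2, e.symmₗ_linearMapAt hy]
    · intro w
      refine ⟨e.symmₗ ℂ y ((↑m⁻¹ : Vec n →L[ℝ] Vec n) w), ?_⟩
      rw [← hM, hr]
  have hxu : IsUnit (M x) := by
    have hr : ∀ w, M x (e.linearMapAt ℂ x (c₀.symm w)) = w := fun w => by
      rw [hM, hTx, e.symmₗ_linearMapAt hx, c₀.apply_symm_apply]
    have hl : ∀ w, e.linearMapAt ℂ x (c₀.symm (M x w)) = w := fun w => by
      rw [hM, hTx, c₀.symm_apply_apply, e.linearMapAt_symmₗ hx]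
    let N : Vec n →L[ℝ] Vec n := LinearMap.toContinuousLinearMap
      ((e.linearMapAt ℂ x ∘ₗ c₀.symm.toLinearMap).restrictScalars ℝ)
    exact ⟨⟨M x, N, ContinuousLinearMap.ext hr, ContinuousLinearMap.ext hl⟩, rfl⟩
  classical
  refine ⟨⟨e.baseSet ∩ M ⁻¹' {m | IsUnit m},
    hMc.isOpen_inter_preimage e.open_baseSet Units.isOpen,
    -- Off the base an arbitrary fibre frame with the right last coordinate is used, so that the
    -- condition on the last coordinate, and with it the group-valued changes of gauge, hold over
    -- all of `X`.
    fun y => if h : y ∈ e.baseSet ∩ M ⁻¹' {m | IsUnit m} then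
      LinearEquiv.ofBijective (T y) (hbij y h.1 h.2) else (B.exists_fib_equiv y).choose, ?_⟩,
    ⟨hx, hxu⟩, fun y u => ?_⟩
  · refine (hTs.mono (Set.preimage_mono Set.inter_subset_left)).congr fun v hv => ?_
    have hv' : v.proj ∈ e.baseSet ∩ M ⁻¹' {m | IsUnit m} := hv
    rw [dif_pos hv']
    rfl
  · by_cases h : y ∈ e.baseSet ∩ M ⁻¹' {m | IsUnit m}
    · dsimp only
      rw [dif_pos h]
      exact hTl y u
    · dsimp only
      rw [dif_neg h]
      exact (B.exists_fib_equiv y).choose_spec u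

end Extn

end Adapted

end FlatAffine

namespace FlatAffine

/-! ### The frame bundle of an extension -/

namespace Extn

variable {V : Type v} [NormedAddCommGroup V] [NormedSpace ℝ V]
  {X : Type u} [TopologicalSpace X] [ChartedSpace V X] {n : ℕ} (B : Extn.{u, v} V X n)

/-- A chosen adapted gauge around a point. -/
def gaugeAt (x : X) : B.F.Gauge := (B.exists_gauge x).choose

theorem mem_gaugeAt (x : X) : x ∈ (B.gaugeAt x).base := (B.exists_gauge x).choose_spec.1

theorem gaugeAt_last (x y : X) (u : B.F.fib y) :
    (B.gaugeAt x).map y u (Fin.last n) = B.quot y u :=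
  (B.exists_gauge x).choose_spec.2 y u

theorem quot_gaugeAt_symm (x y : X) (w : Vec n) :
    B.quot y (((B.gaugeAt x).map y).symm w) = w (Fin.last n) := by
  rw [← B.gaugeAt_last x, LinearEquiv.apply_symm_apply]

theorem exists_gaugeChange (i j y : X) : ∃ g : Af n, ∀ w,
    Af.rep g w = (B.gaugeAt j).map y (((B.gaugeAt i).map y).symm w) :=
  Af.exists_rep_eq (((B.gaugeAt i).map y).symm.trans ((B.gaugeAt j).map y)) fun w => by
    rw [LinearEquiv.trans_apply, B.gaugeAt_last, B.quot_gaugeAt_symm]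

/-- The changes of adapted gauges. -/
def gaugeChange (i j y : X) : Af n := (B.exists_gaugeChange i j y).choose

theorem rep_gaugeChange (i j y : X) (w : Vec n) :
    Af.rep (B.gaugeChange i j y) w = (B.gaugeAt j).map y (((B.gaugeAt i).map y).symm w) :=
  (B.exists_gaugeChange i j y).choose_spec w

theorem gaugeChange_self (i y : X) : B.gaugeChange i i y = 1 := by
  apply Af.rep_injective
  ext1 w
  rw [rep_gaugeChange, LinearEquiv.apply_symm_apply, map_one]
  rfl

theorem gaugeChange_mul (i j k y : X) :
    B.gaugeChange j k y * B.gaugeChange i j y = B.gaugeChange i k y := by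
  apply Af.rep_injective
  ext1 w
  rw [map_mul]
  change Af.rep _ (Af.rep _ w) = _
  rw [rep_gaugeChange, rep_gaugeChange, rep_gaugeChange, LinearEquiv.symm_apply_apply]

theorem contMDiffAt_gaugeChange {i j y : X} (hi : y ∈ (B.gaugeAt i).base)
    (hj : y ∈ (B.gaugeAt j).base) :
    ContMDiffAt 𝓘(ℝ, V) 𝓘(ℝ, AfLie n) ∞ (B.gaugeChange i j) y := by
  refine contMDiffAt_Af_iff.2 (contMDiffAt_clm_of_apply fun w => ?_)
  simp only [rep_gaugeChange]
  exact ((B.gaugeAt j).contMDiffAt_section_iff hj).1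
    ((B.gaugeAt i).contMDiffAt_symm (h := fun _ => w) hi contMDiffAt_id contMDiffAt_const)

/-- A change of trivializations of the frame bundle is smooth. -/
theorem contMDiffAt_gaugeChange_mul {E' H' N : Type*} [NormedAddCommGroup E'] [NormedSpace ℝ E']
    [TopologicalSpace H'] {J : ModelWithCorners ℝ E' H'} [TopologicalSpace N] [ChartedSpace H' N]
    {i j : X} {f : N → X} {g : N → Af n} {m : N} (hi : f m ∈ (B.gaugeAt i).base)
    (hj : f m ∈ (B.gaugeAt j).base) (hf : ContMDiffAt J 𝓘(ℝ, V) ∞ f m)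
    (hg : ContMDiffAt J 𝓘(ℝ, AfLie n) ∞ g m) :
    ContMDiffAt J 𝓘(ℝ, AfLie n) ∞ (fun z => B.gaugeChange i j (f z) * g z) m :=
  ((B.contMDiffAt_gaugeChange hi hj).comp m hf).af_mul hg

/-- The cocycle of the frame bundle. -/
def frameCore : FiberBundleCore X X (Af n) where
  baseSet i := (B.gaugeAt i).base
  isOpen_baseSet i := (B.gaugeAt i).isOpen_base
  indexAt := id
  mem_baseSet_at := B.mem_gaugeAt
  coordChange i j y g := B.gaugeChange i j y * g
  coordChange_self i y _ g := by rw [gaugeChange_self, one_mul]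
  continuousOn_coordChange i j := by
    rintro ⟨y, g⟩ ⟨⟨h1, h2⟩, -⟩
    exact (B.contMDiffAt_gaugeChange_mul (J := 𝓘(ℝ, V).prod 𝓘(ℝ, AfLie n)) (m := (y, g)) h1 h2
      contMDiffAt_fst contMDiffAt_snd).continuousAt.continuousWithinAt
  coordChange_comp i j k y _ g := by rw [← mul_assoc, gaugeChange_mul]

/-- The bundle of adapted frames of an extension. -/
def FrameBundle : Type u := TotalSpace (Af n) B.frameCore.Fiber

instance : TopologicalSpace B.FrameBundle :=
  inferInstanceAs (TopologicalSpace (TotalSpace (Af n) B.frameCore.Fiber))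

/-- The frame bundle is covered by trivializations. -/
abbrev frameBundleCharts : ChartedSpace (X × Af n) B.FrameBundle :=
  inferInstanceAs (ChartedSpace (X × Af n) (TotalSpace (Af n) B.frameCore.Fiber))

instance : ChartedSpace (ModelProd V (AfLie n)) B.FrameBundle :=
  letI := B.frameBundleCharts
  ChartedSpace.comp (ModelProd V (AfLie n)) (X × Af n) B.FrameBundle

/-- The projection of the frame bundle. -/
def frameProj : B.FrameBundle → X := TotalSpace.proj

/-- The trivialization of the frame bundle defined by an adapted gauge. -/
def frameTriv (i : X) : Trivialization (Af n) B.frameProj := B.frameCore.localTriv i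

/-- A frame in the adapted gauge at its base point. -/
def frameVal (p : B.FrameBundle) : Af n := TotalSpace.snd p

theorem frameTriv_apply (i : X) (p : B.FrameBundle) : B.frameTriv i p =
    (B.frameProj p, B.gaugeChange (B.frameProj p) i (B.frameProj p) * B.frameVal p) := rfl

theorem frameTriv_mem_atlas (i : X) :
    letI := B.frameBundleCharts
    (B.frameTriv i).toOpenPartialHomeomorph ∈ atlas (X × Af n) B.FrameBundle :=
  ⟨B.frameCore.localTriv i, ⟨i, rfl⟩, rfl⟩

theorem frameTriv_symm_apply (i j : X) {q : X × Af n} (hq : q ∈ (B.frameTriv i).target) :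
    B.frameTriv j ((B.frameTriv i).toOpenPartialHomeomorph.symm q) =
      (q.1, B.gaugeChange i j q.1 * q.2) := by
  have h1 := (B.frameTriv i).apply_symm_apply hq
  rw [frameTriv_apply] at h1 ⊢
  have h2 := congrArg Prod.fst h1
  have h3 := congrArg Prod.snd h1
  simp only at h2 h3
  rw [h2] at h3 ⊢
  rw [← h3, ← mul_assoc, gaugeChange_mul]

/-- In trivializations the changes of charts multiply the group coordinate on the left by
`gaugeChange i j`, which is a smooth function of the base point. -/
instance [IsManifold 𝓘(ℝ, V) ∞ X] : IsManifold (totalModel V n) ∞ B.FrameBundle := by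
  let := B.frameBundleCharts
  refine isManifold_comp (I := totalModel V n) (H' := X × Af n) ?_
  rintro _ ⟨_, ⟨i, rfl⟩, rfl⟩ _ ⟨_, ⟨j, rfl⟩, rfl⟩
  rintro q ⟨hq1, hq2⟩
  have hi : q.1 ∈ (B.gaugeAt i).base := (B.frameTriv i).mem_target.1 hq1
  have hj : q.1 ∈ (B.gaugeAt j).base := hq2
  refine ContMDiffAt.contMDiffWithinAt ?_
  have h1 : ContMDiffAt (𝓘(ℝ, V).prod 𝓘(ℝ, AfLie n)) (𝓘(ℝ, V).prod 𝓘(ℝ, AfLie n)) ∞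
      (fun z : X × Af n => (z.1, B.gaugeChange i j z.1 * z.2)) q :=
    contMDiffAt_fst.prodMk
      (B.contMDiffAt_gaugeChange_mul hi hj contMDiffAt_fst contMDiffAt_snd)
  refine h1.congr_of_eventuallyEq ?_
  filter_upwards [(B.frameTriv i).open_target.mem_nhds hq1] with z hz
  exact B.frameTriv_symm_apply i j hz

theorem contMDiffOn_frameTriv [IsManifold 𝓘(ℝ, V) ∞ X] (i : X) :
    ContMDiffOn (totalModel V n) (𝓘(ℝ, V).prod 𝓘(ℝ, AfLie n)) ∞ (B.frameTriv i)
      (B.frameTriv i).source :=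
  letI := B.frameBundleCharts
  contMDiffOn_of_mem_atlas_comp (I := totalModel V n) (H' := X × Af n) (B.frameTriv_mem_atlas i)
    inferInstance

theorem contMDiffOn_frameTriv_symm [IsManifold 𝓘(ℝ, V) ∞ X] (i : X) :
    ContMDiffOn (𝓘(ℝ, V).prod 𝓘(ℝ, AfLie n)) (totalModel V n) ∞
      (B.frameTriv i).toOpenPartialHomeomorph.symm (B.frameTriv i).target :=
  letI := B.frameBundleCharts
  contMDiffOn_symm_of_mem_atlas_comp (I := totalModel V n) (H' := X × Af n)
    (B.frameTriv_mem_atlas i) inferInstance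

instance : MulAction (Af n)ᵐᵒᵖ B.FrameBundle where
  smul g p := (⟨B.frameProj p, (B.frameVal p * g.unop : Af n)⟩ :
    TotalSpace (Af n) B.frameCore.Fiber)
  one_smul p := congrArg (TotalSpace.mk (B.frameProj p)) (mul_one (B.frameVal p))
  mul_smul g h p := congrArg (TotalSpace.mk (B.frameProj p))
    (mul_assoc (B.frameVal p) h.unop g.unop).symm

theorem frameProj_smul (g : Af n) (p : B.FrameBundle) :
    B.frameProj (MulOpposite.op g • p) = B.frameProj p := rfl

/-- Left multiplication by the gauge changes commutes with right multiplication, so the action,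
defined in the gauge at the base point, is right multiplication in every trivialization. -/
theorem frameTriv_smul (i : X) (g : Af n) (p : B.FrameBundle) :
    B.frameTriv i (MulOpposite.op g • p) = ((B.frameTriv i p).1, (B.frameTriv i p).2 * g) :=
  congrArg (Prod.mk (B.frameProj p)) (mul_assoc _ _ _).symm

theorem mem_frameTriv_source (p : B.FrameBundle) : p ∈ (B.frameTriv (B.frameProj p)).source :=
  (B.frameTriv _).mem_source.2 (B.mem_gaugeAt _)

variable [IsManifold 𝓘(ℝ, V) ∞ X]

/-- The principal bundle of adapted frames of an extension. -/
def frameBundle : AffineBundle.{u, v} V X n where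
  carrier := B.FrameBundle
  proj := B.frameProj
  contMDiff_proj p := by
    have hp := B.mem_frameTriv_source p
    exact contMDiffAt_fst.comp p
      ((B.contMDiffOn_frameTriv _).contMDiffAt ((B.frameTriv _).open_source.mem_nhds hp))
  contMDiff_action := by
    rintro ⟨p, g⟩
    set e := B.frameTriv (B.frameProj p)
    have hp : p ∈ e.source := B.mem_frameTriv_source p
    have h1 : ContMDiffAt ((totalModel V n).prod 𝓘(ℝ, AfLie n)) (𝓘(ℝ, V).prod 𝓘(ℝ, AfLie n)) ∞
        (fun q : B.FrameBundle × Af n => e q.1) (p, g) :=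
      ContMDiffAt.comp (p, g) ((B.contMDiffOn_frameTriv _).contMDiffAt
        (e.open_source.mem_nhds hp)) contMDiffAt_fst
    have h2 : ContMDiffAt ((totalModel V n).prod 𝓘(ℝ, AfLie n)) (𝓘(ℝ, V).prod 𝓘(ℝ, AfLie n)) ∞
        (fun q : B.FrameBundle × Af n => ((e q.1).1, (e q.1).2 * q.2)) (p, g) :=
      (contMDiffAt_fst.comp (p, g) h1).prodMk
        (ContMDiffAt.af_mul (contMDiffAt_snd.comp (p, g) h1) contMDiffAt_snd)
    have h3 : ((e p).1, (e p).2 * g) ∈ e.target := e.mem_target.2 (B.mem_gaugeAt _)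
    have h4 := ((B.contMDiffOn_frameTriv_symm (B.frameProj p)).contMDiffAt
      (e.open_target.mem_nhds h3))
    refine (ContMDiffAt.comp (p, g) h4 h2).congr_of_eventuallyEq ?_
    have hev : ∀ᶠ q : B.FrameBundle × Af n in 𝓝 (p, g), q.1 ∈ e.source :=
      continuousAt_fst.eventually (e.open_source.mem_nhds hp)
    filter_upwards [hev] with q hq
    refine Eq.trans ?_ (congrArg e.toOpenPartialHomeomorph.symm (B.frameTriv_smul _ q.2 q.1))
    exact (e.toOpenPartialHomeomorph.left_inv (x := MulOpposite.op q.2 • q.1) hq).symm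
  proj_action := B.frameProj_smul
  locally_trivial x := ⟨B.frameTriv x, B.mem_gaugeAt x, B.contMDiffOn_frameTriv x,
    B.contMDiffOn_frameTriv_symm x, fun p _ g => B.frameTriv_smul x g p⟩

/-- The tautological frame at a point of the frame bundle. -/
def tautFrame (x : X) (p : B.FrameBundle) : Vec n ≃ₗ[ℂ] B.F.fib x :=
  (Af.repEquiv (B.frameTriv x p).2).trans ((B.gaugeAt x).map x).symm

-- The tautological frame is defined by the gauge chosen at the moving base point of `p`; in the
-- fixed gauge at `x` it becomes the smooth group coordinate of `p`.
omit [IsManifold 𝓘(ℝ, V) ∞ X] in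
theorem gaugeAt_map_tautFrame (x : X) (p : B.FrameBundle) (w : Vec n) :
    (B.gaugeAt x).map (B.frameProj p) (B.tautFrame (B.frameProj p) p w) =
      Af.rep (B.frameTriv x p).2 w := by
  refine (B.rep_gaugeChange _ _ _ _).symm.trans ?_
  change Af.rep _ (Af.rep (B.frameTriv _ p).2 w) = _
  simp only [frameTriv_apply]
  rw [gaugeChange_self, one_mul, map_mul]
  rfl

theorem contMDiff_tautFrame : ContMDiff ((totalModel V n).prod 𝓘(ℝ, Vec n)) (bundleModel V (n + 1)) ∞
    (fun q : B.FrameBundle × Vec n =>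
      (⟨B.frameProj q.1, B.tautFrame (B.frameProj q.1) q.1 q.2⟩ : B.F.Total)) := by
  intro q
  set x := B.frameProj q.1 with hx
  have hp : q.1 ∈ (B.frameTriv x).source := B.mem_frameTriv_source q.1
  have h0 : ContMDiffAt ((totalModel V n).prod 𝓘(ℝ, Vec n)) (𝓘(ℝ, V).prod 𝓘(ℝ, AfLie n)) ∞
      (fun z : B.FrameBundle × Vec n => B.frameTriv x z.1) q :=
    ContMDiffAt.comp q ((B.contMDiffOn_frameTriv x).contMDiffAt
      ((B.frameTriv x).open_source.mem_nhds hp)) contMDiffAt_fst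
  refine ((B.gaugeAt x).contMDiffAt_iff (B.mem_gaugeAt x)).2 ⟨contMDiffAt_fst.comp q h0, ?_⟩
  have h1 : ContMDiffAt ((totalModel V n).prod 𝓘(ℝ, Vec n)) 𝓘(ℝ, Vec n →L[ℝ] Vec n) ∞
      (fun z : B.FrameBundle × Vec n => Af.rep (B.frameTriv x z.1).2) q :=
    contMDiffAt_Af_iff.1 (contMDiffAt_snd.comp q h0)
  refine (h1.clm_apply contMDiffAt_snd).congr_of_eventuallyEq
    (Filter.Eventually.of_forall fun z => ?_)
  exact B.gaugeAt_map_tautFrame x z.1 z.2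

/-- The tautological frames of the frame bundle. -/
def frameBundleFrameData : FrameData B.frameBundle B where
  frame x p _ := B.tautFrame x p
  contMDiff_frame := B.contMDiff_tautFrame
  frame_action x p _ g w := by
    refine congrArg ((B.gaugeAt x).map x).symm ?_
    refine (congrArg (fun q : X × Af n => Af.rep q.2 w) (B.frameTriv_smul x g p)).trans ?_
    exact congrArg (fun T : Vec n →L[ℝ] Vec n => T w) (map_mul Af.rep (B.frameTriv x p).2 g)
  quot_frame x p hp w := (B.quot_gaugeAt_symm x x _).trans (Af.rep_last _ w)

end Extn

/-! ### Frame bundles of flat extensions and the equivalence -/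

variable {V : Type v} [NormedAddCommGroup V] [NormedSpace ℝ V] [FiniteDimensional ℝ V]
  {X : Type u} [TopologicalSpace X] [T2Space X] [ChartedSpace V X] [IsManifold 𝓘(ℝ, V) ∞ X] {n : ℕ}

namespace FlatExtn

variable (B : FlatExtn.{u, v} V X n)

/-- The flat affine bundle of frames of a flat extension. -/
def flatFrameBundle : FlatAffineBundle.{u, v} V X n where
  toAffineBundle := B.frameBundle
  conn := B.frameBundleFrameData.inducedForm B.induces_trivial
  flat := (B.frameBundleFrameData.compatible_inducedForm B.induces_trivial).isFlat_iff.2 B.flat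

/-- A flat extension is associated with its frame bundle. -/
def frameBundleAssociatedExtn : AssociatedExtn B.flatFrameBundle B :=
  AssociatedExtn.ofFrameData B.frameBundleFrameData
    (B.frameBundleFrameData.compatible_inducedForm B.induces_trivial)

end FlatExtn

/-- Both `B` and the extension constructed from its frame bundle are associated with that bundle,
and extensions associated with the same bundle are isomorphic. -/
instance : (FlatAffineBundle.flatExtnFunctor.{u, v} V X n).EssSurj where
  mem_essImage B :=
    ⟨B.flatFrameBundle, ⟨B.flatFrameBundle.associatedExtn.iso B.frameBundleAssociatedExtn⟩⟩

instance : (FlatAffineBundle.flatExtnFunctor.{u, v} V X n).IsEquivalence where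

end FlatAffine

end

theorem lemma3p1 {V : Type v} [NormedAddCommGroup V] [NormedSpace ℝ V] [FiniteDimensional ℝ V]
    {X : Type u} [TopologicalSpace X] [T2Space X] [ChartedSpace V X] [IsManifold 𝓘(ℝ, V) ∞ X]
    (n : ℕ) :
    ∃ (e : FlatAffine.FlatAffineBundle.{u, v} V X n ≌ FlatAffine.FlatExtn.{u, v} V X n)
      (assoc : ∀ A : FlatAffine.FlatAffineBundle.{u, v} V X n,
        FlatAffine.AssociatedExtn A (e.functor.obj A)),
      ∀ (A B : FlatAffine.FlatAffineBundle.{u, v} V X n) (f : A ⟶ B) (x : X) (p : A.carrier)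
        (hp : A.proj p = x) (w : Fin (n + 1) → ℂ),
        (e.functor.map f).ψ x ((assoc A).frame x p hp w) =
          (assoc B).frame x (f.toFun p) ((f.proj_toFun p).trans hp) w :=
  ⟨(FlatAffine.FlatAffineBundle.flatExtnFunctor V X n).asEquivalence,
    fun A => A.associatedExtn,
    fun _ _ f _ _ hp w => FlatAffine.FlatAffineBundle.flatExtnFunctor_map_frame f hp w⟩
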